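/- Let $n\ge 1$, let $p$ be an odd prime, let $\psi$ be the trivial character $\chi_0$ or the quadratic character $\chi_p$ modulo $p$, and let $k\in\mathbb Z$ with $\psi(-1)=(-1)^k$. Write elements of $\mathrm{GSp}^+(n,\mathbb R)$ (real symplectic similitudes $g$ with similitude $\mu(g)>0$) as $g=\begin{pmatrix}A_g&B_g\\C_g&D_g\end{pmatrix}$; on the Siegel upper half space $\mathfrak H_n$ put $g\langle Z\rangle=(A_gZ+B_g)(C_gZ+D_g)^{-1}$, $j(g,Z)=\mu(g)^{-n/2}\det(C_gZ+D_g)$ and $(f|_kg)(Z)=j(g,Z)^{-k}f(g\langle Z\rangle)$. Let $\Gamma_0=\{\gamma\in\mathrm{Sp}(n,\mathbb Z): C_\gamma\equiv 0 \bmod p\}$, $P=\{\gamma\in \mathrm{Sp}(n,\mathbb Z): C_\gamma=0\}$, and for $0\le r\le n$ let $w_r\in\mathrm{Sp}(n,\mathbb Z)$ have blocks $A=D=\mathrm{diag}(0_r,1_{n-r})$ and $C=-B=\mathrm{diag}(1_r,0_{n-r})$. For $\gamma=\eta w_r\kappa$ with $\eta\in P$, $\kappa\in\Gamma_0$ put $\psi^*(\gamma)=\psi(\det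 D_\eta)\psi(\det D_\kappa)$ (this is well defined), and for $Z=X+iY\in\mathfrak H_n$ and $2\,\mathrm{Re}(s)>n+1$ let $$E(w_r;Z,s)=\det(Y)^{s-k/2}\sum_{\gamma\in P\backslash Pw_r\Gamma_0}\psi^*(\gamma)\,j(\gamma,Z)^{-k}|j(\gamma,Z)|^{-2s+k}.$$ Let $\mathcal E_{k,s}$ be the $\mathbb C$-span of the functions $E(w_r;\,\cdot\,,s)$, $0\le r\le n$. With $\tau_p=\mathrm{diag}(1_n,p1_n)$, the operator $U(p)$ acts on functions $f$ on $\mathfrak H_n$ with $f|_k\gamma=\psi(\det D_\gamma)f$ for all $\gamma\in\Gamma_0$ by $$U(p)f=p^{nk/2-n(n+1)/2}\sum_{\gamma\in\Gamma_0\backslash\Gamma_0\tau_p\Gamma_0}\psi(\det A_\gamma)\,f|_k\gamma .$$ Put $l(s,j)=n(k/2-s)+2sj-j(j+1)/2$. 1. For every $s$ with $2\,\mathrm{Re}(s)>n+1$ the space $\mathcal E_{k,s}$ is stable under $U(p)$, and the set of eigenvalues of $U(p)$ on it is $\{p^{l(s,j)}: 0\le j\le n\}$. 2. If $k>n+1$,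 the space of holomorphic Siegel Eisenstein series, spanned by $\sum_{\gamma\in P\backslash Pw_r\Gamma_0}\psi^*(\gamma)j(\gamma,Z)^{-k}$ $(0\le r\le n)$, which is $\mathcal E_{k,k/2}$, is stable under $U(p)$, and the set of eigenvalues of $U(p)$ on it is $\{p^{kj-j(j+1)/2}: 0\le j\le n\}$. 3. Let $E(w_r;Z,s)$ now denote the meromorphic continuation to all $s\in\mathbb C$, for each $Z\in\mathfrak H_n$ and $0\le r\le n$. Outside a closed discrete set of $s$ the $n+1$ functions $E(w_r;\,\cdot\,,s)$ are linearly independent (whatever values are assigned at poles). At every $s$ at which all of the $E(w_r;Z,\cdot)$ (all $r$, all $Z$) are holomorphic, the span $\mathcal E_{k,s}$ is stable under $U(p)$ and every eigenvalue of $U(p)$ on it lies in $\{p^{l(s,j)}:0\le j\le n\}$; if moreover the $n+1$ functions $E(w_r;\,\cdot\,,s)$ are linearly independent, i.e. $\dim\mathcal E_{k,s}=n+1$, the set of eigenvalues is exactly $\{p^{l(s,j)}:0\le j\le n\}$, and in particular it is $\{p^{kj-j(j+1)/2}:0\le j\le n\}$ if $s=k/2$. -/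

import Mathlib

open Matrix

noncomputable section

namespace SiegelEisenstein

/-! ### The Siegel upper half space and the group of positive symplectic similitudes -/

/-- The Siegel upper half space of degree `n`: symmetric complex `n × n` matrices with positive
definite imaginary part. -/
def UpperHalfSpace (n : ℕ) : Type :=
  {Z : Matrix (Fin n) (Fin n) ℂ // Z.IsSymm ∧ (Z.map Complex.im).PosDef}

/-- Elements of `GSp⁺(n, ℝ)`: a real matrix `g` together with its similitude `μ > 0`,
`ᵗg J g = μ J` (for `n ≥ 1` the number `μ` is determined by `g`). -/
structure GSpPos (n : ℕ) where
  mat : Matrix (Fin n ⊕ Fin n) (Fin n ⊕ Fin n) ℝ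
  mu : ℝ
  mu_pos : 0 < mu
  transpose_mul : matᵀ * J (Fin n) ℝ * mat = mu • J (Fin n) ℝ

/-- A real matrix, regarded as a complex one. -/
abbrev toC {n : ℕ} (A : Matrix (Fin n) (Fin n) ℝ) : Matrix (Fin n) (Fin n) ℂ :=
  A.map Complex.ofRealHom

/-- The `n × n` block `A_g Z + B_g`. -/
def num {n : ℕ} (g : GSpPos n) (Z : UpperHalfSpace n) : Matrix (Fin n) (Fin n) ℂ :=
  toC g.mat.toBlocks₁₁ * Z.1 + toC g.mat.toBlocks₁₂

/-- The `n × n` block `C_g Z + D_g`. -/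
def den {n : ℕ} (g : GSpPos n) (Z : UpperHalfSpace n) : Matrix (Fin n) (Fin n) ℂ :=
  toC g.mat.toBlocks₂₁ * Z.1 + toC g.mat.toBlocks₂₂

lemma block_identity {n : ℕ} (g : GSpPos n) (W Z : Matrix (Fin n) (Fin n) ℂ) :
    (W * (toC g.mat.toBlocks₂₁)ᵀ + (toC g.mat.toBlocks₂₂)ᵀ) *
        (toC g.mat.toBlocks₁₁ * Z + toC g.mat.toBlocks₁₂) -
      (W * (toC g.mat.toBlocks₁₁)ᵀ + (toC g.mat.toBlocks₁₂)ᵀ) *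
        (toC g.mat.toBlocks₂₁ * Z + toC g.mat.toBlocks₂₂) = (g.mu : ℂ) • (Z - W) := by
  have h : (g.mat.map Complex.ofRealHom)ᵀ * J (Fin n) ℂ * g.mat.map Complex.ofRealHom =
      (g.mu : ℂ) • J (Fin n) ℂ := by
    have := congrArg (fun M => M.map Complex.ofRealHom) g.transpose_mul
    simp only [Matrix.map_mul, map_J, transpose_map] at this
    rw [this, ← map_J (l := Fin n) Complex.ofRealHom]
    ext i j
    rw [map_apply, Matrix.smul_apply, Matrix.smul_apply, map_apply, smul_eq_mul, smul_eq_mul,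
      map_mul, Complex.ofRealHom_eq_coe]
  rw [← fromBlocks_toBlocks g.mat, fromBlocks_map] at h
  have aux : ∀ A B C D : Matrix (Fin n) (Fin n) ℂ,
      (fromBlocks A B C D)ᵀ * J (Fin n) ℂ * fromBlocks A B C D = (g.mu : ℂ) • J (Fin n) ℂ →
      (W * Cᵀ + Dᵀ) * (A * Z + B) - (W * Aᵀ + Bᵀ) * (C * Z + D) = (g.mu : ℂ) • (Z - W) := by
    intro A B C D h
    simp only [J, fromBlocks_transpose, fromBlocks_multiply, fromBlocks_smul, fromBlocks_inj,
      mul_zero, mul_one, zero_add, mul_neg, add_zero, neg_mul, smul_zero, smul_neg] at h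
    obtain ⟨h1, h2, h3, h4⟩ := h
    calc _ = W * (Cᵀ * A + -(Aᵀ * C)) * Z + W * (Cᵀ * B + -(Aᵀ * D)) +
          (Dᵀ * A + -(Bᵀ * C)) * Z + (Dᵀ * B + -(Bᵀ * D)) := by noncomm_ring
      _ = _ := by
        rw [h1, h2, h3, h4]
        simp [smul_sub]
        abel
  exact aux _ _ _ _ h

lemma toC_conjTranspose {n : ℕ} (A : Matrix (Fin n) (Fin n) ℝ) : (toC A)ᴴ = (toC A)ᵀ := by
  ext i j
  simp

lemma sub_conjTranspose {n : ℕ} {Z : Matrix (Fin n) (Fin n) ℂ} (hZ : Z.IsSymm) :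
    Z - Zᴴ = (2 * Complex.I) • toC (Z.map Complex.im) := by
  ext i j
  have hij : Z j i = Z i j := hZ.apply i j
  simp only [Matrix.sub_apply, conjTranspose_apply, Matrix.smul_apply, map_apply, hij,
    smul_eq_mul, Complex.star_def, Complex.sub_conj, Complex.ofRealHom_eq_coe]
  push_cast
  ring

open scoped ComplexOrder in
lemma posDef_toC_iff {n : ℕ} {Y : Matrix (Fin n) (Fin n) ℝ} : (toC Y).PosDef ↔ Y.PosDef := by
  constructor
  · intro h
    refine PosDef.of_dotProduct_mulVec_pos ?_ ?_
    · ext i j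
      have := congrFun (congrFun h.1 i) j
      simpa using this
    · intro x hx
      have hx' : (fun i => (x i : ℂ)) ≠ 0 := by
        intro h0
        apply hx
        funext i
        simpa using congrFun h0 i
      have := h.dotProduct_mulVec_pos hx'
      have e : star (fun i => (x i : ℂ)) ⬝ᵥ (toC Y *ᵥ fun i => (x i : ℂ)) =
          ((star x ⬝ᵥ (Y *ᵥ x) : ℝ) : ℂ) := by
        simp [dotProduct, mulVec]
      rw [e] at this
      exact_mod_cast this
  · intro h
    refine PosDef.of_dotProduct_mulVec_pos ?_ ?_
    · ext i j
      have := congrFun (congrFun h.1 i) j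
      simp only [conjTranspose_apply, star_trivial] at this
      simp [this]
    · intro x hx
      have hsymm : ∀ i j, Y j i = Y i j := fun i j => by
        simpa using congrFun (congrFun h.1 i) j
      have key : star x ⬝ᵥ (toC Y *ᵥ x) =
          (((fun i => (x i).re) ⬝ᵥ (Y *ᵥ fun i => (x i).re) +
            (fun i => (x i).im) ⬝ᵥ (Y *ᵥ fun i => (x i).im) : ℝ) : ℂ) := by
        apply Complex.ext
        · simp only [dotProduct, mulVec, Pi.star_apply, map_apply, Complex.ofReal_re,
            Complex.re_sum, Finset.mul_sum, ← Finset.sum_add_distrib, Complex.star_def]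
          refine Finset.sum_congr rfl fun i _ => Finset.sum_congr rfl fun j _ => ?_
          simp
          try ring
        · simp only [dotProduct, mulVec, Pi.star_apply, map_apply, Complex.ofReal_im,
            Complex.im_sum, Finset.mul_sum, Complex.star_def]
          have : ∀ i j, ((starRingEnd ℂ) (x i) * (Complex.ofRealHom (Y i j) * x j)).im =
              (x i).re * Y i j * (x j).im - (x j).re * Y j i * (x i).im := by
            intro i j
            rw [hsymm i j]
            simp
            ring
          simp only [this, Finset.sum_sub_distrib]
          rw [sub_eq_zero, Finset.sum_comm]
      rw [key]
      have hpos : ∀ v : Fin n → ℝ, 0 ≤ v ⬝ᵥ (Y *ᵥ v) := fun v => by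
        simpa using h.posSemidef.dotProduct_mulVec_nonneg v
      have hpos' : ∀ v : Fin n → ℝ, v ≠ 0 → 0 < v ⬝ᵥ (Y *ᵥ v) := fun v hv => by
        simpa using h.dotProduct_mulVec_pos hv
      have : (fun i => (x i).re) ≠ 0 ∨ (fun i => (x i).im) ≠ 0 := by
        by_contra! hcon
        apply hx
        funext i
        exact Complex.ext (congrFun hcon.1 i) (congrFun hcon.2 i)
      have : 0 < (fun i => (x i).re) ⬝ᵥ (Y *ᵥ fun i => (x i).re) +
            (fun i => (x i).im) ⬝ᵥ (Y *ᵥ fun i => (x i).im) := by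
        rcases this with h1 | h1
        · exact add_pos_of_pos_of_nonneg (hpos' _ h1) (hpos _)
        · exact add_pos_of_nonneg_of_pos (hpos _) (hpos' _ h1)
      exact_mod_cast this

lemma den_transpose_mul_num {n : ℕ} (g : GSpPos n) (Z : UpperHalfSpace n) :
    (den g Z)ᵀ * num g Z = (num g Z)ᵀ * den g Z := by
  have h := block_identity g Z.1 Z.1
  have hZ : Z.1ᵀ = Z.1 := Z.2.1
  rw [sub_self, smul_zero, sub_eq_zero] at h
  simpa only [den, num, transpose_add, transpose_mul, hZ] using h

lemma den_conjTranspose_mul_num {n : ℕ} (g : GSpPos n) (Z : UpperHalfSpace n) :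
    (den g Z)ᴴ * num g Z - (num g Z)ᴴ * den g Z =
      (2 * Complex.I) • ((g.mu : ℂ) • toC (Z.1.map Complex.im)) := by
  have h := block_identity g Z.1ᴴ Z.1
  rw [sub_conjTranspose Z.2.1, smul_comm] at h
  simpa only [den, num, conjTranspose_add, conjTranspose_mul, toC_conjTranspose] using h

open scoped ComplexOrder in
lemma posDef_smul_toC_im {n : ℕ} (g : GSpPos n) (Z : UpperHalfSpace n) :
    ((g.mu : ℂ) • toC (Z.1.map Complex.im)).PosDef := by
  have : (g.mu : ℂ) • toC (Z.1.map Complex.im) = toC (g.mu • Z.1.map Complex.im) := by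
    ext i j
    simp
  rw [this, posDef_toC_iff]
  exact Z.2.2.smul g.mu_pos

open scoped ComplexOrder in
lemma isUnit_det_den {n : ℕ} (g : GSpPos n) (Z : UpperHalfSpace n) :
    IsUnit (den g Z).det := by
  rw [isUnit_iff_ne_zero]
  intro h0
  obtain ⟨v, hv, hv0⟩ := exists_mulVec_eq_zero_iff.2 h0
  have h := den_conjTranspose_mul_num g Z
  have h1 : star v ⬝ᵥ (((den g Z)ᴴ * num g Z - (num g Z)ᴴ * den g Z) *ᵥ v) = 0 := by
    rw [sub_mulVec, dotProduct_sub, ← mulVec_mulVec, ← mulVec_mulVec, hv0, mulVec_zero,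
      dotProduct_zero, dotProduct_mulVec, ← star_mulVec, hv0, star_zero, zero_dotProduct, sub_zero]
  rw [h, smul_mulVec, dotProduct_smul, smul_eq_zero] at h1
  rcases h1 with h1 | h1
  · simp at h1
  · exact ((posDef_smul_toC_im g Z).dotProduct_mulVec_pos hv).ne' h1

open scoped ComplexOrder in
lemma num_mul_den_inv_mem {n : ℕ} (g : GSpPos n) (Z : UpperHalfSpace n) :
    (num g Z * (den g Z)⁻¹).IsSymm ∧ ((num g Z * (den g Z)⁻¹).map Complex.im).PosDef := by
  have hu := isUnit_det_den g Z
  have huT : IsUnit (den g Z)ᵀ.det := by rwa [det_transpose]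
  have huH : IsUnit (den g Z)ᴴ.det := by
    rw [det_conjTranspose]
    exact hu.star
  have hs : (num g Z * (den g Z)⁻¹).IsSymm := by
    have h := den_transpose_mul_num g Z
    calc (num g Z * (den g Z)⁻¹)ᵀ
        = ((den g Z)ᵀ)⁻¹ * (num g Z)ᵀ * (den g Z * (den g Z)⁻¹) := by
          rw [mul_nonsing_inv _ hu, mul_one, transpose_mul, transpose_nonsing_inv]
      _ = ((den g Z)ᵀ)⁻¹ * ((num g Z)ᵀ * den g Z) * (den g Z)⁻¹ := by
          simp only [Matrix.mul_assoc]
      _ = ((den g Z)ᵀ)⁻¹ * (den g Z)ᵀ * num g Z * (den g Z)⁻¹ := by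
          rw [← h]
          simp only [Matrix.mul_assoc]
      _ = num g Z * (den g Z)⁻¹ := by rw [nonsing_inv_mul _ huT, one_mul]
  refine ⟨hs, ?_⟩
  have h := den_conjTranspose_mul_num g Z
  have e : num g Z * (den g Z)⁻¹ - (num g Z * (den g Z)⁻¹)ᴴ =
      ((den g Z)⁻¹)ᴴ * ((den g Z)ᴴ * num g Z - (num g Z)ᴴ * den g Z) * (den g Z)⁻¹ := by
    rw [mul_sub, sub_mul, conjTranspose_mul]
    congr 1
    · rw [← Matrix.mul_assoc, conjTranspose_nonsing_inv, nonsing_inv_mul _ huH, one_mul]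
    · rw [← Matrix.mul_assoc, Matrix.mul_assoc _ (den g Z), mul_nonsing_inv _ hu, mul_one]
  rw [h, sub_conjTranspose hs, mul_smul_comm, smul_mul_assoc] at e
  have e' := smul_right_injective _ (by simp : (2 * Complex.I) ≠ 0) e
  rw [← posDef_toC_iff, e']
  refine (posDef_smul_toC_im g Z).conjTranspose_mul_mul_same ?_
  exact mulVec_injective_of_isUnit ((isUnit_iff_isUnit_det _).2 (isUnit_nonsing_inv_det _ hu))

/-- The action `g⟨Z⟩ = (A_g Z + B_g)(C_g Z + D_g)⁻¹`. -/
def act {n : ℕ} (g : GSpPos n) (Z : UpperHalfSpace n) : UpperHalfSpace n :=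
  ⟨num g Z * (den g Z)⁻¹, num_mul_den_inv_mem g Z⟩

/-- The automorphic factor `j(g, Z) = μ(g)^{-n/2} det(C_g Z + D_g)`. -/
def autFactor {n : ℕ} (g : GSpPos n) (Z : UpperHalfSpace n) : ℂ :=
  ((g.mu ^ (-(n : ℝ) / 2) : ℝ) : ℂ) * (den g Z).det

/-- The slash operator `(f|ₖ g)(Z) = j(g, Z)^{-k} f(g⟨Z⟩)`. -/
def slash {n : ℕ} (k : ℤ) (f : UpperHalfSpace n → ℂ) (g : GSpPos n) : UpperHalfSpace n → ℂ :=
  fun Z => autFactor g Z ^ (-k) * f (act g Z)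

/-! ### Integral symplectic matrices, congruence and parabolic subgroups -/

/-- The Siegel modular group `Sp(n, ℤ)`. -/
abbrev SpZ (n : ℕ) : Type := symplecticGroup (Fin n) ℤ

/-- Integer matrices with `ᵗg J g = m J`, `m > 0`, as elements of `GSp⁺(n, ℝ)`. -/
def GSpPos.ofInt {n : ℕ} (g : Matrix (Fin n ⊕ Fin n) (Fin n ⊕ Fin n) ℤ) (m : ℕ) (hm : 0 < m)
    (h : gᵀ * J (Fin n) ℤ * g = (m : ℤ) • J (Fin n) ℤ) : GSpPos n where
  mat := g.map (Int.castRingHom ℝ)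
  mu := m
  mu_pos := by exact_mod_cast hm
  transpose_mul := by
    have := congrArg (fun M => M.map (Int.castRingHom ℝ)) h
    simp only [Matrix.map_mul, map_J, transpose_map] at this
    rw [this, ← map_J (l := Fin n) (Int.castRingHom ℝ)]
    ext i j
    rw [map_apply, Matrix.smul_apply, Matrix.smul_apply, map_apply, smul_eq_mul, smul_eq_mul,
      map_mul, eq_intCast, Int.cast_natCast]

/-- `Sp(n, ℤ)` inside `GSp⁺(n, ℝ)`. -/
def SpZ.toGSpPos {n : ℕ} (γ : SpZ n) : GSpPos n :=
  GSpPos.ofInt γ.1 1 one_pos (by simpa using SymplecticGroup.mem_iff'.1 γ.2)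

lemma toBlocks₂₁_mul {n : ℕ} (γ δ : SpZ n) : (γ * δ).1.toBlocks₂₁ =
    γ.1.toBlocks₂₁ * δ.1.toBlocks₁₁ + γ.1.toBlocks₂₂ * δ.1.toBlocks₂₁ := by
  change (γ.1 * δ.1).toBlocks₂₁ = _
  conv_lhs => rw [← fromBlocks_toBlocks γ.1, ← fromBlocks_toBlocks δ.1, fromBlocks_multiply]
  rw [toBlocks_fromBlocks₂₁]

lemma toBlocks₂₁_inv {n : ℕ} (γ : SpZ n) : (γ⁻¹).1.toBlocks₂₁ = -(γ.1.toBlocks₂₁)ᵀ := by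
  rw [SymplecticGroup.coe_inv]
  conv_lhs => rw [← fromBlocks_toBlocks γ.1]
  simp [J, fromBlocks_transpose, fromBlocks_multiply, fromBlocks_neg]

/-- The congruence subgroup `Γ₀ⁿ(p)`: `C ≡ 0 mod p`. -/
def Gamma0 (n p : ℕ) : Subgroup (SpZ n) where
  carrier := {γ | ∀ i j, (p : ℤ) ∣ γ.1.toBlocks₂₁ i j}
  one_mem' := fun i j => by
    simp [toBlocks₂₁]
  mul_mem' := fun {γ δ} hγ hδ i j => by
    rw [toBlocks₂₁_mul, Matrix.add_apply, mul_apply, mul_apply]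
    exact dvd_add (Finset.dvd_sum fun l _ => (hγ i l).mul_right _)
      (Finset.dvd_sum fun l _ => (hδ l j).mul_left _)
  inv_mem' := fun {γ} hγ i j => by
    rw [toBlocks₂₁_inv]
    exact (dvd_neg).2 (hγ j i)

/-- The Siegel parabolic subgroup `P_{0,n}(ℤ)`: `C = 0`. -/
def parabolic (n : ℕ) : Subgroup (SpZ n) where
  carrier := {γ | γ.1.toBlocks₂₁ = 0}
  one_mem' := by
    ext i j
    simp [toBlocks₂₁]
  mul_mem' := fun {γ δ} (hγ : γ.1.toBlocks₂₁ = 0) (hδ : δ.1.toBlocks₂₁ = 0) => by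
    change (γ * δ).1.toBlocks₂₁ = 0
    rw [toBlocks₂₁_mul, hγ, hδ, zero_mul, mul_zero, add_zero]
  inv_mem' := fun {γ} (hγ : γ.1.toBlocks₂₁ = 0) => by
    change (γ⁻¹).1.toBlocks₂₁ = 0
    rw [toBlocks₂₁_inv, hγ, transpose_zero, neg_zero]

/-- The representative `w_r`: with `I_r = diag(1_r, 0_{n-r})` and `I'_r = diag(0_r, 1_{n-r})`,
its blocks are `A = D = I'_r`, `B = -I_r`, `C = I_r`. -/
def w (n r : ℕ) : SpZ n :=
  ⟨fromBlocks (diagonal fun i : Fin n => if i.1 < r then 0 else 1)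
      (-diagonal fun i : Fin n => if i.1 < r then 1 else 0)
      (diagonal fun i : Fin n => if i.1 < r then 1 else 0)
      (diagonal fun i : Fin n => if i.1 < r then 0 else 1), by
    rw [SymplecticGroup.fromBlocks_mem_iff]
    simp only [transpose_neg, diagonal_transpose, neg_mul, mul_neg, diagonal_mul_diagonal,
      sub_neg_eq_add, diagonal_add]
    refine ⟨?_, ?_, ?_⟩
    · congr 1; funext i; split_ifs <;> simp
    · congr 2; funext i; split_ifs <;> simp
    · rw [← diagonal_one]; congr 1; funext i; split_ifs <;> simp⟩

/-! ### Eisenstein series -/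

/-- `ψ(det M)` for an integer matrix `M`. -/
def charDet {n p : ℕ} (ψ : DirichletCharacter ℂ p) (M : Matrix (Fin n) (Fin n) ℤ) : ℂ :=
  ψ ((M.det : ℤ) : ZMod p)

/-- The double coset `P_{0,n}(ℤ) w_r Γ₀ⁿ(p)`. -/
def cell (n p r : ℕ) : Set (SpZ n) :=
  {γ | ∃ x : SpZ n × SpZ n, x.1 ∈ parabolic n ∧ x.2 ∈ Gamma0 n p ∧ γ = x.1 * w n r * x.2}

open Classical in
/-- The function `ψ*(γ) = ψ(det D_η) ψ(det D_κ)` for `γ = η w_r κ` with `η ∈ P_{0,n}(ℤ)` and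
`κ ∈ Γ₀ⁿ(p)` (for `ψ` trivial or quadratic the value does not depend on the decomposition). -/
def psiStar {n p : ℕ} (ψ : DirichletCharacter ℂ p) (r : ℕ) (γ : SpZ n) : ℂ :=
  if h : γ ∈ cell n p r then
    charDet ψ h.choose.1.1.toBlocks₂₂ * charDet ψ h.choose.2.1.toBlocks₂₂
  else 0

/-- The set `P_{0,n}(ℤ) \ P_{0,n}(ℤ) w_r Γ₀ⁿ(p)` of left `P_{0,n}(ℤ)`-orbits. -/
def CellQuotient (n p r : ℕ) : Type :=
  {q : Quotient (QuotientGroup.rightRel (parabolic n)) //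
    ∃ γ ∈ cell n p r, (Quotient.mk _ γ : Quotient (QuotientGroup.rightRel (parabolic n))) = q}

/-- A representative of an orbit. -/
def CellQuotient.rep {n p r : ℕ} (q : CellQuotient n p r) : SpZ n := Quotient.out q.1

/-- The Siegel Eisenstein series
`E(w_r; Z, s) = det(Y)^{s-k/2} ∑_γ ψ*(γ) j(γ, Z)^{-k} |j(γ, Z)|^{-2s+k}`, where `γ` runs through
`P_{0,n}(ℤ) \ P_{0,n}(ℤ) w_r Γ₀ⁿ(p)`. It converges absolutely for `Re(2s) > n + 1`, and the
summand does not depend on the representative of the orbit if `ψ(-1) = (-1)^k`. -/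
def eisenstein {n p : ℕ} (ψ : DirichletCharacter ℂ p) (k : ℤ) (r : ℕ) (Z : UpperHalfSpace n)
    (s : ℂ) : ℂ :=
  (((Z.1.map Complex.im).det : ℝ) : ℂ) ^ (s - (k : ℂ) / 2) *
    ∑' q : CellQuotient n p r, psiStar ψ r q.rep * autFactor q.rep.toGSpPos Z ^ (-k) *
      ((‖autFactor q.rep.toGSpPos Z‖ : ℝ) : ℂ) ^ (-2 * s + k)

/-- The holomorphic Siegel Eisenstein series `∑_γ ψ*(γ) j(γ, Z)^{-k}` of weight `k`. -/
def holEisenstein {n p : ℕ} (ψ : DirichletCharacter ℂ p) (k : ℤ) (r : ℕ)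
    (Z : UpperHalfSpace n) : ℂ :=
  ∑' q : CellQuotient n p r, psiStar ψ r q.rep * autFactor q.rep.toGSpPos Z ^ (-k)

lemma eisenstein_half {n p : ℕ} (ψ : DirichletCharacter ℂ p) (k : ℤ) (r : ℕ)
    (Z : UpperHalfSpace n) : eisenstein ψ k r Z ((k : ℂ) / 2) = holEisenstein ψ k r Z := by
  have h : -2 * ((k : ℂ) / 2) + k = 0 := by ring
  simp only [eisenstein, holEisenstein, h, sub_self, Complex.cpow_zero, mul_one, one_mul]

/-- `F` is the meromorphic continuation to the whole `s`-plane of `s ↦ E(w_r; Z, s)`, for every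
`Z`. -/
def IsMeromorphicContinuation {n p : ℕ} (ψ : DirichletCharacter ℂ p) (k : ℤ) (r : ℕ)
    (F : UpperHalfSpace n → ℂ → ℂ) : Prop :=
  ∀ Z, Meromorphic (F Z) ∧ ∀ s : ℂ, (n : ℝ) + 1 < 2 * s.re → F Z s = eisenstein ψ k r Z s

/-! ### The operator `U(p)` -/

/-- The matrix `τ_p = diag(1_n, p 1_n)`. -/
def tau (n p : ℕ) : Matrix (Fin n ⊕ Fin n) (Fin n ⊕ Fin n) ℤ :=
  fromBlocks 1 0 0 ((p : ℤ) • 1)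

/-- The double coset `Γ₀ⁿ(p) τ_p Γ₀ⁿ(p)`. -/
def HeckeCoset (n p : ℕ) : Type :=
  {g : Matrix (Fin n ⊕ Fin n) (Fin n ⊕ Fin n) ℤ //
    ∃ a ∈ Gamma0 n p, ∃ b ∈ Gamma0 n p, g = a.1 * tau n p * b.1}

lemma tau_similitude (n p : ℕ) :
    (tau n p)ᵀ * J (Fin n) ℤ * tau n p = (p : ℤ) • J (Fin n) ℤ := by
  simp [tau, J, fromBlocks_transpose, fromBlocks_multiply, fromBlocks_smul]

lemma HeckeCoset.similitude {n p : ℕ} (g : HeckeCoset n p) :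
    g.1ᵀ * J (Fin n) ℤ * g.1 = (p : ℤ) • J (Fin n) ℤ := by
  obtain ⟨a, -, b, -, h⟩ := g.2
  have ha := SymplecticGroup.mem_iff'.1 a.2
  have hb := SymplecticGroup.mem_iff'.1 b.2
  rw [h, transpose_mul, transpose_mul]
  calc _ = b.1ᵀ * ((tau n p)ᵀ * (a.1ᵀ * J (Fin n) ℤ * a.1) * tau n p) * b.1 := by
        simp only [Matrix.mul_assoc]
    _ = _ := by rw [ha, tau_similitude, mul_smul_comm, smul_mul_assoc, hb]

/-- Elements of `Γ₀ⁿ(p) τ_p Γ₀ⁿ(p)` in `GSp⁺(n, ℝ)`; their similitude is `p`. -/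
def HeckeCoset.toGSpPos {n p : ℕ} [Fact p.Prime] (g : HeckeCoset n p) : GSpPos n :=
  GSpPos.ofInt g.1 p (Fact.out : p.Prime).pos g.similitude

/-- Two elements of `Γ₀ⁿ(p) τ_p Γ₀ⁿ(p)` are equivalent if they lie in the same left
`Γ₀ⁿ(p)`-orbit. -/
def heckeSetoid (n p : ℕ) : Setoid (HeckeCoset n p) where
  r g h := ∃ γ ∈ Gamma0 n p, h.1 = γ.1 * g.1
  iseqv :=
    { refl := fun g => ⟨1, one_mem _, by simp⟩
      symm := fun {g h} ⟨γ, hγ, e⟩ => ⟨γ⁻¹, inv_mem hγ, by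
        rw [e, ← Matrix.mul_assoc, ← Submonoid.coe_mul, inv_mul_cancel, Submonoid.coe_one,
          one_mul]⟩
      trans := fun {g h i} ⟨γ, hγ, e⟩ ⟨δ, hδ, e'⟩ => ⟨δ * γ, mul_mem hδ hγ, by
        rw [e', e, Submonoid.coe_mul, Matrix.mul_assoc]⟩ }

/-- The operator
`U(p) f = p^{nk/2 - n(n+1)/2} ∑_γ ψ(det A_γ) f|ₖ γ`, `γ` running through the finite set
`Γ₀ⁿ(p) \ Γ₀ⁿ(p) τ_p Γ₀ⁿ(p)`. The summand does not depend on the representative of an orbit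
if `f|ₖ γ = ψ(det D_γ) f` for all `γ ∈ Γ₀ⁿ(p)`. -/
def heckeU {n p : ℕ} [Fact p.Prime] (ψ : DirichletCharacter ℂ p) (k : ℤ)
    (f : UpperHalfSpace n → ℂ) : UpperHalfSpace n → ℂ :=
  fun Z => (p : ℂ) ^ ((n : ℂ) * k / 2 - (n : ℂ) * (n + 1) / 2) *
    ∑ᶠ q : Quotient (heckeSetoid n p),
      charDet ψ q.out.1.toBlocks₁₁ * slash k f q.out.toGSpPos Z

/-- `c` is an eigenvalue of `U` on `V`. -/
def IsEigenvalue {X : Type*} (U : (X → ℂ) → X → ℂ) (V : Submodule ℂ (X → ℂ)) (c : ℂ) : Prop :=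
  ∃ f ∈ V, f ≠ 0 ∧ U f = c • f

/-- The space `V` is stable under `U`, and the set of eigenvalues of `U` on `V` is `S`. -/
def EigenvaluesAre {X : Type*} (U : (X → ℂ) → X → ℂ) (V : Submodule ℂ (X → ℂ)) (S : Set ℂ) :
    Prop :=
  (∀ f ∈ V, U f ∈ V) ∧ {c | IsEigenvalue U V c} = S

/-- The space of functions on the upper half space spanned by `E_0, …, E_n`. -/
def spanOf {n : ℕ} (E : Fin (n + 1) → UpperHalfSpace n → ℂ) :
    Submodule ℂ (UpperHalfSpace n → ℂ) :=
  Submodule.span ℂ (Set.range E)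

/-- The space of Siegel Eisenstein series spanned by `E(w_r; ·, s)`, `0 ≤ r ≤ n`. -/
def eisSpace (n : ℕ) {p : ℕ} (ψ : DirichletCharacter ℂ p) (k : ℤ) (s : ℂ) :
    Submodule ℂ (UpperHalfSpace n → ℂ) :=
  spanOf fun r Z => eisenstein ψ k r Z s

/-- The space of holomorphic Siegel Eisenstein series of weight `k`. -/
def holEisSpace (n : ℕ) {p : ℕ} (ψ : DirichletCharacter ℂ p) (k : ℤ) :
    Submodule ℂ (UpperHalfSpace n → ℂ) :=
  spanOf fun r Z => holEisenstein ψ k r Z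

/-- `l(s, j) = n(k/2 - s) + 2sj - j(j+1)/2`. -/
def ell (n : ℕ) (k : ℤ) (s : ℂ) (j : ℕ) : ℂ :=
  n * ((k : ℂ) / 2 - s) + 2 * s * j - (j : ℂ) * (j + 1) / 2

/-- The set `{p^{l(s, j)} | 0 ≤ j ≤ n}`. -/
def eigenSet (n p : ℕ) (k : ℤ) (s : ℂ) : Set ℂ :=
  {c | ∃ j : ℕ, j ≤ n ∧ c = (p : ℂ) ^ ell n k s j}

/-- The set `{p^{kj - j(j+1)/2} | 0 ≤ j ≤ n}`. -/
def holEigenSet (n p : ℕ) (k : ℤ) : Set ℂ :=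
  {c | ∃ j : ℕ, j ≤ n ∧ c = (p : ℂ) ^ ((k : ℂ) * j - (j : ℂ) * (j + 1) / 2)}

/-- The quadratic character `χ_p` modulo `p`. -/
def chiQuad (p : ℕ) [Fact p.Prime] : DirichletCharacter ℂ p :=
  (quadraticChar (ZMod p)).ringHomComp (Int.castRingHom ℂ)

end SiegelEisenstein

end

open SiegelEisenstein

/-! Everything is transferred to functions `φ` on `Sp(n, ℤ)` that transform by `ψ(det D)` under `P`
on the left and `Γ₀(p)` on the right. Each such `φ` has an Eisenstein series `eisOf k φ`, a sum over
`P \ Sp(n, ℤ)`, and `E(w_r; ·, s)` is the case `φ = psiStar ψ r`. The double cosets `P w_r Γ₀(p)`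
are separated by the rank of `C` modulo `p` and cover the group (`exists_mem_cell`), so the
functions `psiStar ψ r` form a basis of these `φ`, with coordinates the values at the `w_j`
(`eq_sum_psiStar`).

For `g` in the Hecke double coset, `γ g` can be written `b δ` with `b` block upper triangular and
`δ` in `Sp(n, ℤ)`. This matches orbits `P γ` injectively with orbits `P δ`. If `γ` lies in the cell
of `w_r`, then `det D_b = ± p^(n-r)`, and the factor of automorphy contributes exactly `p^(s(2r-n))`
and a sign (`hFac_of_rel`). Hence slashing by `g` becomes a combinatorial operator on `φ`, up to
this power of `p` (`slash_eisOf_psiStar`), and `U(p)` acts on the `n + 1` series by a matrix whose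
entries are, up to powers of `p`, the values of `heckeSum ψ (psiStar ψ r)` at `w_j`.

This matrix is triangular: a rank comparison modulo `p` kills the entries with `j < r`. With the
representatives `(1 S; 0 p)`, `S` symmetric modulo `p`, a diagonal entry counts the `S` with
vanishing upper left `r × r` block. There are `p^((n(n+1) - r(r+1))/2)` of them, and together with
the normalising powers this gives `p^(l(s, r))` (`heckeCoeff_self`). Triangularity alone confines
the eigenvalues to the diagonal entries; linear independence makes each of them occur.

Two analytic facts are needed. Absolute convergence for `2 Re s > n + 1` (`summable_autFactor`) is
proved by counting reduced representatives: Hermite reduction of the Gram matrix `C ᵗC + D ᵗD`,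
translation of `Re γ⟨i⟩` into the unit cube, and a dyadic box count show that row sizes `N_i` occur
for at most a constant times `∏ N_i^(n+1)` orbits, while `|j(γ, i)|` is at least a constant times `∏
N_i`. Linear independence (`linearIndependent_eisenstein`) follows from the limits at `i ∞` after
slashing by the `w_j`: exactly one of the series has a nonzero limit.

For the continued series, the `U(p)` relation is an identity of meromorphic functions of `s`, so it
persists wherever all terms are holomorphic. Independence is the nonvanishing of a determinant of
values at suitable points, a meromorphic function that is not identically zero. -/

noncomputable section

namespace SiegelEisenstein

/-! ### Blocks of a product -/

section Blocks

variable {R : Type*} [CommRing R] {m : Type*} [Fintype m]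

lemma toBlocks₁₁_mul' (M N : Matrix (m ⊕ m) (m ⊕ m) R) : (M * N).toBlocks₁₁ =
    M.toBlocks₁₁ * N.toBlocks₁₁ + M.toBlocks₁₂ * N.toBlocks₂₁ := by
  conv_lhs => rw [← fromBlocks_toBlocks M, ← fromBlocks_toBlocks N, fromBlocks_multiply]
  rw [toBlocks_fromBlocks₁₁]

lemma toBlocks₁₂_mul' (M N : Matrix (m ⊕ m) (m ⊕ m) R) : (M * N).toBlocks₁₂ =
    M.toBlocks₁₁ * N.toBlocks₁₂ + M.toBlocks₁₂ * N.toBlocks₂₂ := by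
  conv_lhs => rw [← fromBlocks_toBlocks M, ← fromBlocks_toBlocks N, fromBlocks_multiply]
  rw [toBlocks_fromBlocks₁₂]

lemma toBlocks₂₁_mul' (M N : Matrix (m ⊕ m) (m ⊕ m) R) : (M * N).toBlocks₂₁ =
    M.toBlocks₂₁ * N.toBlocks₁₁ + M.toBlocks₂₂ * N.toBlocks₂₁ := by
  conv_lhs => rw [← fromBlocks_toBlocks M, ← fromBlocks_toBlocks N, fromBlocks_multiply]
  rw [toBlocks_fromBlocks₂₁]

lemma toBlocks₂₂_mul' (M N : Matrix (m ⊕ m) (m ⊕ m) R) : (M * N).toBlocks₂₂ =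
    M.toBlocks₂₁ * N.toBlocks₁₂ + M.toBlocks₂₂ * N.toBlocks₂₂ := by
  conv_lhs => rw [← fromBlocks_toBlocks M, ← fromBlocks_toBlocks N, fromBlocks_multiply]
  rw [toBlocks_fromBlocks₂₂]

end Blocks

/-! ### Integral symplectic matrices and the Siegel parabolic -/

section Symplectic

variable {n : ℕ}

lemma symplectic_relations (γ : SpZ n) :
    γ.1.toBlocks₁₁ᵀ * γ.1.toBlocks₂₁ = γ.1.toBlocks₂₁ᵀ * γ.1.toBlocks₁₁ ∧
    γ.1.toBlocks₁₂ᵀ * γ.1.toBlocks₂₂ = γ.1.toBlocks₂₂ᵀ * γ.1.toBlocks₁₂ ∧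
    γ.1.toBlocks₁₁ᵀ * γ.1.toBlocks₂₂ - γ.1.toBlocks₂₁ᵀ * γ.1.toBlocks₁₂ = 1 := by
  have h := γ.2
  rw [← fromBlocks_toBlocks γ.1] at h
  exact SymplecticGroup.fromBlocks_mem_iff.1 h

lemma coe_inv_eq_fromBlocks (γ : SpZ n) : (γ⁻¹).1 =
    fromBlocks γ.1.toBlocks₂₂ᵀ (-γ.1.toBlocks₁₂ᵀ) (-γ.1.toBlocks₂₁ᵀ) γ.1.toBlocks₁₁ᵀ := by
  rw [SymplecticGroup.coe_inv]
  conv_lhs => rw [← fromBlocks_toBlocks γ.1]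
  simp [J, fromBlocks_transpose, fromBlocks_multiply, fromBlocks_neg]

lemma symplectic_relations' (γ : SpZ n) :
    γ.1.toBlocks₁₁ * γ.1.toBlocks₁₂ᵀ = γ.1.toBlocks₁₂ * γ.1.toBlocks₁₁ᵀ ∧
    γ.1.toBlocks₂₁ * γ.1.toBlocks₂₂ᵀ = γ.1.toBlocks₂₂ * γ.1.toBlocks₂₁ᵀ ∧
    γ.1.toBlocks₁₁ * γ.1.toBlocks₂₂ᵀ - γ.1.toBlocks₁₂ * γ.1.toBlocks₂₁ᵀ = 1 := by
  have h := symplectic_relations γ⁻¹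
  rw [coe_inv_eq_fromBlocks] at h
  simp only [toBlocks_fromBlocks₁₁, toBlocks_fromBlocks₁₂, toBlocks_fromBlocks₂₁,
    toBlocks_fromBlocks₂₂, transpose_transpose, transpose_neg, neg_mul, mul_neg, neg_inj,
    neg_neg] at h
  obtain ⟨h1, h2, h3⟩ := h
  refine ⟨h2.symm, h1.symm, ?_⟩
  have := congrArg transpose h3
  simpa [transpose_mul] using this

lemma coe_mul_inv_cancel (γ : SpZ n) : γ.1 * (γ⁻¹).1 = 1 := by
  rw [← Submonoid.coe_mul, mul_inv_cancel, Submonoid.coe_one]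

lemma coe_inv_mul_cancel (γ : SpZ n) : (γ⁻¹).1 * γ.1 = 1 := by
  rw [← Submonoid.coe_mul, inv_mul_cancel, Submonoid.coe_one]

lemma mem_parabolic {γ : SpZ n} : γ ∈ parabolic n ↔ γ.1.toBlocks₂₁ = 0 := Iff.rfl

/-- The Levi element with lower right block `U`. -/
def levi (U V : Matrix (Fin n) (Fin n) ℤ) (h : U * V = 1) : SpZ n :=
  ⟨fromBlocks Vᵀ 0 0 U, by
    rw [SymplecticGroup.fromBlocks_mem_iff]
    simp [mul_eq_one_comm.1 h]⟩

lemma levi_mem (U V : Matrix (Fin n) (Fin n) ℤ) (h : U * V = 1) : levi U V h ∈ parabolic n := by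
  rw [mem_parabolic, levi, toBlocks_fromBlocks₂₁]

/-- The unipotent element with upper right block `S`. -/
def unip (S : Matrix (Fin n) (Fin n) ℤ) (h : S.IsSymm) : SpZ n :=
  ⟨fromBlocks 1 S 0 1, by
    rw [SymplecticGroup.fromBlocks_mem_iff]
    simp [h.eq]⟩

lemma unip_mem (S : Matrix (Fin n) (Fin n) ℤ) (h : S.IsSymm) : unip S h ∈ parabolic n := by
  rw [mem_parabolic, unip, toBlocks_fromBlocks₂₁]

/-- The element with diagonal blocks. -/
def diagElt (a x y b : Fin n → ℤ) (h : ∀ i, a i * b i - y i * x i = 1) : SpZ n :=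
  ⟨fromBlocks (diagonal a) (diagonal x) (diagonal y) (diagonal b), by
    rw [SymplecticGroup.fromBlocks_mem_iff]
    simp only [diagonal_transpose, diagonal_mul_diagonal, diagonal_sub, h]
    refine ⟨?_, ?_, ?_⟩
    · congr 1; funext i; ring
    · congr 1; funext i; ring
    · exact diagonal_one⟩

lemma parabolic_relation {η : SpZ n} (h : η ∈ parabolic n) :
    η.1.toBlocks₁₁ᵀ * η.1.toBlocks₂₂ = 1 := by
  have := (symplectic_relations η).2.2
  rwa [mem_parabolic.1 h, transpose_zero, zero_mul, sub_zero] at this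

lemma parabolic_det {η : SpZ n} (h : η ∈ parabolic n) : IsUnit η.1.toBlocks₂₂.det := by
  have := congrArg det (parabolic_relation h)
  rw [det_mul, det_one, mul_comm] at this
  exact .of_mul_eq_one _ this

lemma parabolic_mul_toBlocks₂₂ (η γ : SpZ n) (h : η ∈ parabolic n) :
    (η * γ).1.toBlocks₂₂ = η.1.toBlocks₂₂ * γ.1.toBlocks₂₂ := by
  rw [Submonoid.coe_mul, toBlocks₂₂_mul', mem_parabolic.1 h, zero_mul, zero_add]

lemma parabolic_mul_toBlocks₂₁ (η γ : SpZ n) (h : η ∈ parabolic n) :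
    (η * γ).1.toBlocks₂₁ = η.1.toBlocks₂₂ * γ.1.toBlocks₂₁ := by
  rw [Submonoid.coe_mul, toBlocks₂₁_mul', mem_parabolic.1 h, zero_mul, zero_add]

end Symplectic

/-! ### Reduction modulo p and characters of determinants -/

section ModP

variable {n p : ℕ}

/-- Reduction modulo `p` of an integer matrix. -/
def red (p : ℕ) {m : Type*} (M : Matrix m m ℤ) : Matrix m m (ZMod p) :=
  M.map (Int.castRingHom (ZMod p))

lemma red_mul {m : Type*} [Fintype m] (M N : Matrix m m ℤ) : red p (M * N) = red p M * red p N :=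
  Matrix.map_mul

lemma red_add {m : Type*} (M N : Matrix m m ℤ) : red p (M + N) = red p M + red p N :=
  Matrix.map_add _ (map_add _) _ _

lemma red_sub {m : Type*} (M N : Matrix m m ℤ) : red p (M - N) = red p M - red p N :=
  Matrix.map_sub _ (map_sub _) _ _

lemma red_neg {m : Type*} (M : Matrix m m ℤ) : red p (-M) = - red p M := by
  ext i j; simp [red]

lemma red_zero {m : Type*} : red p (0 : Matrix m m ℤ) = 0 := by
  ext i j; simp [red]

lemma red_one {m : Type*} [DecidableEq m] : red p (1 : Matrix m m ℤ) = 1 :=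
  Matrix.map_one _ (map_zero _) (map_one _)

lemma red_transpose {m : Type*} (M : Matrix m m ℤ) : red p Mᵀ = (red p M)ᵀ := rfl

lemma red_diagonal {m : Type*} [DecidableEq m] (d : m → ℤ) :
    red p (diagonal d) = diagonal fun i => (d i : ZMod p) := by
  rw [red, diagonal_map (map_zero _)]
  rfl

lemma red_smul_self {m : Type*} (M : Matrix m m ℤ) : red p ((p : ℤ) • M) = 0 := by
  ext i j; simp [red]

lemma det_red {m : Type*} [Fintype m] [DecidableEq m] (M : Matrix m m ℤ) :
    (red p M).det = ((M.det : ℤ) : ZMod p) :=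
  (RingHom.map_det (Int.castRingHom (ZMod p)) M).symm

lemma red_eq_zero_iff {m : Type*} (M : Matrix m m ℤ) :
    red p M = 0 ↔ ∀ i j, (p : ℤ) ∣ M i j := by
  simp only [← Matrix.ext_iff, red, map_apply, eq_intCast, Matrix.zero_apply,
    ZMod.intCast_zmod_eq_zero_iff_dvd]

/-- The lift of a matrix over `ℤ/p` with entries in `{0, …, p - 1}`. -/
def lift {m : Type*} (S : Matrix m m (ZMod p)) : Matrix m m ℤ := S.map fun x => (x.val : ℤ)

lemma red_lift [NeZero p] {m : Type*} (S : Matrix m m (ZMod p)) : red p (lift S) = S := by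
  ext i j
  simp [red, lift]

lemma lift_isSymm {m : Type*} {S : Matrix m m (ZMod p)} (h : S.IsSymm) : (lift S).IsSymm :=
  h.map _

lemma exists_smul_of_red_eq_zero {m : Type*} (M : Matrix m m ℤ) (h : red p M = 0) :
    ∃ N : Matrix m m ℤ, M = (p : ℤ) • N := by
  rw [red_eq_zero_iff] at h
  choose N hN using h
  exact ⟨of N, by ext i j; simp [hN i j]⟩

lemma charDet_eq (ψ : DirichletCharacter ℂ p) (M : Matrix (Fin n) (Fin n) ℤ) :
    charDet ψ M = ψ (red p M).det := by
  rw [charDet, det_red]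

lemma charDet_mul (ψ : DirichletCharacter ℂ p) (M N : Matrix (Fin n) (Fin n) ℤ) :
    charDet ψ (M * N) = charDet ψ M * charDet ψ N := by
  simp only [charDet_eq, red_mul, det_mul, map_mul]

lemma charDet_one (ψ : DirichletCharacter ℂ p) :
    charDet ψ (1 : Matrix (Fin n) (Fin n) ℤ) = 1 := by
  simp [charDet]

lemma charDet_transpose (ψ : DirichletCharacter ℂ p) (M : Matrix (Fin n) (Fin n) ℤ) :
    charDet ψ Mᵀ = charDet ψ M := by
  simp [charDet]

lemma mem_Gamma0 {κ : SpZ n} : κ ∈ Gamma0 n p ↔ red p κ.1.toBlocks₂₁ = 0 := by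
  rw [red_eq_zero_iff]; rfl

lemma Gamma0_red_mul_toBlocks₂₂ (γ κ : SpZ n) (h : γ ∈ Gamma0 n p) :
    red p (γ * κ).1.toBlocks₂₂ = red p γ.1.toBlocks₂₂ * red p κ.1.toBlocks₂₂ := by
  rw [Submonoid.coe_mul, toBlocks₂₂_mul', red_add, red_mul, red_mul, mem_Gamma0.1 h, zero_mul,
    zero_add]

lemma Gamma0_relation {κ : SpZ n} (h : κ ∈ Gamma0 n p) :
    (red p κ.1.toBlocks₁₁)ᵀ * red p κ.1.toBlocks₂₂ = 1 := by
  have := congrArg (red p) (symplectic_relations κ).2.2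
  rwa [red_sub, red_mul, red_mul, red_transpose, red_transpose, mem_Gamma0.1 h, transpose_zero,
    zero_mul, sub_zero, red_one] at this

lemma Gamma0_charDet {ψ : DirichletCharacter ℂ p} {κ : SpZ n} (h : κ ∈ Gamma0 n p) :
    charDet ψ κ.1.toBlocks₁₁ * charDet ψ κ.1.toBlocks₂₂ = 1 := by
  rw [charDet_eq, charDet_eq, ← map_mul, ← det_transpose (red p κ.1.toBlocks₁₁), ← det_mul,
    Gamma0_relation h, det_one, map_one]

lemma charDet_Gamma0_mul {ψ : DirichletCharacter ℂ p} (γ κ : SpZ n) (h : γ ∈ Gamma0 n p) :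
    charDet ψ (γ * κ).1.toBlocks₂₂ = charDet ψ γ.1.toBlocks₂₂ * charDet ψ κ.1.toBlocks₂₂ := by
  rw [charDet_eq, Gamma0_red_mul_toBlocks₂₂ _ _ h, det_mul, map_mul, charDet_eq, charDet_eq]

lemma parabolic_le_Gamma0 : parabolic n ≤ Gamma0 n p := fun η h => by
  rw [mem_Gamma0, mem_parabolic.1 h, red_zero]

end ModP

/-- A character with values `±1` on units. -/
def IsSquareTrivial {p : ℕ} (ψ : DirichletCharacter ℂ p) : Prop :=
  ∀ u : ZMod p, IsUnit u → ψ u * ψ u = 1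

lemma isSquareTrivial_of_eq {p : ℕ} [Fact p.Prime] {ψ : DirichletCharacter ℂ p}
    (hψ : ψ = 1 ∨ ψ = chiQuad p) : IsSquareTrivial ψ := by
  intro u hu
  rcases hψ with rfl | rfl
  · rw [MulChar.one_apply hu, mul_one]
  · have h := quadraticChar_sq_one hu.ne_zero
    have h2 := congrArg (Int.castRingHom ℂ) h
    simpa [chiQuad, pow_two] using h2

namespace IsSquareTrivial

variable {n p : ℕ} {ψ : DirichletCharacter ℂ p} (hq : IsSquareTrivial ψ)
include hq

lemma charDet_mul_self {M : Matrix (Fin n) (Fin n) ℤ} (h : IsUnit (red p M).det) :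
    charDet ψ M * charDet ψ M = 1 := by
  rw [charDet_eq]; exact hq _ h

lemma Gamma0_mul_self {κ : SpZ n} (h : κ ∈ Gamma0 n p) :
    charDet ψ κ.1.toBlocks₂₂ * charDet ψ κ.1.toBlocks₂₂ = 1 := by
  refine hq.charDet_mul_self (.of_mul_eq_one_right (red p κ.1.toBlocks₁₁)ᵀ.det ?_)
  rw [← det_mul, Gamma0_relation h, det_one]

/-- Modulo `p` the blocks satisfy `ᵗA D = 1`, so the two values are inverse to each other; both are
`±1`. -/
lemma Gamma0_charDet_eq {κ : SpZ n} (h : κ ∈ Gamma0 n p) :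
    charDet ψ κ.1.toBlocks₁₁ = charDet ψ κ.1.toBlocks₂₂ := by
  have h1 := hq.Gamma0_mul_self h
  have h2 := Gamma0_charDet (ψ := ψ) h
  have h0 : charDet ψ κ.1.toBlocks₂₂ ≠ 0 := fun h0 => by simp [h0] at h1
  exact mul_right_cancel₀ h0 (h2.trans h1.symm)

end IsSquareTrivial

/-! ### The projections diag(1_r, 0) and diag(0, 1_{n-r}) -/

section Projections

/-- The projection `diag(1_r, 0_{n-r})`. -/
def prL (R : Type*) [CommRing R] (n r : ℕ) : Matrix (Fin n) (Fin n) R :=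
  diagonal fun i => if i.1 < r then 1 else 0

/-- The projection `diag(0_r, 1_{n-r})`. -/
def prR (R : Type*) [CommRing R] (n r : ℕ) : Matrix (Fin n) (Fin n) R :=
  diagonal fun i => if i.1 < r then 0 else 1

variable {R : Type*} [CommRing R] {n r : ℕ}

@[simp] lemma prL_mul_prL : prL R n r * prL R n r = prL R n r := by
  simp only [prL, diagonal_mul_diagonal]; congr 1; funext i; split_ifs <;> simp

@[simp] lemma prR_mul_prR : prR R n r * prR R n r = prR R n r := by
  simp only [prR, diagonal_mul_diagonal]; congr 1; funext i; split_ifs <;> simp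

@[simp] lemma prL_mul_prR : prL R n r * prR R n r = 0 := by
  simp only [prL, prR, diagonal_mul_diagonal]; rw [← diagonal_zero]
  congr 1; funext i; split_ifs <;> simp

@[simp] lemma prR_mul_prL : prR R n r * prL R n r = 0 := by
  simp only [prL, prR, diagonal_mul_diagonal]; rw [← diagonal_zero]
  congr 1; funext i; split_ifs <;> simp

@[simp] lemma prL_add_prR : prL R n r + prR R n r = 1 := by
  simp only [prL, prR, diagonal_add]; rw [← diagonal_one]
  congr 1; funext i; split_ifs <;> simp

@[simp] lemma prL_transpose : (prL R n r)ᵀ = prL R n r := diagonal_transpose _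

@[simp] lemma prR_transpose : (prR R n r)ᵀ = prR R n r := diagonal_transpose _

@[simp] lemma prL_mul_prL_assoc (M : Matrix (Fin n) (Fin n) R) :
    prL R n r * (prL R n r * M) = prL R n r * M := by
  rw [← Matrix.mul_assoc, prL_mul_prL]

@[simp] lemma prL_mul_prR_assoc (M : Matrix (Fin n) (Fin n) R) :
    prL R n r * (prR R n r * M) = 0 := by
  rw [← Matrix.mul_assoc, prL_mul_prR, zero_mul]

@[simp] lemma prR_mul_prL_assoc (M : Matrix (Fin n) (Fin n) R) :
    prR R n r * (prL R n r * M) = 0 := by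
  rw [← Matrix.mul_assoc, prR_mul_prL, zero_mul]

lemma red_prL {p : ℕ} : red p (prL ℤ n r) = prL (ZMod p) n r := by
  rw [prL, red_diagonal, prL]; congr 1; funext i; split_ifs <;> simp

lemma red_prR {p : ℕ} : red p (prR ℤ n r) = prR (ZMod p) n r := by
  rw [prR, red_diagonal, prR]; congr 1; funext i; split_ifs <;> simp

/-- With `I` and `I'` the two projections, the matrices differ by the left factor `1 + I M I'`, of
determinant `1` because `I' I = 0`. -/
lemma det_prL_mul_add_prR (M : Matrix (Fin n) (Fin n) R) :
    (prL R n r * M + prR R n r).det = (prL R n r * M * prL R n r + prR R n r).det := by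
  have h : (1 + prL R n r * (M * prR R n r)) * (prL R n r * M * prL R n r + prR R n r) =
      prL R n r * M + prR R n r := by
    have e : prL R n r * M * prL R n r + prL R n r * M * prR R n r = prL R n r * M := by
      rw [← Matrix.mul_add, prL_add_prR, mul_one]
    simp only [add_mul, mul_add, one_mul, Matrix.mul_assoc, prR_mul_prL_assoc, mul_zero,
      prR_mul_prR] at e ⊢
    rw [← e]
    abel
  rw [← h, det_mul, det_one_add_mul_comm]
  simp [Matrix.mul_assoc]

lemma rank_prL (K : Type*) [Field K] (h : r ≤ n) : (prL K n r).rank = r := by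
  classical
  rw [prL, rank_diagonal, Fintype.card_subtype]
  have : (Finset.univ.filter fun i : Fin n => (if i.1 < r then (1 : K) else 0) ≠ 0) =
      Finset.univ.filter fun i : Fin n => i.1 < r := by
    ext i; simp
  rw [this, Fin.card_filter_val_lt, min_eq_right h]

end Projections

/-! ### The double cosets of w_r, and ψ* is well defined -/

section Cells

variable {n p r : ℕ}

lemma coe_w : (w n r).1 = fromBlocks (prR ℤ n r) (-prL ℤ n r) (prL ℤ n r) (prR ℤ n r) := rfl

lemma parabolic_mul_cell {η γ : SpZ n} (h : η ∈ parabolic n) (hγ : γ ∈ cell n p r) :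
    η * γ ∈ cell n p r := by
  obtain ⟨⟨a, b⟩, ha, hb, rfl⟩ := hγ
  exact ⟨⟨η * a, b⟩, mul_mem h ha, hb, by simp only [mul_assoc]⟩

lemma cell_mul_Gamma0 {κ γ : SpZ n} (hγ : γ ∈ cell n p r) (h : κ ∈ Gamma0 n p) :
    γ * κ ∈ cell n p r := by
  obtain ⟨⟨a, b⟩, ha, hb, rfl⟩ := hγ
  exact ⟨⟨a, b * κ⟩, ha, mul_mem hb h, by simp only [mul_assoc]⟩

lemma w_mem_cell : w n r ∈ cell n p r :=
  ⟨⟨1, 1⟩, one_mem _, one_mem _, by simp⟩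

/-- Modulo `p` the lower left block of `η w_r κ` is `D_η I_r A_κ` with invertible outer factors. The
rank is therefore an invariant that separates the cells. -/
lemma rank_of_mem_cell [Fact p.Prime] (h : r ≤ n) {γ : SpZ n} (hγ : γ ∈ cell n p r) :
    (red p γ.1.toBlocks₂₁).rank = r := by
  obtain ⟨⟨η, κ⟩, hη, hκ, rfl⟩ := hγ
  simp only at hη hκ
  rw [mul_assoc, parabolic_mul_toBlocks₂₁ _ _ hη, Submonoid.coe_mul, toBlocks₂₁_mul', coe_w,
    toBlocks_fromBlocks₂₁, toBlocks_fromBlocks₂₂, red_mul, red_add, red_mul, red_mul,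
    mem_Gamma0.1 hκ, mul_zero, add_zero, red_prL]
  have h1 : IsUnit (red p η.1.toBlocks₂₂).det := by
    rw [det_red]
    exact (parabolic_det hη).map (Int.castRingHom (ZMod p))
  have h2 : IsUnit (red p κ.1.toBlocks₁₁).det := by
    have := congrArg det (Gamma0_relation hκ)
    rw [det_mul, det_transpose, det_one] at this
    exact .of_mul_eq_one _ this
  rw [rank_mul_eq_right_of_isUnit_det _ _ h1, rank_mul_eq_left_of_isUnit_det _ _ h2,
    rank_prL _ h]

lemma cell_disjoint [Fact p.Prime] {j : ℕ} (hr : r ≤ n) (hj : j ≤ n) {γ : SpZ n}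
    (h1 : γ ∈ cell n p r) (h2 : γ ∈ cell n p j) : r = j := by
  rw [← rank_of_mem_cell hr h1, rank_of_mem_cell hj h2]

variable {ψ : DirichletCharacter ℂ p}

/-- This is the well-definedness of `ψ*`. Modulo `p` the hypothesis reads `D I = I a` and `D I' = I
b + I' d`, where `D = D_η` and `a, b, d` are blocks of `κ`. It follows that `det D · det a` is a
square of a unit, which `ψ` sends to `1`. -/
lemma charDet_eq_of_mul_w_eq (hq : IsSquareTrivial ψ) {η κ : SpZ n}
    (hη : η ∈ parabolic n) (hκ : κ ∈ Gamma0 n p) (h : η * w n r = w n r * κ) :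
    charDet ψ η.1.toBlocks₂₂ = charDet ψ κ.1.toBlocks₂₂ := by
  have h' : η.1 * (w n r).1 = (w n r).1 * κ.1 := congrArg Subtype.val h
  have h1 := congrArg (fun M => red p M.toBlocks₂₁) h'
  have h2 := congrArg (fun M => red p M.toBlocks₂₂) h'
  simp only [toBlocks₂₁_mul', toBlocks₂₂_mul', coe_w, toBlocks_fromBlocks₁₁,
    toBlocks_fromBlocks₁₂, toBlocks_fromBlocks₂₁, toBlocks_fromBlocks₂₂, red_add, red_mul,
    mem_parabolic.1 hη, mem_Gamma0.1 hκ, zero_mul, mul_zero, zero_add, add_zero,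
    red_prL, red_prR] at h1 h2
  have hda := Gamma0_relation hκ
  have hDη : IsUnit (red p η.1.toBlocks₂₂).det := by
    rw [det_red]
    exact (parabolic_det hη).map (Int.castRingHom (ZMod p))
  have hUa : IsUnit (red p κ.1.toBlocks₁₁).det := by
    have := congrArg det hda
    rw [det_mul, det_transpose, det_one] at this
    exact .of_mul_eq_one _ this
  rw [← hq.Gamma0_charDet_eq hκ]
  rw [charDet_eq, charDet_eq]
  generalize red p η.1.toBlocks₂₂ = D at *
  generalize red p κ.1.toBlocks₁₁ = a at *
  generalize red p κ.1.toBlocks₁₂ = b at *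
  generalize red p κ.1.toBlocks₂₂ = d at *
  have hda' : d * aᵀ = 1 := mul_eq_one_comm.1 hda
  set I := prL (ZMod p) n r with hI
  set I' := prR (ZMod p) n r with hI'
  have e1 : I * b * I = 0 := by
    have := congrArg (fun M => I * (M * I)) h2
    simpa [I, I', Matrix.add_mul, Matrix.mul_add, Matrix.mul_assoc] using this.symm
  have e2 : I * a * I = I * a := by
    rw [← h1, Matrix.mul_assoc, prL_mul_prL]
  have e2' : I * aᵀ * I = aᵀ * I := by
    have := congrArg transpose e2
    simpa [I, transpose_mul, Matrix.mul_assoc] using this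
  have e3 : I * (b * aᵀ) * I = 0 := by
    calc I * (b * aᵀ) * I = I * b * (aᵀ * I) := by simp only [Matrix.mul_assoc]
      _ = (I * b * I) * aᵀ * I := by rw [← e2']; simp only [Matrix.mul_assoc]
      _ = 0 := by rw [e1]; simp
  have hD : D = I * a + (I * b + I' * d) := by
    rw [← h1, ← h2, ← Matrix.mul_add, prL_add_prR, mul_one]
  -- Since `d ᵗa = 1`, multiplication by `ᵗa` turns the lower rows of `D` into those of the
  -- identity, leaving only an `r × r` determinant.
  have hDa : D * aᵀ = I * (a * aᵀ + b * aᵀ) + I' := by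
    rw [hD]
    simp only [Matrix.add_mul, Matrix.mul_add, Matrix.mul_assoc, hda', mul_one]
    abel
  have hdet : D.det * a.det = (I * a * I + I').det * (I * a * I + I').det := by
    calc D.det * a.det = (D * aᵀ).det := by rw [det_mul, det_transpose]
      _ = (I * (a * aᵀ + b * aᵀ) * I + I').det := by rw [hDa, det_prL_mul_add_prR]
      _ = ((I * a * I + I') * (I * a * I + I')ᵀ).det := by
        congr 1
        have z1 : I * a * I' = 0 := by
          rw [← e2, Matrix.mul_assoc, prL_mul_prR, mul_zero]
        have z2 : I' * aᵀ * I = 0 := by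
          have := congrArg transpose z1
          simpa [I, I', transpose_mul, Matrix.mul_assoc] using this
        rw [e2, transpose_add, transpose_mul, hI, hI', prL_transpose, prR_transpose, ← hI, ← hI',
          Matrix.mul_add, Matrix.add_mul, e3, add_zero, Matrix.add_mul, Matrix.mul_add,
          Matrix.mul_add, z1, ← Matrix.mul_assoc I', z2, hI', prR_mul_prR, add_zero, zero_add]
        simp only [Matrix.mul_assoc]
      _ = _ := by rw [det_mul, det_transpose]
  have hu : IsUnit (I * a * I + I').det :=
    isUnit_of_mul_isUnit_left (hdet ▸ hDη.mul hUa)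
  have hψ : ψ D.det * ψ a.det = 1 := by rw [← map_mul, hdet, map_mul, hq _ hu]
  have h3 := hq _ hUa
  have h0 : ψ a.det ≠ 0 := fun h0 => by simp [h0] at h3
  exact mul_right_cancel₀ h0 (hψ.trans h3.symm)

/-- Two decompositions `η w κ = η' w κ'` give `(η⁻¹η') w = w (κκ'⁻¹)`, to which
`charDet_eq_of_mul_w_eq` applies. -/
lemma psiStar_eq (hq : IsSquareTrivial ψ) {η κ : SpZ n} (hη : η ∈ parabolic n)
    (hκ : κ ∈ Gamma0 n p) : psiStar ψ r (η * w n r * κ) =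
      charDet ψ η.1.toBlocks₂₂ * charDet ψ κ.1.toBlocks₂₂ := by
  have hc : η * w n r * κ ∈ cell n p r := ⟨⟨η, κ⟩, hη, hκ, rfl⟩
  rw [psiStar, dif_pos hc]
  obtain ⟨h1, h2, h3⟩ := hc.choose_spec
  generalize hc.choose = x at *
  obtain ⟨η', κ'⟩ := x
  simp only at h1 h2 h3 ⊢
  have e : (η⁻¹ * η') * w n r = w n r * (κ * κ'⁻¹) := by
    have : η' * w n r = η * w n r * κ * κ'⁻¹ := by rw [h3]; group
    rw [mul_assoc, this]; group
  have key := charDet_eq_of_mul_w_eq hq (mul_mem (inv_mem hη) h1) (mul_mem hκ (inv_mem h2)) e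
  have a1 : η'= η * (η⁻¹ * η') := by group
  have a2 : κ = (κ * κ'⁻¹) * κ' := by group
  rw [a2, charDet_Gamma0_mul _ _ (mul_mem hκ (inv_mem h2)), ← key, a1,
    parabolic_mul_toBlocks₂₂ _ _ hη, charDet_mul, mul_assoc]
  simp only [mul_inv_cancel_left]

lemma psiStar_eq_zero {γ : SpZ n} (h : γ ∉ cell n p r) : psiStar ψ r γ = 0 := dif_neg h

lemma psiStar_parabolic_mul (hq : IsSquareTrivial ψ) {η : SpZ n} (hη : η ∈ parabolic n)
    (γ : SpZ n) : psiStar ψ r (η * γ) = charDet ψ η.1.toBlocks₂₂ * psiStar ψ r γ := by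
  by_cases h : γ ∈ cell n p r
  · obtain ⟨⟨a, b⟩, ha, hb, rfl⟩ := h
    simp only at ha hb ⊢
    rw [psiStar_eq hq ha hb, ← mul_assoc, ← mul_assoc, psiStar_eq hq (mul_mem hη ha) hb,
      parabolic_mul_toBlocks₂₂ _ _ hη, charDet_mul, mul_assoc]
  · rw [psiStar_eq_zero h, psiStar_eq_zero, mul_zero]
    intro h'
    have := parabolic_mul_cell (inv_mem hη) h'
    rw [inv_mul_cancel_left] at this
    exact h this

lemma psiStar_mul_Gamma0 (hq : IsSquareTrivial ψ) {κ : SpZ n} (hκ : κ ∈ Gamma0 n p)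
    (γ : SpZ n) : psiStar ψ r (γ * κ) = charDet ψ κ.1.toBlocks₂₂ * psiStar ψ r γ := by
  by_cases h : γ ∈ cell n p r
  · obtain ⟨⟨a, b⟩, ha, hb, rfl⟩ := h
    simp only at ha hb ⊢
    rw [psiStar_eq hq ha hb, mul_assoc, psiStar_eq hq ha (mul_mem hb hκ),
      charDet_Gamma0_mul _ _ hb]
    ring
  · rw [psiStar_eq_zero h, psiStar_eq_zero, mul_zero]
    intro h'
    have := cell_mul_Gamma0 h' (inv_mem hκ)
    rw [mul_inv_cancel_right] at this
    exact h this

lemma psiStar_w (hq : IsSquareTrivial ψ) : psiStar ψ r (w n r) = 1 := by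
  have := psiStar_eq (r := r) hq (one_mem (parabolic n)) (one_mem (Gamma0 n p))
  have e : (1 : SpZ n).1.toBlocks₂₂ = 1 := by
    rw [Submonoid.coe_one, ← fromBlocks_one, toBlocks_fromBlocks₂₂]
  rw [one_mul, mul_one] at this
  rw [this, e, charDet_one, mul_one]

lemma psiStar_w_of_ne [Fact p.Prime] {j : ℕ} (hr : r ≤ n) (hj : j ≤ n) (h : r ≠ j) :
    psiStar ψ r (w n j) = 0 :=
  psiStar_eq_zero fun hm => h (cell_disjoint hr hj hm w_mem_cell)

end Cells

/-! ### The double cosets of w_r cover the modular group -/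

section Cover

variable {n p : ℕ}

lemma red_transvection [NeZero p] (i j : Fin n) (c : ZMod p) :
    red p (transvection i j (c.val : ℤ)) = transvection i j c := by
  rw [transvection, red_add, red_one, transvection]
  congr 1
  ext a b
  simp only [red, map_apply, single_apply]
  split_ifs <;> simp

/-- Transvections lift entrywise to unimodular integral matrices, so Gaussian elimination over `ℤ/p`
lifts except for its diagonal factor. -/
lemma exists_lift_of_transvections [NeZero p] (L : List (TransvectionStruct (Fin n) (ZMod p))) :
    ∃ U V : Matrix (Fin n) (Fin n) ℤ, U * V = 1 ∧
      red p U = (L.map TransvectionStruct.toMatrix).prod := by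
  induction L with
  | nil => exact ⟨1, 1, by simp, by simp [red_one]⟩
  | cons t L ih =>
    obtain ⟨U, V, h1, h2⟩ := ih
    obtain ⟨i, j, hij, c⟩ := t
    refine ⟨transvection i j (c.val : ℤ) * U, V * transvection i j (-(c.val : ℤ)), ?_, ?_⟩
    · rw [Matrix.mul_assoc, ← Matrix.mul_assoc U, h1, Matrix.one_mul,
        transvection_mul_transvection_same i j hij, add_neg_cancel, transvection_zero]
    · rw [red_mul, h2, red_transvection, List.map_cons, List.prod_cons,
        TransvectionStruct.toMatrix_mk]

lemma exists_Gamma0_of_int (X Y : Matrix (Fin n) (Fin n) ℤ) (h : X * Y = 1) :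
    ∃ κ ∈ Gamma0 n p, red p κ.1.toBlocks₁₁ = red p X :=
  ⟨levi Yᵀ Xᵀ (by rw [← transpose_mul, h, transpose_one]),
    parabolic_le_Gamma0 (levi_mem _ _ _), by
      rw [levi, toBlocks_fromBlocks₁₁, transpose_transpose]⟩

/-- A diagonal matrix over `ℤ/p` need not lift to a unimodular matrix, but it is the `A`-block of an
element of `Γ₀(p)`: Bézout completes each pair `(d_i, p)` to a `2 × 2` matrix of determinant `1`. -/
lemma exists_Gamma0_of_diagonal [Fact p.Prime] (d : Fin n → ZMod p) (hd : ∀ i, d i ≠ 0) :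
    ∃ κ ∈ Gamma0 n p, red p κ.1.toBlocks₁₁ = diagonal d := by
  have h : ∀ i, ∃ u v : ℤ, u * ((d i).val : ℤ) + v * (p : ℤ) = 1 := fun i => by
    have h1 : Nat.Coprime (d i).val p := by
      have := ZMod.isUnit_iff_coprime (d i).val p
      rw [ZMod.natCast_zmod_val] at this
      exact this.1 (hd i).isUnit
    exact (Nat.isCoprime_iff_coprime.2 h1)
  choose u v h using h
  refine ⟨diagElt (fun i => ((d i).val : ℤ)) (fun i => -v i) (fun _ => p) u fun i => ?_, ?_, ?_⟩
  · rw [← h i]; ring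
  · rw [mem_Gamma0, diagElt, toBlocks_fromBlocks₂₁, red_diagonal]
    simp
  · rw [diagElt, toBlocks_fromBlocks₁₁, red_diagonal]
    simp

lemma exists_Gamma0_mul {X Y : Matrix (Fin n) (Fin n) (ZMod p)}
    (hX : ∃ κ ∈ Gamma0 n p, red p κ.1.toBlocks₁₁ = X)
    (hY : ∃ κ ∈ Gamma0 n p, red p κ.1.toBlocks₁₁ = Y) :
    ∃ κ ∈ Gamma0 n p, red p κ.1.toBlocks₁₁ = X * Y := by
  obtain ⟨κ, hκ, rfl⟩ := hX
  obtain ⟨κ', hκ', rfl⟩ := hY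
  refine ⟨κ * κ', mul_mem hκ hκ', ?_⟩
  rw [Submonoid.coe_mul, toBlocks₁₁_mul', red_add, red_mul, red_mul, mem_Gamma0.1 hκ', mul_zero,
    add_zero]

lemma exists_perm_support {K : Type*} [Zero K] (D : Fin n → K) :
    ∃ (σ : Equiv.Perm (Fin n)) (r : ℕ), r ≤ n ∧ ∀ i, D (σ i) ≠ 0 ↔ i.1 < r := by
  classical
  set r := Fintype.card {i // D i ≠ 0} with hr
  have hrn : r ≤ n := (Fintype.card_subtype_le _).trans_eq (Fintype.card_fin n)
  have hc : Fintype.card {i : Fin n // i.1 < r} = Fintype.card {i // D i ≠ 0} := by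
    rw [Fintype.card_subtype, Fin.card_filter_val_lt, min_eq_right hrn]
  let e := Fintype.equivOfCardEq hc
  refine ⟨e.extendSubtype, r, hrn, fun i => ⟨fun h => ?_, fun h => e.extendSubtype_mem i h⟩⟩
  by_contra hi
  exact e.extendSubtype_not_mem i hi h

/-- Elimination gives `M = L D L'` with `D` diagonal. A permutation moves the nonzero entries of `D`
to the front; replacing the zero entries by `1` leaves an invertible factor, which goes into `X`. -/
lemma exists_rank_normal_form [Fact p.Prime] (M : Matrix (Fin n) (Fin n) (ZMod p)) :
    ∃ (r : ℕ) (U V : Matrix (Fin n) (Fin n) ℤ) (X : Matrix (Fin n) (Fin n) (ZMod p)),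
      r ≤ n ∧ U * V = 1 ∧ (∃ κ ∈ Gamma0 n p, red p κ.1.toBlocks₁₁ = X) ∧
      M = red p U * prL (ZMod p) n r * X := by
  obtain ⟨L, L', D, hM⟩ := Pivot.exists_list_transvec_mul_diagonal_mul_list_transvec M
  obtain ⟨U, V, hUV, hU⟩ := exists_lift_of_transvections L
  obtain ⟨U', V', hUV', hU'⟩ := exists_lift_of_transvections L'
  obtain ⟨σ, r, hr, hσ⟩ := exists_perm_support D
  let S : Matrix (Fin n) (Fin n) ℤ := of fun i j => if i = σ j then 1 else 0
  have hS : S * Sᵀ = 1 := by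
    ext i j
    simp only [S, mul_apply, transpose_apply, of_apply, mul_ite, mul_one, mul_zero, one_apply]
    rw [Finset.sum_eq_single (σ.symm j)]
    · simp
    · intro b _ hb
      rw [if_neg]
      rintro rfl
      simp at hb
    · simp
  have hD : diagonal D = red p S * prL (ZMod p) n r *
      (red p Sᵀ * diagonal fun i => if D i = 0 then 1 else D i) := by
    ext i j
    rw [prL, mul_apply]
    simp only [mul_diagonal, red, map_apply, S, of_apply, transpose_apply]
    rw [Finset.sum_eq_single (σ.symm i)]
    · have hi := hσ (σ.symm i)
      rw [Equiv.apply_symm_apply] at hi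
      rw [diagonal_apply]
      by_cases hij : i = j
      · subst hij
        by_cases h0 : D i = 0
        · simp [h0] at hi
          simp [h0, hi]
        · simp [h0, hi.1 h0]
      · simp [hij, Ne.symm hij]
    · intro b _ hb
      rw [if_neg]
      · simp
      · rintro rfl
        simp at hb
    · simp
  refine ⟨r, U * S, Sᵀ * V, _, hr, ?_, exists_Gamma0_mul (exists_Gamma0_mul
    (exists_Gamma0_of_int Sᵀ S (mul_eq_one_comm.1 hS))
    (exists_Gamma0_of_diagonal (fun i => if D i = 0 then 1 else D i) fun i => ?_))
    (exists_Gamma0_of_int U' V' hUV'), ?_⟩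
  · rw [Matrix.mul_assoc, ← Matrix.mul_assoc S, hS, Matrix.one_mul, hUV]
  · split_ifs with h
    · exact one_ne_zero
    · exact h
  · rw [hM, ← hU, ← hU', hD, red_mul]
    simp only [Matrix.mul_assoc]

/-- The double cosets `P w_r Γ₀(p)` cover the modular group. -/
lemma exists_mem_cell [Fact p.Prime] (γ : SpZ n) : ∃ r ≤ n, γ ∈ cell n p r := by
  obtain ⟨r, U, V, X, hr, hUV, ⟨κ, hκ, rfl⟩, hC⟩ := exists_rank_normal_form
    (red p γ.1.toBlocks₂₁)
  have hVU : V * U = 1 := mul_eq_one_comm.1 hUV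
  -- Multiplication by elements of `P` and `Γ₀(p)` reduces to the case `C ≡ I_r`.
  set γ₁ : SpZ n := levi V U hVU * γ * κ⁻¹ with hγ₁
  have hC₁ : red p γ₁.1.toBlocks₂₁ = prL (ZMod p) n r := by
    have e : γ₁ * κ = levi V U hVU * γ := by rw [hγ₁]; group
    have e1 := congrArg (fun g : SpZ n => red p g.1.toBlocks₂₁) e
    simp only [parabolic_mul_toBlocks₂₁ _ _ (levi_mem V U hVU)] at e1
    rw [Submonoid.coe_mul, toBlocks₂₁_mul', red_add, red_mul, red_mul, mem_Gamma0.1 hκ, mul_zero,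
      add_zero, red_mul _ γ.1.toBlocks₂₁, hC, levi, toBlocks_fromBlocks₂₂, ← Matrix.mul_assoc, ← Matrix.mul_assoc,
      ← red_mul V U, hVU, red_one, one_mul] at e1
    have hu : red p κ.1.toBlocks₁₁ * (red p κ.1.toBlocks₂₂)ᵀ = 1 := by
      have := congrArg transpose (mul_eq_one_comm.1 (Gamma0_relation hκ))
      simpa [transpose_mul] using this
    have := congrArg (fun M => M * (red p κ.1.toBlocks₂₂)ᵀ) e1
    simpa [Matrix.mul_assoc, hu] using this
  have hsym := congrArg (red p) (symplectic_relations γ₁).1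
  rw [red_mul, red_mul, red_transpose, red_transpose, hC₁, prL_transpose] at hsym
  set a := red p γ₁.1.toBlocks₁₁ with ha
  have hS : (prL (ZMod p) n r * a).IsSymm := by
    rw [IsSymm, transpose_mul, prL_transpose, hsym]
  -- The relation `ᵗA C = ᵗC A` with `C ≡ I_r` makes `I_r A` symmetric modulo `p`. Translating by
  -- its negative replaces `A` by `A - I_r A I_r`, which `I_r` annihilates from the left; this is
  -- the condition for `w_r⁻¹ N γ₁` to lie in `Γ₀(p)`.
  set N := unip (-(lift (prL (ZMod p) n r * a))) (lift_isSymm hS).neg with hN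
  have hmem : (w n r)⁻¹ * (N * γ₁) ∈ Gamma0 n p := by
    rw [mem_Gamma0, Submonoid.coe_mul, coe_inv_eq_fromBlocks, coe_w, toBlocks₂₁_mul']
    simp only [toBlocks_fromBlocks₁₁, toBlocks_fromBlocks₁₂, toBlocks_fromBlocks₂₁,
      toBlocks_fromBlocks₂₂, Submonoid.coe_mul, toBlocks₂₁_mul', toBlocks₁₁_mul', hN, unip,
      red_add, red_mul, red_neg, red_lift, hC₁, one_mul, zero_mul, zero_add, prL_transpose,
      prR_transpose, red_prL, red_prR, prR_mul_prL, add_zero, ← ha]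
    simp only [← hsym, Matrix.neg_mul]
    rw [Matrix.mul_assoc aᵀ (prL (ZMod p) n r), prL_mul_prL, hsym]
    simp [mul_add]
  refine ⟨r, hr, ⟨(levi V U hVU)⁻¹ * N⁻¹, (w n r)⁻¹ * (N * γ₁) * κ⟩, ?_, mul_mem hmem hκ, ?_⟩
  · exact mul_mem (inv_mem (levi_mem _ _ _)) (inv_mem (unip_mem _ _))
  · simp only [hγ₁]; group

end Cover

/-! ### Hermite reduction of integral quadratic forms -/

section Hermite

/-- The value of an integral quadratic form. -/
def quad {n : ℕ} (Q : Matrix (Fin n) (Fin n) ℤ) (v : Fin n → ℤ) : ℤ := v ⬝ᵥ Q *ᵥ v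

lemma mul_mul_transpose_apply {n : ℕ} (U Q : Matrix (Fin n) (Fin n) ℤ) (i : Fin n) :
    (U * Q * Uᵀ) i i = quad Q (U i) := by
  rw [quad, Matrix.mul_assoc, mul_apply, dotProduct]
  refine Finset.sum_congr rfl fun j _ => ?_
  rw [mul_apply, mulVec, dotProduct]
  rfl

lemma quad_mul_mul_transpose {n : ℕ} (U Q : Matrix (Fin n) (Fin n) ℤ) (v : Fin n → ℤ) :
    quad (U * Q * Uᵀ) v = quad Q (v ᵥ* U) := by
  rw [quad, quad, Matrix.mul_assoc, ← mulVec_mulVec, ← mulVec_mulVec, dotProduct_mulVec,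
    mulVec_transpose]

/-- The integral Schur complement of the upper left entry. -/
def schurInt {n : ℕ} (Q : Matrix (Fin (n + 1)) (Fin (n + 1)) ℤ) : Matrix (Fin n) (Fin n) ℤ :=
  of fun i j => Q 0 0 * Q i.succ j.succ - Q i.succ 0 * Q j.succ 0

lemma schurInt_isSymm {n : ℕ} {Q : Matrix (Fin (n + 1)) (Fin (n + 1)) ℤ} (hQ : Q.IsSymm) :
    (schurInt Q).IsSymm := by
  ext i j
  simp [schurInt, hQ.apply i.succ j.succ, mul_comm]

/-- Completing the square in the first variable, with denominators cleared. -/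
lemma quad_cons {n : ℕ} {Q : Matrix (Fin (n + 1)) (Fin (n + 1)) ℤ} (hQ : Q.IsSymm) (x : ℤ)
    (u : Fin n → ℤ) : Q 0 0 * quad Q (Fin.cons x u) =
      quad (schurInt Q) u + (Q 0 0 * x + ∑ i, Q (Fin.succ i) 0 * u i) ^ 2 := by
  have h1 : quad Q (Fin.cons x u) = Q 0 0 * x ^ 2 + 2 * x * ∑ i, Q (Fin.succ i) 0 * u i +
      ∑ i, ∑ j, u i * (Q (Fin.succ i) (Fin.succ j) * u j) := by
    simp only [quad, dotProduct, mulVec, Fin.sum_univ_succ, Fin.cons_zero, Fin.cons_succ,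
      hQ.apply _ 0, mul_add, Finset.mul_sum, Finset.sum_add_distrib]
    have e : ∑ i, 2 * x * (Q (Fin.succ i) 0 * u i) = ∑ i, x * (Q (Fin.succ i) 0 * u i) +
        ∑ i, u i * (Q (Fin.succ i) 0 * x) := by
      rw [← Finset.sum_add_distrib]
      exact Finset.sum_congr rfl fun i _ => by ring
    rw [e]
    ring
  have h2 : quad (schurInt Q) u = Q 0 0 * (∑ i, ∑ j, u i * (Q (Fin.succ i) (Fin.succ j) * u j)) -
      (∑ i, Q (Fin.succ i) 0 * u i) ^ 2 := by
    rw [pow_two, Finset.sum_mul_sum]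
    simp only [quad, dotProduct, mulVec, schurInt, of_apply, Finset.mul_sum,
      ← Finset.sum_sub_distrib]
    exact Finset.sum_congr rfl fun i _ => Finset.sum_congr rfl fun j _ => by ring
  rw [h1, h2]
  ring

/-- The row operations `row_i ↦ Q₀₀ row_i - Q_{i0} row_0` clear the first column below the corner
and multiply the determinant by `Q₀₀ ^ n`. -/
lemma det_schurInt {n : ℕ} {Q : Matrix (Fin (n + 1)) (Fin (n + 1)) ℤ} (hQ : Q.IsSymm) :
    Q 0 0 * (schurInt Q).det = Q 0 0 ^ n * Q.det := by
  let T : Matrix (Fin (n + 1)) (Fin (n + 1)) ℤ :=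
    of (Fin.cons (Pi.single 0 1) fun i => Fin.cons (-Q i.succ 0) (Pi.single i (Q 0 0)))
  have hT : T.det = Q 0 0 ^ n := by
    rw [det_succ_row_zero, Fin.sum_univ_succ]
    have : (T.submatrix Fin.succ Fin.succ) = diagonal fun _ => Q 0 0 := by
      ext i j
      simp [T, diagonal_apply, Pi.single_apply, eq_comm]
    simp [T, Fin.succAbove_zero] at this ⊢
    rw [this]
    simp
  have hTQ : (T * Q).det = Q 0 0 * (schurInt Q).det := by
    have e0 : ∀ j, (T * Q) 0 j = Q 0 j := fun j => by
      simp [T, mul_apply, Fin.sum_univ_succ]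
    have e1 : ∀ i j, (T * Q) (Fin.succ i) j = -Q i.succ 0 * Q 0 j + Q 0 0 * Q i.succ j :=
      fun i j => by simp [T, mul_apply, Fin.sum_univ_succ, Pi.single_apply]
    have e2 : (T * Q).submatrix Fin.succ Fin.succ = schurInt Q := by
      ext i j
      rw [submatrix_apply, e1, schurInt, of_apply, hQ.apply j.succ 0]
      ring
    rw [det_succ_column_zero, Fin.sum_univ_succ, Finset.sum_eq_zero fun i _ => ?_]
    · simp [e0, e2, Fin.succAbove_zero]
    · rw [e1]; ring
  rw [← hTQ, det_mul, hT]

lemma two_mul_min_round (m y : ℤ) (hm : 0 < m) : ∃ x : ℤ, 4 * (m * x + y) ^ 2 ≤ m ^ 2 := by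
  refine ⟨-((2 * y + m) / (2 * m)), ?_⟩
  have h1 := Int.emod_add_mul_ediv (2 * y + m) (2 * m)
  have h2 := Int.emod_nonneg (2 * y + m) (show 2 * m ≠ 0 by omega)
  have h3 := Int.emod_lt_of_pos (2 * y + m) (show 0 < 2 * m by omega)
  generalize (2 * y + m) / (2 * m) = z at *
  generalize (2 * y + m) % (2 * m) = w at *
  have e : 2 * (m * -z + y) = w - m := by linarith
  have : 4 * (m * -z + y) ^ 2 = (w - m) ^ 2 := by rw [← e]; ring
  rw [this]
  nlinarith

/-- Weak Hermite reduction of positive definite integral quadratic forms. -/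
lemma exists_hermite_reduced (n : ℕ) : ∃ κ : ℕ, ∀ Q : Matrix (Fin n) (Fin n) ℤ, Q.IsSymm →
    (∀ v, v ≠ 0 → 0 < quad Q v) →
    ∃ U : Matrix (Fin n) (Fin n) ℤ, IsUnit U.det ∧ ∏ i, (U * Q * Uᵀ) i i ≤ κ * Q.det := by
  induction n with
  | zero => exact ⟨1, fun Q _ _ => ⟨1, by simp, by simp⟩⟩
  | succ n ih =>
    obtain ⟨κ, ih⟩ := ih
    refine ⟨2 ^ n * κ, fun Q₀ hQ₀ hpos₀ => ?_⟩
    have hrow : ∀ U : Matrix (Fin (n + 1)) (Fin (n + 1)) ℤ, IsUnit U.det → ∀ v, v ≠ 0 →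
        v ᵥ* U ≠ 0 := fun U hU v hv h => by
      apply hv
      have := congrArg (fun x => x ᵥ* U⁻¹) h
      simpa [vecMul_vecMul, mul_nonsing_inv _ hU] using this
    -- Among all equivalent forms one with the smallest possible corner entry is chosen.
    have hex : ∃ m : ℕ, ∃ U : Matrix (Fin (n + 1)) (Fin (n + 1)) ℤ, IsUnit U.det ∧
        (U * Q₀ * Uᵀ) 0 0 = m := by
      refine ⟨(Q₀ 0 0).toNat, 1, by simp, ?_⟩
      have := hpos₀ (Pi.single 0 1) (by simp)
      simp [quad] at this
      simp [this.le]
    classical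
    obtain ⟨U₀, hU₀, hm⟩ := Nat.find_spec hex
    set m := Nat.find hex with hm_def
    set Q := U₀ * Q₀ * U₀ᵀ with hQdef
    have hQ : Q.IsSymm := by
      rw [IsSymm, hQdef, transpose_mul, transpose_mul, transpose_transpose, hQ₀.eq,
        Matrix.mul_assoc]
    have hpos : ∀ v, v ≠ 0 → 0 < quad Q v := fun v hv => by
      rw [hQdef, quad_mul_mul_transpose]
      exact hpos₀ _ (hrow _ hU₀ _ hv)
    have hdet : Q.det = Q₀.det := by
      have : U₀.det * U₀.det = 1 := by
        rcases Int.isUnit_iff.1 hU₀ with h | h <;> simp [h]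
      rw [hQdef, det_mul, det_mul, det_transpose]
      linear_combination Q₀.det * this
    have hm0 : 0 < Q 0 0 := by
      have := hpos (Pi.single 0 1) (by simp)
      simpa [quad] using this
    -- Every row of a unimodular matrix can be swapped to the top, so its value is a corner entry of
    -- an equivalent form.
    have hmin : ∀ U : Matrix (Fin (n + 1)) (Fin (n + 1)) ℤ, IsUnit U.det → ∀ i,
        Q 0 0 ≤ quad Q (U i) := fun U hU i => by
      set S := U.submatrix (Equiv.swap 0 i) id with hS
      have hSu : IsUnit S.det := by
        rw [hS, det_permute]
        exact ((Equiv.Perm.sign (Equiv.swap 0 i)).isUnit.map (Int.castRingHom ℤ)).mul hU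
      have hSi : S 0 = U i := by ext j; simp [hS]
      have hp : 0 < quad Q (S 0) := hpos _ fun h0 => by
        apply hSu.ne_zero
        exact det_eq_zero_of_row_eq_zero 0 fun j => congrFun h0 j
      have := Nat.find_min' hex ⟨S * U₀, by rw [det_mul]; exact hSu.mul hU₀, by
        rw [transpose_mul, show S * U₀ * Q₀ * (U₀ᵀ * Sᵀ) = S * Q * Sᵀ by
          simp only [hQdef, Matrix.mul_assoc], mul_mul_transpose_apply]
        exact (Int.toNat_of_nonneg hp.le).symm⟩
      rw [← hSi, hm, ← Int.toNat_of_nonneg hp.le]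
      exact_mod_cast this
    obtain ⟨U', hU', hred⟩ := ih (schurInt Q) (schurInt_isSymm hQ) fun v hv => by
      -- With this first coordinate the square vanishes on the vector scaled by `Q₀₀`, so positivity
      -- of `Q` passes to the Schur complement.
      have h1 := quad_cons hQ (-∑ i, Q (Fin.succ i) 0 * v i) (Q 0 0 • v)
      have h2 : (Q 0 0 * -∑ i, Q (Fin.succ i) 0 * v i +
          ∑ i, Q (Fin.succ i) 0 * (Q 0 0 • v) i) = 0 := by
        simp only [Pi.smul_apply, smul_eq_mul, Finset.mul_sum, mul_neg, mul_left_comm,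
          neg_add_cancel]
      have h3 : quad (schurInt Q) (Q 0 0 • v) = Q 0 0 ^ 2 * quad (schurInt Q) v := by
        rw [quad, quad, mulVec_smul, smul_dotProduct, dotProduct_smul, smul_eq_mul, smul_eq_mul]
        ring
      rw [h2, h3] at h1
      have h4 : 0 < Q 0 0 * quad Q (Fin.cons (-∑ i, Q (Fin.succ i) 0 * v i) (Q 0 0 • v)) := by
        refine mul_pos hm0 (hpos _ fun h0 => hv ?_)
        funext i
        have := congrFun h0 i.succ
        simpa [hm0.ne'] using this
      rw [h1] at h4
      have h5 : 0 < Q 0 0 ^ 2 * quad (schurInt Q) v := by linarith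
      exact pos_of_mul_pos_right h5 (by positivity)
    choose x hx using fun i => two_mul_min_round (Q 0 0) (∑ j, Q (Fin.succ j) 0 * U' i j) hm0
    let U₁ : Matrix (Fin (n + 1)) (Fin (n + 1)) ℤ :=
      of (Fin.cons (Pi.single 0 1) fun i => Fin.cons (x i) (U' i))
    have hU₁ : IsUnit U₁.det := by
      have e : U₁.det = U'.det := by
        rw [det_succ_row_zero, Fin.sum_univ_succ]
        have : (U₁.submatrix Fin.succ Fin.succ) = U' := by
          ext i j
          simp [U₁]
        simp [U₁, Fin.succAbove_zero] at this ⊢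
        rw [this]
      rwa [e]
    -- Rounding bounds the square by `Q₀₀² / 4`, and minimality bounds `Q₀₀²` by the left side.
    -- Hence three quarters of the left side is at most the Schur value; the factor `2` is a
    -- convenient weakening of `4/3`.
    have hbound : ∀ i : Fin n, Q 0 0 * quad Q (U₁ i.succ) ≤ 2 * quad (schurInt Q) (U' i) := by
      intro i
      have h1 : Q 0 0 * quad Q (U₁ i.succ) = _ := quad_cons hQ (x i) (U' i)
      have h2 := hmin U₁ hU₁ i.succ
      have h3 := hx i
      nlinarith
    refine ⟨U₁ * U₀, by rw [det_mul]; exact hU₁.mul hU₀, ?_⟩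
    have e : U₁ * U₀ * Q₀ * (U₁ * U₀)ᵀ = U₁ * Q * U₁ᵀ := by
      rw [transpose_mul]; simp only [hQdef, Matrix.mul_assoc]
    rw [e, ← hdet]
    simp only [mul_mul_transpose_apply] at hred ⊢
    rw [Fin.prod_univ_succ]
    have h0 : quad Q (U₁ 0) = Q 0 0 := by
      rw [show U₁ 0 = Pi.single 0 1 from rfl]
      simp [quad]
    rw [h0]
    refine le_of_mul_le_mul_left ?_ (pow_pos hm0 n)
    calc Q 0 0 ^ n * (Q 0 0 * ∏ i : Fin n, quad Q (U₁ i.succ))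
        = Q 0 0 * ∏ i : Fin n, (Q 0 0 * quad Q (U₁ i.succ)) := by
          rw [Finset.prod_mul_distrib]; simp; ring
      _ ≤ Q 0 0 * ∏ i : Fin n, (2 * quad (schurInt Q) (U' i)) := by
          refine mul_le_mul_of_nonneg_left (Finset.prod_le_prod (fun i _ => ?_)
            fun i _ => hbound i) hm0.le
          exact mul_nonneg hm0.le (hm0.le.trans (hmin U₁ hU₁ _))
      _ = Q 0 0 * 2 ^ n * ∏ i : Fin n, quad (schurInt Q) (U' i) := by
          rw [Finset.prod_mul_distrib]; simp; ring
      _ ≤ Q 0 0 * 2 ^ n * (κ * (schurInt Q).det) :=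
          mul_le_mul_of_nonneg_left hred (by positivity)
      _ = Q 0 0 ^ n * ((2 ^ n * κ : ℕ) * Q.det) := by
          push_cast
          linear_combination (2 : ℤ) ^ n * κ * det_schurInt hQ

end Hermite

/-! ### The cocycle relation for the factor of automorphy -/

section Cocycle

variable {n : ℕ}

lemma GSpPos.ext' {g h : GSpPos n} (h1 : g.mat = h.mat) (h2 : g.mu = h.mu) : g = h := by
  cases g; cases h; simp only at h1 h2; subst h1; subst h2; rfl

/-- The product in `GSp⁺(n, ℝ)`. -/
def gmul (g h : GSpPos n) : GSpPos n where
  mat := g.mat * h.mat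
  mu := g.mu * h.mu
  mu_pos := mul_pos g.mu_pos h.mu_pos
  transpose_mul := by
    rw [transpose_mul]
    calc _ = h.matᵀ * (g.matᵀ * J (Fin n) ℝ * g.mat) * h.mat := by
          simp only [Matrix.mul_assoc]
      _ = _ := by
          rw [g.transpose_mul, mul_smul_comm, smul_mul_assoc, h.transpose_mul, smul_smul]

lemma toC_mul (A B : Matrix (Fin n) (Fin n) ℝ) : toC (A * B) = toC A * toC B := Matrix.map_mul

lemma toC_add (A B : Matrix (Fin n) (Fin n) ℝ) : toC (A + B) = toC A + toC B :=
  Matrix.map_add _ (map_add _) _ _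

lemma num_gmul_aux (g h : GSpPos n) (Z : UpperHalfSpace n) : num (gmul g h) Z =
    toC g.mat.toBlocks₁₁ * num h Z + toC g.mat.toBlocks₁₂ * den h Z := by
  rw [num, num, den, gmul, toBlocks₁₁_mul', toBlocks₁₂_mul', toC_add, toC_add, toC_mul, toC_mul,
    toC_mul, toC_mul]
  noncomm_ring

lemma den_gmul_aux (g h : GSpPos n) (Z : UpperHalfSpace n) : den (gmul g h) Z =
    toC g.mat.toBlocks₂₁ * num h Z + toC g.mat.toBlocks₂₂ * den h Z := by
  rw [den, num, den, gmul, toBlocks₂₁_mul', toBlocks₂₂_mul', toC_add, toC_add, toC_mul, toC_mul,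
    toC_mul, toC_mul]
  noncomm_ring

lemma act_mul_den (g : GSpPos n) (Z : UpperHalfSpace n) : (act g Z).1 * den g Z = num g Z := by
  rw [act, Matrix.mul_assoc, nonsing_inv_mul _ (isUnit_det_den g Z), mul_one]

lemma den_gmul (g h : GSpPos n) (Z : UpperHalfSpace n) :
    den (gmul g h) Z = den g (act h Z) * den h Z := by
  rw [den_gmul_aux, den.eq_def g, add_mul, Matrix.mul_assoc, act_mul_den]

lemma num_gmul (g h : GSpPos n) (Z : UpperHalfSpace n) :
    num (gmul g h) Z = num g (act h Z) * den h Z := by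
  rw [num_gmul_aux, num.eq_def g, add_mul, Matrix.mul_assoc, act_mul_den]

lemma act_gmul (g h : GSpPos n) (Z : UpperHalfSpace n) :
    act (gmul g h) Z = act g (act h Z) := by
  apply Subtype.ext
  change num (gmul g h) Z * (den (gmul g h) Z)⁻¹ = num g (act h Z) * (den g (act h Z))⁻¹
  rw [num_gmul, den_gmul, Matrix.mul_inv_rev, ← Matrix.mul_assoc, Matrix.mul_assoc _ (den h Z),
    mul_nonsing_inv _ (isUnit_det_den h Z), mul_one]

lemma autFactor_gmul (g h : GSpPos n) (Z : UpperHalfSpace n) :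
    autFactor (gmul g h) Z = autFactor g (act h Z) * autFactor h Z := by
  rw [autFactor, autFactor, autFactor, den_gmul, det_mul]
  rw [show (gmul g h).mu = g.mu * h.mu from rfl, Real.mul_rpow g.mu_pos.le h.mu_pos.le]
  push_cast
  ring

lemma autFactor_ne_zero (g : GSpPos n) (Z : UpperHalfSpace n) : autFactor g Z ≠ 0 := by
  refine mul_ne_zero ?_ (isUnit_det_den g Z).ne_zero
  exact_mod_cast (Real.rpow_pos_of_pos g.mu_pos _).ne'

lemma toGSpPos_mul (γ δ : SpZ n) : (γ * δ).toGSpPos = gmul γ.toGSpPos δ.toGSpPos := by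
  refine GSpPos.ext' ?_ ?_
  · exact Matrix.map_mul
  · simp [SpZ.toGSpPos, GSpPos.ofInt, gmul]

lemma autFactor_of_toBlocks₂₁_eq_zero (g : GSpPos n) (h : g.mat.toBlocks₂₁ = 0)
    (Z : UpperHalfSpace n) : autFactor g Z =
      ((g.mu ^ (-(n : ℝ) / 2) * g.mat.toBlocks₂₂.det : ℝ) : ℂ) := by
  have : toC (0 : Matrix (Fin n) (Fin n) ℝ) = 0 := by ext i j; simp
  rw [autFactor, den, h, this, zero_mul, zero_add, Complex.ofReal_mul]
  congr 1
  exact (RingHom.map_det Complex.ofRealHom _).symm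

/-- The imaginary part. -/
abbrev im (Z : UpperHalfSpace n) : Matrix (Fin n) (Fin n) ℝ := Z.1.map Complex.im

/-- Conjugating `W - W*`, for `W = g⟨Z⟩`, by `C Z + D` gives `2i μ Im Z`; the normalisation
`μ^(-n/2)` in `j` removes the power of `μ` from the determinant. -/
lemma det_im_act (g : GSpPos n) (Z : UpperHalfSpace n) :
    (im (act g Z)).det * ‖autFactor g Z‖ ^ 2 = (im Z).det := by
  have hu := isUnit_det_den g Z
  have huH : IsUnit (den g Z)ᴴ.det := by
    rw [det_conjTranspose]
    exact hu.star
  have e : (den g Z)ᴴ * ((act g Z).1 - (act g Z).1ᴴ) * den g Z =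
      (den g Z)ᴴ * num g Z - (num g Z)ᴴ * den g Z := by
    rw [mul_sub, sub_mul, Matrix.mul_assoc, act_mul_den]
    congr 1
    rw [← act_mul_den g Z, conjTranspose_mul]
  rw [den_conjTranspose_mul_num, sub_conjTranspose (act g Z).2.1, mul_smul_comm,
    smul_mul_assoc] at e
  have e' := smul_right_injective _ (by simp : (2 * Complex.I) ≠ 0) e
  have e2 := congrArg det e'
  rw [det_mul, det_mul, det_conjTranspose, det_smul] at e2
  have hd : ∀ A : Matrix (Fin n) (Fin n) ℝ, (toC A).det = ((A.det : ℝ) : ℂ) := fun A =>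
    (RingHom.map_det Complex.ofRealHom _).symm
  rw [hd, hd, Fintype.card_fin] at e2
  have e3 : (im (act g Z)).det * ‖(den g Z).det‖ ^ 2 = g.mu ^ n * (im Z).det := by
    have h1 : star (den g Z).det * (den g Z).det = ((‖(den g Z).det‖ ^ 2 : ℝ) : ℂ) := by
      rw [Complex.star_def, ← Complex.normSq_eq_conj_mul_self, Complex.normSq_eq_norm_sq]
    have h2 : ((im (act g Z)).det : ℂ) * (star (den g Z).det * (den g Z).det) =
        (g.mu : ℂ) ^ n * ((im Z).det : ℂ) := by
      rw [← e2]; ring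
    rw [h1] at h2
    exact_mod_cast h2
  rw [autFactor, norm_mul, mul_pow, Complex.norm_real, Real.norm_of_nonneg
    (Real.rpow_nonneg g.mu_pos.le _), mul_left_comm, e3, ← Real.rpow_natCast, ← Real.rpow_mul
    g.mu_pos.le, ← Real.rpow_natCast, ← mul_assoc, ← Real.rpow_add g.mu_pos]
  have : -(n : ℝ) / 2 * (2 : ℕ) + n = 0 := by push_cast; ring
  rw [this, Real.rpow_zero, one_mul]

lemma det_im_pos (Z : UpperHalfSpace n) : 0 < (im Z).det := Z.2.2.det_pos

/-- The factor `j(g, Z)^{-k} |j(g, Z)|^{-2s+k}`. -/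
def hFac (k : ℤ) (s : ℂ) (g : GSpPos n) (Z : UpperHalfSpace n) : ℂ :=
  autFactor g Z ^ (-k) * ((‖autFactor g Z‖ : ℝ) : ℂ) ^ (-2 * s + k)

lemma hFac_gmul (k : ℤ) (s : ℂ) (g h : GSpPos n) (Z : UpperHalfSpace n) :
    hFac k s (gmul g h) Z = hFac k s g (act h Z) * hFac k s h Z := by
  rw [hFac, hFac, hFac, autFactor_gmul, mul_zpow, norm_mul, Complex.ofReal_mul,
    Complex.mul_cpow_ofReal_nonneg (norm_nonneg _) (norm_nonneg _)]
  ring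

lemma norm_hFac (k : ℤ) (s : ℂ) (g : GSpPos n) (Z : UpperHalfSpace n) :
    ‖hFac k s g Z‖ = ‖autFactor g Z‖ ^ (-2 * s.re) := by
  have h0 : 0 < ‖autFactor g Z‖ := norm_pos_iff.2 (autFactor_ne_zero g Z)
  rw [hFac, norm_mul, norm_zpow, Complex.norm_cpow_eq_rpow_re_of_pos h0, ← Real.rpow_intCast,
    ← Real.rpow_add h0]
  congr 1
  simp

/-- The power of `det Y` in front of the series supplies exactly the factor `|j|^(-2s+k)` that
distinguishes `hFac` from `j^(-k)`. -/
lemma det_im_cpow_act (k : ℤ) (s : ℂ) (g : GSpPos n) (Z : UpperHalfSpace n) :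
    autFactor g Z ^ (-k) * (((im (act g Z)).det : ℝ) : ℂ) ^ (s - (k : ℂ) / 2) =
      (((im Z).det : ℝ) : ℂ) ^ (s - (k : ℂ) / 2) * hFac k s g Z := by
  have h0 : 0 < ‖autFactor g Z‖ := norm_pos_iff.2 (autFactor_ne_zero g Z)
  have h1 : ((‖autFactor g Z‖ ^ 2 : ℝ) : ℂ) ^ (s - (k : ℂ) / 2) *
      ((‖autFactor g Z‖ : ℝ) : ℂ) ^ (-2 * s + k) = 1 := by
    have : ((‖autFactor g Z‖ ^ 2 : ℝ) : ℂ) ^ (s - (k : ℂ) / 2) =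
        ((‖autFactor g Z‖ : ℝ) : ℂ) ^ (2 * (s - (k : ℂ) / 2)) := by
      rw [Complex.ofReal_pow, ← Complex.cpow_nat_mul']
      · norm_num
      · rw [Complex.arg_ofReal_of_nonneg h0.le]; simp [Real.pi_pos]
      · rw [Complex.arg_ofReal_of_nonneg h0.le]; simp [Real.pi_pos.le]
    rw [this, ← Complex.cpow_add _ _ (by exact_mod_cast h0.ne')]
    rw [show 2 * (s - (k : ℂ) / 2) + (-2 * s + k) = 0 by ring, Complex.cpow_zero]
  rw [← det_im_act g Z, Complex.ofReal_mul, Complex.mul_cpow_ofReal_nonneg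
    (det_im_pos (act g Z)).le (by positivity), hFac]
  linear_combination -(autFactor g Z ^ (-k) *
    (((im (act g Z)).det : ℝ) : ℂ) ^ (s - (k : ℂ) / 2)) * h1

end Cocycle

/-! ### Eisenstein series attached to functions on the modular group -/

section EisensteinOfFunction

variable {n p : ℕ}

/-- Left orbits of the Siegel parabolic subgroup. -/
abbrev ParQuot (n : ℕ) : Type := Quotient (QuotientGroup.rightRel (parabolic n))

/-- The Eisenstein series attached to a function on `Sp(n, ℤ)`. -/
def eisOf (k : ℤ) (φ : SpZ n → ℂ) (Z : UpperHalfSpace n) (s : ℂ) : ℂ :=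
  (((im Z).det : ℝ) : ℂ) ^ (s - (k : ℂ) / 2) *
    ∑' q : ParQuot n, φ q.out * hFac k s q.out.toGSpPos Z

lemma exists_out_eq (γ : SpZ n) :
    ∃ η ∈ parabolic n, (Quotient.mk _ γ : ParQuot n).out = η * γ := by
  have h := Quotient.mk_out (s := QuotientGroup.rightRel (parabolic n)) γ
  rw [QuotientGroup.rightRel_apply] at h
  refine ⟨_, inv_mem h, ?_⟩
  group

/-- `psiStar` vanishes off its cell, so the sum may be extended to all orbits. The different series
then share one index set. -/
lemma eisenstein_eq_eisOf (ψ : DirichletCharacter ℂ p) (k : ℤ) (r : ℕ) (Z : UpperHalfSpace n)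
    (s : ℂ) : eisenstein ψ k r Z s = eisOf k (psiStar ψ r) Z s := by
  rw [eisenstein, eisOf]
  congr 1
  let S : Set (ParQuot n) := {q | ∃ γ ∈ cell n p r, (Quotient.mk _ γ : ParQuot n) = q}
  have h1 := tsum_subtype S fun q => psiStar ψ r q.out * hFac k s q.out.toGSpPos Z
  have h2 : S.indicator (fun q => psiStar ψ r q.out * hFac k s q.out.toGSpPos Z) =
      fun q => psiStar ψ r q.out * hFac k s q.out.toGSpPos Z := by
    rw [Set.indicator_eq_self]
    intro q hq
    by_contra hqS
    apply hq
    have : q.out ∉ cell n p r := fun h => hqS ⟨_, h, q.out_eq⟩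
    simp only [psiStar_eq_zero this, zero_mul]
  rw [h2] at h1
  rw [← h1]
  refine tsum_congr fun q => ?_
  rw [hFac, ← mul_assoc]
  rfl

/-- Left equivariance of functions on `Sp(n, ℤ)`. -/
def LeftEquivariant (ψ : DirichletCharacter ℂ p) (φ : SpZ n → ℂ) : Prop :=
  ∀ η ∈ parabolic n, ∀ γ, φ (η * γ) = charDet ψ η.1.toBlocks₂₂ * φ γ

variable {ψ : DirichletCharacter ℂ p} {k : ℤ}

lemma character_sign (hk : ψ (-1) = (-1) ^ k) {d : ℤ} (hd : d = 1 ∨ d = -1) :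
    ((d : ℝ) : ℂ) ^ (-k) = ψ (d : ZMod p) := by
  rcases hd with rfl | rfl
  · simp
  · simp only [Int.cast_neg, Int.cast_one, Complex.ofReal_neg, Complex.ofReal_one, hk, _root_.zpow_neg]
    rw [← _root_.inv_zpow, inv_neg_one]

/-- Here `j = det D = ±1`, and the parity condition on `ψ` identifies `(±1)^(-k)` with `ψ(±1)`. -/
lemma hFac_parabolic (hk : ψ (-1) = (-1) ^ k) (s : ℂ) {η : SpZ n} (hη : η ∈ parabolic n)
    (Z : UpperHalfSpace n) : hFac k s η.toGSpPos Z = charDet ψ η.1.toBlocks₂₂ := by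
  have hd := Int.isUnit_iff.1 (parabolic_det hη)
  have h1 : autFactor η.toGSpPos Z = ((η.1.toBlocks₂₂.det : ℝ) : ℂ) := by
    rw [autFactor_of_toBlocks₂₁_eq_zero]
    · have h2 : η.toGSpPos.mat.toBlocks₂₂.det = (η.1.toBlocks₂₂.det : ℝ) :=
        (RingHom.map_det (Int.castRingHom ℝ) _).symm
      have h3 : η.toGSpPos.mu = 1 := by simp [SpZ.toGSpPos, GSpPos.ofInt]
      rw [h2, h3, Real.one_rpow, one_mul]
    · ext i j
      have := congrFun (congrFun (mem_parabolic.1 hη) i) j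
      simp only [toBlocks₂₁, of_apply, Matrix.zero_apply] at this
      simp [SpZ.toGSpPos, GSpPos.ofInt, toBlocks₂₁, this]
  have h2 : ‖autFactor η.toGSpPos Z‖ = 1 := by
    rw [h1, Complex.norm_real]
    rcases hd with h | h <;> simp [h]
  rw [hFac, h2, h1, character_sign hk hd, charDet]
  simp

lemma IsSquareTrivial.parabolic_mul_self (hq : IsSquareTrivial ψ) {η : SpZ n}
    (h : η ∈ parabolic n) :
    charDet ψ η.1.toBlocks₂₂ * charDet ψ η.1.toBlocks₂₂ = 1 :=
  hq.Gamma0_mul_self (parabolic_le_Gamma0 h)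

lemma slash_eisOf (k : ℤ) (φ : SpZ n → ℂ) (s : ℂ) (g : GSpPos n) (Z : UpperHalfSpace n) :
    slash k (fun Z => eisOf k φ Z s) g Z = (((im Z).det : ℝ) : ℂ) ^ (s - (k : ℂ) / 2) *
      ∑' q : ParQuot n, φ q.out * hFac k s (gmul q.out.toGSpPos g) Z := by
  simp only [slash, eisOf, hFac_gmul]
  rw [← mul_assoc, det_im_cpow_act, mul_assoc, ← tsum_mul_left]
  congr 1
  exact tsum_congr fun q => by ring

end EisensteinOfFunction

/-! ### Comparing factors of automorphy at different points -/

section Comparison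

variable {n : ℕ}

/-- The real matrix underlying an integral one. -/
abbrev toR {m : Type*} (M : Matrix m m ℤ) : Matrix m m ℝ := M.map (Int.castRingHom ℝ)

lemma toR_mul {m : Type*} [Fintype m] (A B : Matrix m m ℤ) : toR (A * B) = toR A * toR B :=
  Matrix.map_mul

lemma toR_add {m : Type*} (A B : Matrix m m ℤ) : toR (A + B) = toR A + toR B :=
  Matrix.map_add _ (map_add _) _ _

lemma toR_sub {m : Type*} (A B : Matrix m m ℤ) : toR (A - B) = toR A - toR B :=
  Matrix.map_sub _ (map_sub _) _ _

lemma toR_one {m : Type*} [DecidableEq m] : toR (1 : Matrix m m ℤ) = 1 :=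
  Matrix.map_one _ (map_zero _) (map_one _)

lemma den_toGSpPos (γ : SpZ n) (Z : UpperHalfSpace n) : den γ.toGSpPos Z =
    toC (toR γ.1.toBlocks₂₁) * Z.1 + toC (toR γ.1.toBlocks₂₂) := rfl

lemma autFactor_toGSpPos (γ : SpZ n) (Z : UpperHalfSpace n) :
    autFactor γ.toGSpPos Z = (den γ.toGSpPos Z).det := by
  have h3 : γ.toGSpPos.mu = 1 := by simp [SpZ.toGSpPos, GSpPos.ofInt]
  rw [autFactor, h3, Real.one_rpow, Complex.ofReal_one, one_mul]

/-- `c` is a lower bound for the imaginary part of `Z`. -/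
def ImLowerBound (c : ℝ) (Z : UpperHalfSpace n) : Prop :=
  ∀ x : Fin n → ℂ, c * ‖x‖ ^ 2 ≤ (star x ⬝ᵥ (toC (im Z) *ᵥ x)).re

open scoped ComplexOrder in
lemma exists_imLowerBound (Z : UpperHalfSpace n) : ∃ c > 0, ImLowerBound c Z := by
  have hpos := posDef_toC_iff.2 Z.2.2
  by_cases hne : (Metric.sphere (0 : Fin n → ℂ) 1).Nonempty
  · have hcont : Continuous fun x : Fin n → ℂ => (star x ⬝ᵥ (toC (im Z) *ᵥ x)).re := by
      refine Complex.continuous_re.comp ?_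
      simp only [dotProduct, mulVec, Pi.star_apply]
      fun_prop
    obtain ⟨x₀, hx₀, hmin⟩ := (isCompact_sphere (0 : Fin n → ℂ) 1).exists_isMinOn hne
      hcont.continuousOn
    have hx₀' : x₀ ≠ 0 := by
      rintro rfl
      simp at hx₀
    refine ⟨_, (Complex.lt_def.1 (hpos.dotProduct_mulVec_pos hx₀')).1, fun x => ?_⟩
    by_cases hx : x = 0
    · simp [hx]
    have hn : ‖x‖ ≠ 0 := norm_ne_zero_iff.2 hx
    have h1 : ((‖x‖⁻¹ : ℝ) : ℂ) • x ∈ Metric.sphere (0 : Fin n → ℂ) 1 := by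
      simp [norm_smul, hn]
    have h2 := hmin h1
    have h3 : star (((‖x‖⁻¹ : ℝ) : ℂ) • x) ⬝ᵥ (toC (im Z) *ᵥ (((‖x‖⁻¹ : ℝ) : ℂ) • x)) =
        ((‖x‖⁻¹ ^ 2 : ℝ) : ℂ) * (star x ⬝ᵥ (toC (im Z) *ᵥ x)) := by
      rw [mulVec_smul, dotProduct_smul, star_smul, smul_dotProduct]
      simp only [smul_eq_mul, Complex.star_def, Complex.conj_ofReal]
      push_cast
      ring
    simp only [Set.mem_ofPred_eq, h3, Complex.re_ofReal_mul] at h2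
    rw [inv_pow, inv_mul_eq_div, le_div_iff₀ (by positivity)] at h2
    exact h2
  -- An empty unit sphere means that there is no nonzero vector, that is `n = 0`.
  · refine ⟨1, one_pos, fun x => ?_⟩
    have hx : x = 0 := by
      by_contra hx
      exact hne ⟨((‖x‖⁻¹ : ℝ) : ℂ) • x, by simp [norm_smul, norm_ne_zero_iff.2 hx]⟩
    simp [hx]

/-- The symmetry of `C ᵗD` gives `W - W* = -2i W Y W*` for `W = (C Z + D)⁻¹ C`. On the diagonal this
says `c ‖W_i‖² ≤ -Im W_ii ≤ ‖W_i‖`, a bound on each row `W_i` that is uniform in `γ`. -/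
lemma norm_den_inv_mul_le {c : ℝ} (hc : 0 < c) {Z : UpperHalfSpace n} (hZ : ImLowerBound c Z)
    (γ : SpZ n) (i j : Fin n) :
    ‖((den γ.toGSpPos Z)⁻¹ * toC (toR γ.1.toBlocks₂₁)) i j‖ ≤ 1 / c := by
  set M := den γ.toGSpPos Z with hM
  set C := toC (toR γ.1.toBlocks₂₁) with hC
  set D := toC (toR γ.1.toBlocks₂₂) with hD
  set W := M⁻¹ * C with hW
  have hu := isUnit_det_den γ.toGSpPos Z
  have huH : IsUnit Mᴴ.det := by
    rw [det_conjTranspose]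
    exact hu.star
  have hCD : C * Dᴴ = D * Cᴴ := by
    rw [hC, hD, toC_conjTranspose, toC_conjTranspose]
    have h : toC (toR (γ.1.toBlocks₂₁ * γ.1.toBlocks₂₂ᵀ)) =
        toC (toR (γ.1.toBlocks₂₂ * γ.1.toBlocks₂₁ᵀ)) := by rw [(symplectic_relations' γ).2.1]
    rw [toR_mul, toR_mul, toC_mul, toC_mul] at h
    exact h
  have h1 : C * Mᴴ - M * Cᴴ = -((2 * Complex.I) • (C * toC (im Z) * Cᴴ)) := by
    have hs : Z.1ᴴ = Z.1 - (2 * Complex.I) • toC (im Z) := by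
      rw [← sub_conjTranspose Z.2.1]; abel
    have hM' : M = C * Z.1 + D := den_toGSpPos γ Z
    rw [hM', conjTranspose_add, conjTranspose_mul, mul_add, add_mul, hCD, hs]
    simp only [sub_mul, mul_sub, smul_mul_assoc, mul_smul_comm, Matrix.mul_assoc]
    abel
  have h2 : W - Wᴴ = -((2 * Complex.I) • (W * toC (im Z) * Wᴴ)) := by
    have e1 : W = M⁻¹ * (C * Mᴴ) * (Mᴴ)⁻¹ := by
      rw [hW, Matrix.mul_assoc, Matrix.mul_assoc C, mul_nonsing_inv _ huH, mul_one]
    have e2 : Wᴴ = M⁻¹ * (M * Cᴴ) * (Mᴴ)⁻¹ := by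
      rw [← Matrix.mul_assoc, nonsing_inv_mul _ hu, one_mul, hW, conjTranspose_mul,
        conjTranspose_nonsing_inv]
    have e3 : W * toC (im Z) * Wᴴ = M⁻¹ * (C * toC (im Z) * Cᴴ) * (Mᴴ)⁻¹ := by
      rw [hW, conjTranspose_mul, conjTranspose_nonsing_inv]
      simp only [Matrix.mul_assoc]
    rw [e3, ← smul_mul_assoc, ← mul_smul_comm, ← Matrix.neg_mul, ← Matrix.mul_neg, ← h1, mul_sub,
      sub_mul, ← e1, ← e2]
  have h3 := congrFun (congrFun h2 i) i
  have h4 : (W * toC (im Z) * Wᴴ) i i = star (star (W i)) ⬝ᵥ (toC (im Z) *ᵥ star (W i)) := by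
    rw [star_star, Matrix.mul_assoc, mul_apply]
    refine Finset.sum_congr rfl fun l _ => ?_
    rw [mul_apply]
    rfl
  have h5 : (W i i).im = -((W * toC (im Z) * Wᴴ) i i).re := by
    simp only [Matrix.sub_apply, conjTranspose_apply, Matrix.neg_apply, Matrix.smul_apply, smul_eq_mul,
      Complex.star_def, Complex.sub_conj] at h3
    generalize (W * toC (im Z) * Wᴴ) i i = z at h3 ⊢
    have := congrArg Complex.im h3
    simp at this
    linarith
  have h6 := hZ (star (W i))
  rw [← h4, norm_star] at h6
  have h7 : ‖W i i‖ ≤ ‖W i‖ := norm_le_pi_norm _ _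
  have h8 : c * ‖W i‖ ^ 2 ≤ ‖W i‖ := by
    have := Complex.abs_im_le_norm (W i i)
    have := neg_abs_le (W i i).im
    linarith
  have h9 : ‖W i‖ ≤ 1 / c := by
    rw [le_div_iff₀ hc]
    by_contra! hlt
    have h0 : 0 ≤ ‖W i‖ := norm_nonneg _
    have h10 : 0 < ‖W i‖ := lt_of_le_of_ne h0 fun h => by rw [← h] at hlt; simp at hlt; linarith
    nlinarith
  exact (norm_le_pi_norm (W i) j).trans h9

lemma norm_det_le {m : Type*} [Fintype m] [DecidableEq m] (M : Matrix m m ℂ) {K : ℝ}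
    (h : ∀ i j, ‖M i j‖ ≤ K) :
    ‖M.det‖ ≤ (Nat.factorial (Fintype.card m) : ℝ) * K ^ Fintype.card m := by
  have := det_le (A := M) (abv := NormedField.toAbsoluteValue ℂ) (x := K) h
  rwa [nsmul_eq_mul] at this

/-- The matrix in the hypothesis is the quotient of the denominators, `C Z₀ + D = (C Z + D)(1 + W
(Z₀ - Z))` with `W = (C Z + D)⁻¹ C`; its determinant is bounded entrywise. -/
lemma norm_autFactor_le {Z Z₀ : UpperHalfSpace n} {K : ℝ} (γ : SpZ n)
    (h : ∀ i j, ‖(1 + (den γ.toGSpPos Z)⁻¹ * toC (toR γ.1.toBlocks₂₁) * (Z₀.1 - Z.1)) i j‖ ≤ K) :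
    ‖autFactor γ.toGSpPos Z₀‖ ≤ (Nat.factorial n * K ^ n) * ‖autFactor γ.toGSpPos Z‖ := by
  have hu := isUnit_det_den γ.toGSpPos Z
  have e : den γ.toGSpPos Z₀ = den γ.toGSpPos Z *
      (1 + (den γ.toGSpPos Z)⁻¹ * toC (toR γ.1.toBlocks₂₁) * (Z₀.1 - Z.1)) := by
    rw [mul_add, mul_one, Matrix.mul_assoc, ← Matrix.mul_assoc (den γ.toGSpPos Z),
      mul_nonsing_inv _ hu, one_mul, den_toGSpPos, den_toGSpPos, mul_sub]
    abel
  rw [autFactor_toGSpPos, autFactor_toGSpPos, e, det_mul, norm_mul, mul_comm]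
  refine mul_le_mul_of_nonneg_right ?_ (norm_nonneg _)
  simpa using norm_det_le _ h

lemma exists_norm_autFactor_le (Z Z₀ : UpperHalfSpace n) :
    ∃ K > 0, ∀ γ : SpZ n, ‖autFactor γ.toGSpPos Z₀‖ ≤ K * ‖autFactor γ.toGSpPos Z‖ := by
  obtain ⟨c, hc, hZ⟩ := exists_imLowerBound Z
  let B : ℝ := 1 + ∑ i, ∑ j, ‖(Z₀.1 - Z.1) i j‖
  have hB : ∀ i j, ‖(Z₀.1 - Z.1) i j‖ ≤ B := fun i j => by
    have h1 := Finset.single_le_sum (f := fun j => ‖(Z₀.1 - Z.1) i j‖)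
      (fun j _ => norm_nonneg _) (Finset.mem_univ j)
    have h2 := Finset.single_le_sum (f := fun i => ∑ j, ‖(Z₀.1 - Z.1) i j‖)
      (fun i _ => Finset.sum_nonneg fun j _ => norm_nonneg _) (Finset.mem_univ i)
    simp only [B]
    linarith
  have hB0 : 0 ≤ B := add_nonneg zero_le_one
    (Finset.sum_nonneg fun i _ => Finset.sum_nonneg fun j _ => norm_nonneg _)
  refine ⟨Nat.factorial n * (1 + n * (1 / c * B)) ^ n, by positivity, fun γ =>
    norm_autFactor_le γ fun i j => ?_⟩
  rw [Matrix.add_apply]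
  refine (norm_add_le _ _).trans (add_le_add ?_ ?_)
  · rw [one_apply]; split_ifs <;> simp
  · rw [mul_apply]
    refine (norm_sum_le _ _).trans ?_
    refine (Finset.sum_le_card_nsmul _ _ (1 / c * B) fun l _ => ?_).trans_eq (by simp)
    rw [norm_mul]
    exact mul_le_mul (norm_den_inv_mul_le hc hZ γ i l) (hB l j) (norm_nonneg _) (by positivity)

/-- The point `i t` of the upper half space. -/
def scalarPt (n : ℕ) (t : ℝ) (ht : 0 < t) : UpperHalfSpace n :=
  ⟨((t : ℂ) * Complex.I) • 1, by
    rw [IsSymm, transpose_smul, transpose_one], by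
    have : (((t : ℂ) * Complex.I) • (1 : Matrix (Fin n) (Fin n) ℂ)).map Complex.im = t • 1 := by
      ext i j
      simp [one_apply]
      split_ifs <;> simp
    rw [this]
    exact PosDef.one.smul ht⟩

lemma im_scalarPt (t : ℝ) (ht : 0 < t) : im (scalarPt n t ht) = t • 1 := by
  ext i j
  simp [scalarPt, one_apply]
  split_ifs <;> simp

lemma imLowerBound_scalarPt (t : ℝ) (ht : 0 < t) : ImLowerBound t (scalarPt n t ht) := by
  intro x
  have e : toC (t • (1 : Matrix (Fin n) (Fin n) ℝ)) = (t : ℂ) • 1 := by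
    ext i j
    simp [one_apply]
    split_ifs <;> simp
  rw [im_scalarPt, e, smul_mulVec, one_mulVec, dotProduct_smul, smul_eq_mul,
    Complex.re_ofReal_mul]
  refine mul_le_mul_of_nonneg_left ?_ ht.le
  have h1 : (star x ⬝ᵥ x).re = ∑ i, ‖x i‖ ^ 2 := by
    rw [dotProduct, Complex.re_sum]
    refine Finset.sum_congr rfl fun i _ => ?_
    rw [Pi.star_apply, Complex.star_def, ← Complex.normSq_eq_conj_mul_self, Complex.ofReal_re,
      Complex.normSq_eq_norm_sq]
  rw [h1]
  have h0 : 0 ≤ ∑ i, ‖x i‖ ^ 2 := Finset.sum_nonneg fun i _ => by positivity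
  rw [← Real.sqrt_le_sqrt_iff h0, Real.sqrt_sq (norm_nonneg _), pi_norm_le_iff_of_nonneg
    (Real.sqrt_nonneg _)]
  intro i
  refine Real.le_sqrt_of_sq_le ?_
  exact Finset.single_le_sum (f := fun i => ‖x i‖ ^ 2) (fun i _ => by positivity)
    (Finset.mem_univ i)

/-- For `Z = i t` one has `|W_ij| ≤ 1/t`, so the quotient has entries at most `1 + (t - 1)/t ≤ 2`.
The constant does not depend on `t`, as dominated convergence for `t → ∞` requires. -/
lemma norm_autFactor_scalarPt_le (t : ℝ) (ht : 1 ≤ t) (γ : SpZ n) :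
    ‖autFactor γ.toGSpPos (scalarPt n 1 one_pos)‖ ≤
      (Nat.factorial n * 2 ^ n) * ‖autFactor γ.toGSpPos (scalarPt n t (by linarith))‖ := by
  have ht0 : 0 < t := by linarith
  refine norm_autFactor_le γ fun i j => ?_
  have e : (scalarPt n 1 one_pos).1 - (scalarPt n t ht0).1 =
      (((1 - t : ℝ) : ℂ) * Complex.I) • 1 := by
    simp only [scalarPt, ← sub_smul]
    congr 1
    push_cast
    ring
  rw [e, mul_smul_comm, mul_one, Matrix.add_apply, Matrix.smul_apply, smul_eq_mul]
  refine (norm_add_le _ _).trans ?_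
  have h1 : ‖(1 : Matrix (Fin n) (Fin n) ℂ) i j‖ ≤ 1 := by
    rw [one_apply]; split_ifs <;> simp
  have h2 := norm_den_inv_mul_le ht0 (imLowerBound_scalarPt t ht0) γ i j
  have h3 : ‖((1 - t : ℝ) : ℂ) * Complex.I‖ = t - 1 := by
    rw [norm_mul, Complex.norm_I, mul_one, Complex.norm_real, Real.norm_eq_abs,
      abs_of_nonpos (by linarith)]
    ring
  rw [norm_mul, h3]
  have h4 : (t - 1) * (1 / t) ≤ 1 := by
    rw [mul_one_div, div_le_one ht0]; linarith
  have h5 := mul_le_mul_of_nonneg_left h2 (show 0 ≤ t - 1 by linarith)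
  linarith

end Comparison

/-! ### Gram matrices and reduced representatives -/

section Summability

lemma summable_prod_pow (n : ℕ) {r : ℝ} (h0 : 0 ≤ r) (h1 : r < 1) :
    Summable fun a : Fin n → ℕ => ∏ i, r ^ a i := by
  induction n with
  | zero => exact Summable.of_finite
  | succ n ih =>
    rw [← (Fin.consEquiv fun _ : Fin (n + 1) => ℕ).summable_iff]
    have := (summable_geometric_of_lt_one h0 h1).mul_of_nonneg ih (fun _ => by positivity)
      (fun _ => Finset.prod_nonneg fun _ _ => by positivity)
    refine this.congr fun x => ?_
    simp [Fin.prod_univ_succ, Fin.consEquiv]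

/-- `N_i` occurs `n - i` times as first factor and `i + 1` times as second factor, with `i` counted
from `0`. The total exponent `n + 1` is the source of the bound `2 Re s > n + 1`. -/
lemma prod_prod_ite_le {n : ℕ} (N : Fin n → ℝ) :
    ∏ i, ∏ j, (if i ≤ j then N i * N j else 1) = ∏ i, N i ^ (n + 1) := by
  have h : ∀ i j : Fin n, (if i ≤ j then N i * N j else 1) =
      (if i ≤ j then N i else 1) * (if i ≤ j then N j else 1) := fun i j => by
    split_ifs <;> simp
  simp only [h, Finset.prod_mul_distrib]
  have e2 : ∏ i, ∏ j, (if i ≤ j then N j else 1) = ∏ j, ∏ i, (if i ≤ j then N j else 1) :=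
    Finset.prod_comm
  rw [e2, ← Finset.prod_mul_distrib]
  refine Finset.prod_congr rfl fun i _ => ?_
  rw [Finset.prod_ite, Finset.prod_ite]
  simp only [Finset.prod_const, one_pow, mul_one]
  rw [← pow_add]
  congr 1
  have h1 : (Finset.univ.filter fun j => i ≤ j) = Finset.Ici i := by ext; simp
  have h2 : (Finset.univ.filter fun j => j ≤ i) = Finset.Iic i := by ext; simp
  rw [h1, h2, Fin.card_Ici, Fin.card_Iic]
  omega

variable {n : ℕ}

/-- The Gram matrix of the lower rows. -/
def gram (γ : SpZ n) : Matrix (Fin n) (Fin n) ℤ :=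
  γ.1.toBlocks₂₁ * γ.1.toBlocks₂₁ᵀ + γ.1.toBlocks₂₂ * γ.1.toBlocks₂₂ᵀ

/-- The point `i`. -/
def iPt (n : ℕ) : UpperHalfSpace n := scalarPt n 1 one_pos

/-- The real part of `γ⟨i⟩`. -/
def rePt (γ : SpZ n) : Matrix (Fin n) (Fin n) ℝ := (act γ.toGSpPos (iPt n)).1.map Complex.re

lemma gram_isSymm (γ : SpZ n) : (gram γ).IsSymm := by
  rw [IsSymm, gram, transpose_add, transpose_mul, transpose_mul, transpose_transpose,
    transpose_transpose]

lemma dotProduct_self_nonneg_int (v : Fin n → ℤ) : 0 ≤ v ⬝ᵥ v :=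
  Finset.sum_nonneg fun _ _ => mul_self_nonneg _

lemma quad_gram (γ : SpZ n) (v : Fin n → ℤ) : quad (gram γ) v =
    (v ᵥ* γ.1.toBlocks₂₁) ⬝ᵥ (v ᵥ* γ.1.toBlocks₂₁) +
    (v ᵥ* γ.1.toBlocks₂₂) ⬝ᵥ (v ᵥ* γ.1.toBlocks₂₂) := by
  rw [quad, gram, add_mulVec, dotProduct_add, ← mulVec_mulVec, ← mulVec_mulVec, dotProduct_mulVec,
    dotProduct_mulVec v γ.1.toBlocks₂₂, mulVec_transpose, mulVec_transpose]

/-- If the value is not positive, `v` annihilates both `C` and `D`, and then `D ᵗA - C ᵗB = 1`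
forces `v = 0`. -/
lemma quad_gram_pos (γ : SpZ n) (v : Fin n → ℤ) (hv : v ≠ 0) : 0 < quad (gram γ) v := by
  rw [quad_gram]
  have h1 := dotProduct_self_nonneg_int (v ᵥ* γ.1.toBlocks₂₁)
  have h2 := dotProduct_self_nonneg_int (v ᵥ* γ.1.toBlocks₂₂)
  by_contra! h
  have h3 : v ᵥ* γ.1.toBlocks₂₁ = 0 := dotProduct_self_eq_zero.1 (by linarith)
  have h4 : v ᵥ* γ.1.toBlocks₂₂ = 0 := dotProduct_self_eq_zero.1 (by linarith)
  have h5 := congrArg transpose (symplectic_relations' γ).2.2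
  rw [transpose_sub, transpose_mul, transpose_mul, transpose_transpose, transpose_transpose,
    transpose_one] at h5
  have h6 := congrArg (fun M => v ᵥ* M) h5
  rw [vecMul_sub, ← vecMul_vecMul, ← vecMul_vecMul, h3, h4] at h6
  simp at h6
  exact hv h6.symm

lemma gram_levi_mul (U V : Matrix (Fin n) (Fin n) ℤ) (h : U * V = 1) (γ : SpZ n) :
    gram (levi U V h * γ) = U * gram γ * Uᵀ := by
  rw [gram, parabolic_mul_toBlocks₂₁ _ _ (levi_mem U V h),
    parabolic_mul_toBlocks₂₂ _ _ (levi_mem U V h), levi, toBlocks_fromBlocks₂₂, gram,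
    transpose_mul, transpose_mul]
  noncomm_ring

lemma gram_unip_mul (S : Matrix (Fin n) (Fin n) ℤ) (h : S.IsSymm) (γ : SpZ n) :
    gram (unip S h * γ) = gram γ := by
  rw [gram, parabolic_mul_toBlocks₂₁ _ _ (unip_mem S h),
    parabolic_mul_toBlocks₂₂ _ _ (unip_mem S h), unip, toBlocks_fromBlocks₂₂, one_mul, one_mul,
    gram]

lemma rePt_unip_mul (S : Matrix (Fin n) (Fin n) ℤ) (h : S.IsSymm) (γ : SpZ n) :
    rePt (unip S h * γ) = rePt γ + toR S := by
  have h0 : toC (toR (0 : Matrix (Fin n) (Fin n) ℤ)) = 0 := by ext; simp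
  have h1 : toC (toR (1 : Matrix (Fin n) (Fin n) ℤ)) = 1 := by
    ext i j; simp only [map_apply, one_apply]; split_ifs <;> simp
  have e : ∀ Z : UpperHalfSpace n, (act (unip S h).toGSpPos Z).1 = Z.1 + toC (toR S) := by
    intro Z
    have hd : den (unip S h).toGSpPos Z = 1 := by
      rw [den_toGSpPos, unip, toBlocks_fromBlocks₂₁, toBlocks_fromBlocks₂₂, h0, h1, zero_mul,
        zero_add]
    have hn : num (unip S h).toGSpPos Z =
        toC (toR (unip S h).1.toBlocks₁₁) * Z.1 + toC (toR (unip S h).1.toBlocks₁₂) := rfl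
    have := act_mul_den (unip S h).toGSpPos Z
    rw [hd, mul_one, hn, unip, toBlocks_fromBlocks₁₁, toBlocks_fromBlocks₁₂, h1, one_mul] at this
    exact this
  rw [rePt, toGSpPos_mul, act_gmul, e, rePt]
  ext i j
  simp

lemma rePt_isSymm (γ : SpZ n) : (rePt γ).IsSymm := (act γ.toGSpPos (iPt n)).2.1.map _

/-- A Levi element Hermite-reduces the Gram matrix; a unipotent element then translates the real
part of `γ⟨i⟩` into the unit cube without changing the Gram matrix. -/
lemma exists_reduced_representative (n : ℕ) : ∃ κ : ℕ, ∀ γ : SpZ n, ∃ η ∈ parabolic n,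
    ∏ i, gram (η * γ) i i ≤ κ * (gram (η * γ)).det ∧
    ∀ i j, 0 ≤ rePt (η * γ) i j ∧ rePt (η * γ) i j < 1 := by
  obtain ⟨κ, hκ⟩ := exists_hermite_reduced n
  refine ⟨κ, fun γ => ?_⟩
  obtain ⟨U, hU, hred⟩ := hκ (gram γ) (gram_isSymm γ) (quad_gram_pos γ)
  have hUV := mul_nonsing_inv U hU
  set γ₁ := levi U U⁻¹ hUV * γ with hγ₁
  have hS : (-((rePt γ₁).map Int.floor)).IsSymm := ((rePt_isSymm γ₁).map _).neg
  refine ⟨unip _ hS * levi U U⁻¹ hUV, mul_mem (unip_mem _ _) (levi_mem _ _ _), ?_, ?_⟩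
  · rw [mul_assoc, gram_unip_mul, gram_levi_mul]
    have h2 : U.det * U.det = 1 := by
      rcases Int.isUnit_iff.1 hU with h | h <;> simp [h]
    have : (U * gram γ * Uᵀ).det = (gram γ).det := by
      rw [det_mul, det_mul, det_transpose]
      linear_combination (gram γ).det * h2
    rwa [this]
  · intro i j
    rw [mul_assoc, ← hγ₁, rePt_unip_mul]
    simp only [Matrix.add_apply, map_apply, Matrix.neg_apply, map_neg, eq_intCast]
    have h1 := Int.floor_le (rePt γ₁ i j)
    have h2 := Int.lt_floor_add_one (rePt γ₁ i j)
    constructor <;> linarith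

/-- The Iwasawa-type relations between the blocks of `γ` and the point `γ⟨i⟩`. -/
lemma iwasawa_relations (γ : SpZ n) : ∃ V : Matrix (Fin n) (Fin n) ℝ, V * toR (gram γ) = 1 ∧
    Vᵀ = V ∧
    toR γ.1.toBlocks₁₁ = rePt γ * toR γ.1.toBlocks₂₁ + V * toR γ.1.toBlocks₂₂ ∧
    toR γ.1.toBlocks₁₂ = rePt γ * toR γ.1.toBlocks₂₂ - V * toR γ.1.toBlocks₂₁ := by
  set A := toR γ.1.toBlocks₁₁ with hA
  set B := toR γ.1.toBlocks₁₂ with hB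
  set C := toR γ.1.toBlocks₂₁ with hC
  set D := toR γ.1.toBlocks₂₂ with hD
  set X := rePt γ with hX
  set V := im (act γ.toGSpPos (iPt n)) with hV
  have hZ : (act γ.toGSpPos (iPt n)).1 = toC X + Complex.I • toC V := by
    ext i j
    simp [hX, hV, rePt, mul_comm Complex.I, Complex.re_add_im]
  have hi : (iPt n).1 = Complex.I • 1 := by simp [iPt, scalarPt]
  have h1 := act_mul_den γ.toGSpPos (iPt n)
  have hd : den γ.toGSpPos (iPt n) = toC C * (iPt n).1 + toC D := rfl
  have hn : num γ.toGSpPos (iPt n) = toC A * (iPt n).1 + toC B := rfl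
  rw [hd, hn, hZ, hi] at h1
  -- The identity `γ⟨i⟩ (C i + D) = A i + B`, separated into real and imaginary parts with `γ⟨i⟩ = X
  -- + i V`.
  have h2 : toC (X * D - V * C) + Complex.I • toC (X * C + V * D) =
      toC B + Complex.I • toC A := by
    have e : toC (X * D - V * C) = toC X * toC D - toC V * toC C := by
      rw [← toC_mul, ← toC_mul]; exact Matrix.map_sub _ (map_sub _) _ _
    rw [e, toC_add, toC_mul, toC_mul]
    calc _ = (toC X + Complex.I • toC V) * (toC C * Complex.I • 1 + toC D) := by
          simp only [add_mul, mul_add, mul_smul_comm, smul_mul_assoc, mul_one, smul_smul, smul_add,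
            Complex.I_mul_I, neg_smul, one_smul]
          abel
      _ = _ := by
          rw [h1, mul_smul_comm, mul_one, add_comm]
  have hre : ∀ P Q : Matrix (Fin n) (Fin n) ℝ,
      (toC P + Complex.I • toC Q).map Complex.re = P ∧
      (toC P + Complex.I • toC Q).map Complex.im = Q := fun P Q => by
    constructor <;> (ext i j; simp)
  have eA : A = X * C + V * D := by
    rw [← (hre B A).2, ← h2, (hre _ _).2]
  have eB : B = X * D - V * C := by
    rw [← (hre B A).1, ← h2, (hre _ _).1]
  have r2 : C * Dᵀ = D * Cᵀ := by
    have := congrArg toR (symplectic_relations' γ).2.1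
    rwa [toR_mul, toR_mul] at this
  have r3 : A * Dᵀ - B * Cᵀ = 1 := by
    have := congrArg toR (symplectic_relations' γ).2.2
    rwa [toR_sub, toR_mul, toR_mul, toR_one] at this
  refine ⟨V, ?_, ((act γ.toGSpPos (iPt n)).2.1.map _), eA, eB⟩
  have eG : toR (gram γ) = C * Cᵀ + D * Dᵀ := by
    rw [gram, toR_add, toR_mul, toR_mul]; rfl
  rw [eG]
  rw [eA, eB] at r3
  calc V * (C * Cᵀ + D * Dᵀ) = (X * C + V * D) * Dᵀ - (X * D - V * C) * Cᵀ := by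
        simp only [add_mul, mul_add, sub_mul, Matrix.mul_assoc, r2]
        abel
    _ = 1 := r3

/-- `(i C + D)(i C + D)* = C ᵗC + D ᵗD`, because the cross terms cancel by the symmetry of `C ᵗD`.
-/
lemma norm_sq_autFactor_iPt (γ : SpZ n) :
    ‖autFactor γ.toGSpPos (iPt n)‖ ^ 2 = ((gram γ).det : ℝ) := by
  set C := toC (toR γ.1.toBlocks₂₁) with hC
  set D := toC (toR γ.1.toBlocks₂₂) with hD
  have hi : (iPt n).1 = Complex.I • 1 := by simp [iPt, scalarPt]
  have hd : den γ.toGSpPos (iPt n) = Complex.I • C + D := by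
    rw [den_toGSpPos, hi, mul_smul_comm, mul_one]
  have hCD : C * Dᴴ = D * Cᴴ := by
    rw [hC, hD, toC_conjTranspose, toC_conjTranspose]
    have h : toC (toR (γ.1.toBlocks₂₁ * γ.1.toBlocks₂₂ᵀ)) =
        toC (toR (γ.1.toBlocks₂₂ * γ.1.toBlocks₂₁ᵀ)) := by rw [(symplectic_relations' γ).2.1]
    rw [toR_mul, toR_mul, toC_mul, toC_mul] at h
    exact h
  have hG : toC (toR (gram γ)) = C * Cᴴ + D * Dᴴ := by
    rw [gram, toR_add, toR_mul, toR_mul, toC_add, toC_mul, toC_mul, toC_conjTranspose,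
      toC_conjTranspose]
    rfl
  have h1 : (Complex.I • C + D) * (Complex.I • C + D)ᴴ = toC (toR (gram γ)) := by
    rw [hG, conjTranspose_add, conjTranspose_smul, Complex.star_def, Complex.conj_I]
    simp only [add_mul, mul_add, mul_smul_comm, smul_mul_assoc, hCD, neg_smul, Matrix.mul_neg,
      smul_neg]
    rw [smul_smul, Complex.I_mul_I, neg_one_smul]
    abel
  have h2 := congrArg det h1
  rw [det_mul, det_conjTranspose, Complex.star_def, Complex.mul_conj, Complex.normSq_eq_norm_sq,
    ← hd, ← autFactor_toGSpPos] at h2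
  have h3 : (toC (toR (gram γ))).det = (((gram γ).det : ℝ) : ℂ) := by
    have h4 : (toC (toR (gram γ))).det = (((toR (gram γ)).det : ℝ) : ℂ) :=
      (RingHom.map_det Complex.ofRealHom _).symm
    have h5 : (toR (gram γ)).det = ((gram γ).det : ℝ) :=
      (RingHom.map_det (Int.castRingHom ℝ) _).symm
    rw [h4, h5]
  rw [h3] at h2
  exact_mod_cast h2

end Summability

/-! ### Reduced representatives of equal size differ by bounded matrices -/

section Counting

variable {n : ℕ}

/-- The dyadic size of the rows. -/
def rowExp (γ : SpZ n) (i : Fin n) : ℕ := Nat.log 4 (gram γ i i).toNat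

lemma gram_apply_self (γ : SpZ n) (i : Fin n) : gram γ i i =
    ∑ j, γ.1.toBlocks₂₁ i j ^ 2 + ∑ j, γ.1.toBlocks₂₂ i j ^ 2 := by
  simp only [gram, Matrix.add_apply, mul_apply, transpose_apply, pow_two]

lemma gram_diag_pos (γ : SpZ n) (i : Fin n) : 0 < gram γ i i := by
  have := quad_gram_pos γ (Pi.single i 1) (by simp)
  simpa [quad] using this

/-- The logarithm to base `4` of the squared length makes `2 ^ rowExp` the length of the row up to a
factor `2`. -/
lemma rowExp_bounds (γ : SpZ n) (i : Fin n) :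
    ((2 : ℝ) ^ rowExp γ i) ^ 2 ≤ gram γ i i ∧ (gram γ i i : ℝ) ≤ (2 * 2 ^ rowExp γ i) ^ 2 := by
  have h0 := gram_diag_pos γ i
  have h1 : ((gram γ i i).toNat : ℤ) = gram γ i i := Int.toNat_of_nonneg h0.le
  have h2 := Nat.pow_log_le_self 4 (x := (gram γ i i).toNat) (by omega)
  have h3 := Nat.lt_pow_succ_log_self (b := 4) (by norm_num) (gram γ i i).toNat
  have h1' : ((gram γ i i).toNat : ℝ) = gram γ i i := by exact_mod_cast h1
  rw [← h1']
  have e : ∀ a : ℕ, ((2 : ℝ) ^ a) ^ 2 = 4 ^ a := fun a => by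
    rw [← pow_mul, mul_comm, pow_mul]; norm_num
  constructor
  · rw [e]; exact_mod_cast h2
  · rw [mul_pow, e, show (2 : ℝ) ^ 2 = 4 by norm_num, ← pow_succ']
    exact_mod_cast h3.le

lemma abs_toBlocks_le (γ : SpZ n) (i j : Fin n) :
    |toR γ.1.toBlocks₂₁ i j| ≤ 2 * 2 ^ rowExp γ i ∧
    |toR γ.1.toBlocks₂₂ i j| ≤ 2 * 2 ^ rowExp γ i := by
  have h := (rowExp_bounds γ i).2
  rw [gram_apply_self] at h
  push_cast at h
  have h1 := Finset.single_le_sum (f := fun j => (γ.1.toBlocks₂₁ i j : ℝ) ^ 2)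
    (fun j _ => sq_nonneg _) (Finset.mem_univ j)
  have h2 := Finset.single_le_sum (f := fun j => (γ.1.toBlocks₂₂ i j : ℝ) ^ 2)
    (fun j _ => sq_nonneg _) (Finset.mem_univ j)
  have h3 : 0 ≤ ∑ j, (γ.1.toBlocks₂₁ i j : ℝ) ^ 2 := Finset.sum_nonneg fun _ _ => sq_nonneg _
  have h4 : 0 ≤ ∑ j, (γ.1.toBlocks₂₂ i j : ℝ) ^ 2 := Finset.sum_nonneg fun _ _ => sq_nonneg _
  constructor <;> refine abs_le_of_sq_le_sq ?_ (by positivity) <;>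
    simp only [map_apply, eq_intCast] <;> linarith

/-- The row sizes `N_i` of the outer factors cancel against the decay of `M`, so the bound is
independent of `N`. -/
lemma abs_triple_product_le {P P' M : Matrix (Fin n) (Fin n) ℝ} {N : Fin n → ℝ} {K : ℝ}
    (hN : ∀ i, 0 ≤ N i)
    (hP : ∀ i j, |P i j| ≤ 2 * N i) (hP' : ∀ i j, |P' i j| ≤ 2 * N i)
    (hM : ∀ i j, |M i j| * (N i * N j) ≤ K) (i j : Fin n) :
    |(Pᵀ * M * P') i j| ≤ n * (n * (4 * K)) := by
  rw [mul_apply]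
  refine (Finset.abs_sum_le_sum_abs _ _).trans ?_
  refine (Finset.sum_le_card_nsmul _ _ (n * (4 * K)) fun l _ => ?_).trans_eq (by simp)
  rw [mul_apply, Finset.sum_mul]
  refine (Finset.abs_sum_le_sum_abs _ _).trans ?_
  refine (Finset.sum_le_card_nsmul _ _ (4 * K) fun m _ => ?_).trans_eq (by simp)
  rw [transpose_apply, abs_mul, abs_mul]
  calc |P m i| * |M m l| * |P' l j| ≤ (2 * N m) * |M m l| * (2 * N l) :=
        mul_le_mul (mul_le_mul_of_nonneg_right (hP m i) (abs_nonneg _)) (hP' l j) (abs_nonneg _)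
          (mul_nonneg (mul_nonneg zero_le_two (hN m)) (abs_nonneg _))
    _ = 4 * (|M m l| * (N m * N l)) := by ring
    _ ≤ 4 * K := by linarith [hM m l]

lemma abs_det_le {m : Type*} [Fintype m] [DecidableEq m] (M : Matrix m m ℝ) {K : ℝ}
    (h : ∀ i j, |M i j| ≤ K) :
    |M.det| ≤ (Nat.factorial (Fintype.card m) : ℝ) * K ^ Fintype.card m := by
  have := det_le (A := M) (abv := AbsoluteValue.abs) (x := K) h
  rwa [nsmul_eq_mul] at this

/-- The inverse Gram matrix of a reduced representative is bounded in terms of the row sizes. -/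
lemma abs_inv_gram_le {κ : ℕ} {γ : SpZ n} (hred : ∏ i, gram γ i i ≤ κ * (gram γ).det)
    {V : Matrix (Fin n) (Fin n) ℝ} (hV : V * toR (gram γ) = 1) (i j : Fin n) :
    |V i j| * (2 ^ rowExp γ i * 2 ^ rowExp γ j) ≤
      κ * (Nat.factorial n * (8 * n + 1 : ℝ) ^ n) := by
  set N : Fin n → ℝ := fun i => 2 ^ rowExp γ i with hN
  have hN0 : ∀ i, 0 < N i := fun i => by positivity
  -- The Gram matrix is rescaled by the row sizes: `G` has bounded entries, reducedness keeps its
  -- determinant away from `0`, and Cramer's rule bounds its inverse `H`.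
  set G : Matrix (Fin n) (Fin n) ℝ := of fun i j => (N i)⁻¹ * (gram γ i j : ℝ) * (N j)⁻¹ with hG
  set H : Matrix (Fin n) (Fin n) ℝ := of fun i j => N i * V i j * N j with hH
  have hHG : H * G = 1 := by
    ext a b
    have h1 := congrFun (congrFun hV a) b
    rw [mul_apply] at h1 ⊢
    simp only [map_apply, eq_intCast] at h1
    have : ∀ l, H a l * G l b = N a * (V a l * (gram γ l b : ℝ)) * (N b)⁻¹ := fun l => by
      simp only [hH, hG, of_apply]
      field_simp [(hN0 l).ne']
    simp only [this]
    rw [← Finset.sum_mul, ← Finset.mul_sum, h1, one_apply]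
    split_ifs with hab
    · subst hab; field_simp [(hN0 a).ne']
    · simp
  have hGdiag : G = diagonal (fun i => (N i)⁻¹) * toR (gram γ) * diagonal fun i => (N i)⁻¹ := by
    ext a b
    rw [mul_diagonal, diagonal_mul]
    simp [hG]
  have hprod : 0 < ∏ i, N i := Finset.prod_pos fun i _ => hN0 i
  have hdet : G.det * ((∏ i, N i) * ∏ i, N i) = (gram γ).det := by
    have h5 : (toR (gram γ)).det = ((gram γ).det : ℝ) :=
      (RingHom.map_det (Int.castRingHom ℝ) _).symm
    rw [hGdiag, det_mul, det_mul, det_diagonal, h5, Finset.prod_inv_distrib]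
    field_simp
  have hdet1 : 1 ≤ κ * G.det := by
    have h1 : (∏ i, N i) * ∏ i, N i ≤ ∏ i, (gram γ i i : ℝ) := by
      rw [← Finset.prod_mul_distrib]
      refine Finset.prod_le_prod (fun i _ => (mul_pos (hN0 i) (hN0 i)).le) fun i _ => ?_
      rw [← pow_two]
      exact (rowExp_bounds γ i).1
    have h2 : ∏ i, (gram γ i i : ℝ) ≤ κ * ((gram γ).det : ℝ) := by exact_mod_cast hred
    rw [← hdet] at h2
    have h3 := h1.trans h2
    have h4 : 0 < (∏ i, N i) * ∏ i, N i := mul_pos hprod hprod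
    by_contra! hlt
    nlinarith
  -- Each of the `n` terms has two products of entries bounded by `2 N_a` and `2 N_b`, hence `8`.
  -- The extra `1` makes the bound also valid for the unit row in the adjugate.
  have hGb : ∀ a b, |G a b| ≤ 8 * n + 1 := by
    intro a b
    have h1 : |(gram γ a b : ℝ)| ≤ n * (8 * (N a * N b)) := by
      have e : (gram γ a b : ℝ) = ∑ l, (toR γ.1.toBlocks₂₁ a l * toR γ.1.toBlocks₂₁ b l +
          toR γ.1.toBlocks₂₂ a l * toR γ.1.toBlocks₂₂ b l) := by
        rw [Finset.sum_add_distrib]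
        simp [gram, mul_apply]
      rw [e]
      refine (Finset.abs_sum_le_sum_abs _ _).trans ?_
      refine (Finset.sum_le_card_nsmul _ _ (8 * (N a * N b)) fun l _ => ?_).trans_eq (by simp)
      refine (abs_add_le _ _).trans ?_
      rw [abs_mul, abs_mul]
      have q1 := mul_le_mul (abs_toBlocks_le γ a l).1 (abs_toBlocks_le γ b l).1 (abs_nonneg _)
        (by positivity)
      have q2 := mul_le_mul (abs_toBlocks_le γ a l).2 (abs_toBlocks_le γ b l).2 (abs_nonneg _)
        (by positivity)
      simp only [hN]
      linarith
    have h2 : G a b = (gram γ a b : ℝ) / (N a * N b) := by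
      simp only [hG, of_apply]
      field_simp
    rw [h2, abs_div, abs_of_pos (mul_pos (hN0 a) (hN0 b)), div_le_iff₀ (mul_pos (hN0 a) (hN0 b))]
    have := mul_pos (hN0 a) (hN0 b)
    linarith
  have hadj : H i j * G.det = G.adjugate i j := by
    have h1 : G.adjugate = G.det • H := by
      calc G.adjugate = H * G * G.adjugate := by rw [hHG, one_mul]
        _ = _ := by rw [Matrix.mul_assoc, mul_adjugate, mul_smul_comm, mul_one]
    rw [h1, Matrix.smul_apply, smul_eq_mul, mul_comm]
  have hadjb : |G.adjugate i j| ≤ Nat.factorial n * (8 * n + 1 : ℝ) ^ n := by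
    rw [adjugate_apply]
    have := abs_det_le (G.updateRow j (Pi.single i 1)) (K := 8 * n + 1) fun a b => by
      rw [updateRow_apply]
      split_ifs
      · rw [Pi.single_apply]
        split_ifs <;> simp <;> positivity
      · exact hGb a b
    simpa using this
  have hfin : |V i j| * (N i * N j) = |H i j| := by
    simp only [hH, of_apply]
    rw [abs_mul, abs_mul, abs_of_pos (hN0 i), abs_of_pos (hN0 j)]
    ring
  change |V i j| * (N i * N j) ≤ _
  rw [hfin]
  have hd0 : 0 < G.det := by
    by_contra! h
    have : (κ : ℝ) * G.det ≤ 0 := mul_nonpos_of_nonneg_of_nonpos (Nat.cast_nonneg _) h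
    linarith
  have h6 : |H i j| * G.det ≤ Nat.factorial n * (8 * n + 1 : ℝ) ^ n := by
    rw [← abs_of_pos hd0, ← abs_mul, hadj]
    exact hadjb
  calc |H i j| ≤ |H i j| * (κ * G.det) := le_mul_of_one_le_right (abs_nonneg _) hdet1
    _ = κ * (|H i j| * G.det) := by ring
    _ ≤ _ := mul_le_mul_of_nonneg_left h6 (Nat.cast_nonneg _)

/-- Substituting the Iwasawa relations, every block of `γ⁻¹ γ'` becomes a sum of three triple
products with middle factors `± (X' - X)`, `± V'` and `V`, all controlled by the common row sizes.
-/
lemma abs_inv_mul_le {κ : ℕ} {γ γ' : SpZ n} (hred : ∏ i, gram γ i i ≤ κ * (gram γ).det)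
    (hred' : ∏ i, gram γ' i i ≤ κ * (gram γ').det) (hexp : rowExp γ = rowExp γ')
    (hX : ∀ i j, |(rePt γ' - rePt γ) i j| * (2 ^ rowExp γ i * 2 ^ rowExp γ j) ≤ 1)
    (i j : Fin n ⊕ Fin n) :
    |((γ⁻¹ * γ').1 i j : ℝ)| ≤
      3 * (n * (n * (4 * (1 + κ * (Nat.factorial n * (8 * n + 1 : ℝ) ^ n))))) := by
  obtain ⟨V, hV, hVs, hA, hB⟩ := iwasawa_relations γ
  obtain ⟨V', hV', -, hA', hB'⟩ := iwasawa_relations γ'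
  set K : ℝ := 1 + κ * (Nat.factorial n * (8 * n + 1 : ℝ) ^ n) with hK
  have hK0 : 0 ≤ (κ : ℝ) * (Nat.factorial n * (8 * n + 1 : ℝ) ^ n) := by positivity
  have bV : ∀ i j, |V i j| * (2 ^ rowExp γ i * 2 ^ rowExp γ j) ≤ K := fun i j => by
    have := abs_inv_gram_le hred hV i j
    linarith
  have bV' : ∀ i j, |V' i j| * (2 ^ rowExp γ i * 2 ^ rowExp γ j) ≤ K := fun i j => by
    have := abs_inv_gram_le hred' hV' i j
    rw [hexp]
    linarith
  have bX : ∀ i j, |(rePt γ' - rePt γ) i j| * (2 ^ rowExp γ i * 2 ^ rowExp γ j) ≤ K :=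
    fun i j => by linarith [hX i j]
  have bC := fun i j => (abs_toBlocks_le γ i j).1
  have bD := fun i j => (abs_toBlocks_le γ i j).2
  have bC' := fun i j => (abs_toBlocks_le γ' i j).1
  have bD' := fun i j => (abs_toBlocks_le γ' i j).2
  rw [← hexp] at bC' bD'
  have hN : ∀ i, (0 : ℝ) ≤ 2 ^ rowExp γ i := fun i => by positivity
  have hXs : (rePt γ)ᵀ = rePt γ := rePt_isSymm γ
  have three : ∀ M₁ M₂ M₃ : Matrix (Fin n) (Fin n) ℝ, ∀ i j,
      |M₁ i j| ≤ n * (n * (4 * K)) → |M₂ i j| ≤ n * (n * (4 * K)) →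
      |M₃ i j| ≤ n * (n * (4 * K)) → |(M₁ + M₂ + M₃) i j| ≤ 3 * (n * (n * (4 * K))) :=
    fun M₁ M₂ M₃ i j h1 h2 h3 => by
      rw [Matrix.add_apply, Matrix.add_apply]
      linarith [abs_add_le (M₁ i j + M₂ i j) (M₃ i j), abs_add_le (M₁ i j) (M₂ i j)]
  have tr : ∀ A B : Matrix (Fin n) (Fin n) ℤ, toR (-Aᵀ * B) = -((toR A)ᵀ * toR B) :=
    fun A B => by rw [toR_mul, ← Matrix.neg_mul]; congr 1; ext; simp
  have tr' : ∀ A B : Matrix (Fin n) (Fin n) ℤ, toR (Aᵀ * B) = (toR A)ᵀ * toR B :=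
    fun A B => toR_mul _ _
  have key : ∀ (M : Matrix (Fin n ⊕ Fin n) (Fin n ⊕ Fin n) ℤ),
      (∀ i j, |toR M.toBlocks₁₁ i j| ≤ 3 * (n * (n * (4 * K)))) →
      (∀ i j, |toR M.toBlocks₁₂ i j| ≤ 3 * (n * (n * (4 * K)))) →
      (∀ i j, |toR M.toBlocks₂₁ i j| ≤ 3 * (n * (n * (4 * K)))) →
      (∀ i j, |toR M.toBlocks₂₂ i j| ≤ 3 * (n * (n * (4 * K)))) →
      ∀ i j, |(M i j : ℝ)| ≤ 3 * (n * (n * (4 * K))) := by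
    intro M h1 h2 h3 h4 i j
    rcases i with i | i <;> rcases j with j | j
    · exact h1 i j
    · exact h2 i j
    · exact h3 i j
    · exact h4 i j
  have hneg : ∀ M : Matrix (Fin n) (Fin n) ℝ, ∀ i j, |(-M) i j| = |M i j| := fun M i j => by
    rw [Matrix.neg_apply, abs_neg]
  refine key _ ?_ ?_ ?_ ?_ i j <;> intro i j <;>
    rw [Submonoid.coe_mul, coe_inv_eq_fromBlocks]
  · rw [toBlocks₁₁_mul', toBlocks_fromBlocks₁₁, toBlocks_fromBlocks₁₂, toR_add, tr', tr, hA', hB]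
    have e : (toR γ.1.toBlocks₂₂)ᵀ * (rePt γ' * toR γ'.1.toBlocks₂₁ + V' * toR γ'.1.toBlocks₂₂) +
        -((rePt γ * toR γ.1.toBlocks₂₂ - V * toR γ.1.toBlocks₂₁)ᵀ * toR γ'.1.toBlocks₂₁) =
        (toR γ.1.toBlocks₂₂)ᵀ * (rePt γ' - rePt γ) * toR γ'.1.toBlocks₂₁ +
        (toR γ.1.toBlocks₂₂)ᵀ * V' * toR γ'.1.toBlocks₂₂ +
        (toR γ.1.toBlocks₂₁)ᵀ * V * toR γ'.1.toBlocks₂₁ := by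
      rw [transpose_sub, transpose_mul, transpose_mul, hXs, hVs]
      noncomm_ring
    rw [e]
    exact three _ _ _ i j (abs_triple_product_le hN bD bC' bX i j)
      (abs_triple_product_le hN bD bD' bV' i j) (abs_triple_product_le hN bC bC' bV i j)
  · rw [toBlocks₁₂_mul', toBlocks_fromBlocks₁₁, toBlocks_fromBlocks₁₂, toR_add, tr', tr, hB', hB]
    have e : (toR γ.1.toBlocks₂₂)ᵀ * (rePt γ' * toR γ'.1.toBlocks₂₂ - V' * toR γ'.1.toBlocks₂₁) +
        -((rePt γ * toR γ.1.toBlocks₂₂ - V * toR γ.1.toBlocks₂₁)ᵀ * toR γ'.1.toBlocks₂₂) =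
        (toR γ.1.toBlocks₂₂)ᵀ * (rePt γ' - rePt γ) * toR γ'.1.toBlocks₂₂ +
        -((toR γ.1.toBlocks₂₂)ᵀ * V' * toR γ'.1.toBlocks₂₁) +
        (toR γ.1.toBlocks₂₁)ᵀ * V * toR γ'.1.toBlocks₂₂ := by
      rw [transpose_sub, transpose_mul, transpose_mul, hXs, hVs]
      noncomm_ring
    rw [e]
    refine three _ _ _ i j (abs_triple_product_le hN bD bD' bX i j) ?_
      (abs_triple_product_le hN bC bD' bV i j)
    rw [hneg]
    exact abs_triple_product_le hN bD bC' bV' i j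
  · rw [toBlocks₂₁_mul', toBlocks_fromBlocks₂₁, toBlocks_fromBlocks₂₂, toR_add, tr', tr, hA', hA]
    have e : -((toR γ.1.toBlocks₂₁)ᵀ * (rePt γ' * toR γ'.1.toBlocks₂₁ +
          V' * toR γ'.1.toBlocks₂₂)) +
        (rePt γ * toR γ.1.toBlocks₂₁ + V * toR γ.1.toBlocks₂₂)ᵀ * toR γ'.1.toBlocks₂₁ =
        -((toR γ.1.toBlocks₂₁)ᵀ * (rePt γ' - rePt γ) * toR γ'.1.toBlocks₂₁) +
        -((toR γ.1.toBlocks₂₁)ᵀ * V' * toR γ'.1.toBlocks₂₂) +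
        (toR γ.1.toBlocks₂₂)ᵀ * V * toR γ'.1.toBlocks₂₁ := by
      rw [transpose_add, transpose_mul, transpose_mul, hXs, hVs]
      noncomm_ring
    rw [e]
    refine three _ _ _ i j ?_ ?_ (abs_triple_product_le hN bD bC' bV i j)
    · rw [hneg]; exact abs_triple_product_le hN bC bC' bX i j
    · rw [hneg]; exact abs_triple_product_le hN bC bD' bV' i j
  · rw [toBlocks₂₂_mul', toBlocks_fromBlocks₂₁, toBlocks_fromBlocks₂₂, toR_add, tr', tr, hB', hA]
    have e : -((toR γ.1.toBlocks₂₁)ᵀ * (rePt γ' * toR γ'.1.toBlocks₂₂ -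
          V' * toR γ'.1.toBlocks₂₁)) +
        (rePt γ * toR γ.1.toBlocks₂₁ + V * toR γ.1.toBlocks₂₂)ᵀ * toR γ'.1.toBlocks₂₂ =
        -((toR γ.1.toBlocks₂₁)ᵀ * (rePt γ' - rePt γ) * toR γ'.1.toBlocks₂₂) +
        (toR γ.1.toBlocks₂₁)ᵀ * V' * toR γ'.1.toBlocks₂₁ +
        (toR γ.1.toBlocks₂₂)ᵀ * V * toR γ'.1.toBlocks₂₂ := by
      rw [transpose_add, transpose_mul, transpose_mul, hXs, hVs]
      noncomm_ring
    rw [e]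
    refine three _ _ _ i j ?_ (abs_triple_product_le hN bC bC' bV' i j)
      (abs_triple_product_le hN bD bD' bV i j)
    rw [hneg]; exact abs_triple_product_le hN bC bD' bX i j

end Counting

/-! ### Absolute convergence -/

section Convergence

variable {n : ℕ}

lemma finite_bounded_matrices (m : Type*) [Finite m] (R : ℝ) :
    Finite {M : Matrix m m ℤ // ∀ i j, |(M i j : ℝ)| ≤ R} := by
  let f : {M : Matrix m m ℤ // ∀ i j, |(M i j : ℝ)| ≤ R} → m → m → Set.Icc (-⌈R⌉) ⌈R⌉ :=
    fun M i j => ⟨M.1 i j, by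
      have h := M.2 i j
      have h1 : |(M.1 i j : ℝ)| ≤ (⌈R⌉ : ℝ) := h.trans (Int.le_ceil R)
      have h2 : |M.1 i j| ≤ ⌈R⌉ := by exact_mod_cast h1
      exact abs_le.1 h2⟩
  refine Finite.of_injective f fun M M' h => Subtype.ext (Matrix.ext fun i j => ?_)
  exact congrArg Subtype.val (congrFun (congrFun h i) j)

/-- The number of boxes in each coordinate. -/
def boxBound (a : Fin n → ℕ) (i j : Fin n) : ℕ := if i ≤ j then 2 ^ a i * 2 ^ a j else 1

/-- The index of the box of `Re γ⟨i⟩`. -/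
def boxIdx (γ : SpZ n) (i j : Fin n) : ℕ :=
  if i ≤ j then ⌊rePt γ i j * (2 ^ rowExp γ i * 2 ^ rowExp γ j)⌋₊ else 0

lemma boxIdx_lt {γ : SpZ n} (h : ∀ i j, 0 ≤ rePt γ i j ∧ rePt γ i j < 1) (i j : Fin n) :
    boxIdx γ i j < boxBound (rowExp γ) i j := by
  rw [boxIdx, boxBound]
  split_ifs
  · have h0 : (0 : ℝ) < 2 ^ rowExp γ i * 2 ^ rowExp γ j := by positivity
    rw [Nat.floor_lt (mul_nonneg (h i j).1 h0.le)]
    push_cast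
    exact mul_lt_of_lt_one_left h0 (h i j).2
  · exact one_pos

lemma abs_rePt_sub_le {γ γ' : SpZ n} (h : ∀ i j, 0 ≤ rePt γ i j) (h' : ∀ i j, 0 ≤ rePt γ' i j)
    (he : rowExp γ = rowExp γ') (hb : boxIdx γ = boxIdx γ') (i j : Fin n) :
    |(rePt γ' - rePt γ) i j| * (2 ^ rowExp γ i * 2 ^ rowExp γ j) ≤ 1 := by
  have main : ∀ i j : Fin n, i ≤ j →
      |(rePt γ' - rePt γ) i j| * (2 ^ rowExp γ i * 2 ^ rowExp γ j) ≤ 1 := by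
    intro i j hij
    have h0 : (0 : ℝ) < 2 ^ rowExp γ i * 2 ^ rowExp γ j := by positivity
    have h1 := congrFun (congrFun hb i) j
    rw [boxIdx, boxIdx, if_pos hij, if_pos hij, ← he] at h1
    have f1 := Nat.floor_le (mul_nonneg (h i j) h0.le)
    have f2 := Nat.lt_floor_add_one (rePt γ i j * (2 ^ rowExp γ i * 2 ^ rowExp γ j))
    have f3 := Nat.floor_le (mul_nonneg (h' i j) h0.le)
    have f4 := Nat.lt_floor_add_one (rePt γ' i j * (2 ^ rowExp γ i * 2 ^ rowExp γ j))
    rw [h1] at f1 f2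
    rw [← abs_of_pos h0, ← abs_mul, Matrix.sub_apply, sub_mul]
    exact abs_le.2 ⟨by linarith, by linarith⟩
  rcases le_total i j with hij | hij
  · exact main i j hij
  · have := main j i hij
    rw [Matrix.sub_apply, (rePt_isSymm γ).apply, (rePt_isSymm γ').apply] at this
    rw [Matrix.sub_apply, mul_comm (2 ^ rowExp γ i : ℝ)]
    exact this

lemma norm_autFactor_rep (γ η : SpZ n) (hη : η ∈ parabolic n) (Z : UpperHalfSpace n) :
    ‖autFactor (η * γ).toGSpPos Z‖ = ‖autFactor γ.toGSpPos Z‖ := by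
  -- For `k = 0` and `s = -1/2` the modulus of `hFac` is `|j|`, so the parabolic formula with the
  -- trivial character modulo `1` gives `|j(η, ·)| = 1`.
  have h1 := norm_hFac 0 (-1 / 2) η.toGSpPos (act γ.toGSpPos Z)
  have h2 : ((1 : DirichletCharacter ℂ 1) (-1)) = (-1) ^ (0 : ℤ) := by
    rw [zpow_zero, MulChar.one_apply isUnit_one.neg]
  rw [hFac_parabolic h2 _ hη, charDet_eq, MulChar.one_apply] at h1
  · rw [toGSpPos_mul, autFactor_gmul, norm_mul]
    have h3 : -2 * ((-1 / 2 : ℂ)).re = 1 := by norm_num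
    rw [h3, Real.rpow_one, norm_one] at h1
    rw [← h1, one_mul]
  · rw [det_red]
    exact (parabolic_det hη).map (Int.castRingHom (ZMod 1))

/-- Absolute convergence of the Siegel Eisenstein series at `Z = i`. -/
lemma summable_autFactor_iPt {σ : ℝ} (hσ : (n : ℝ) + 1 < 2 * σ) :
    Summable fun q : ParQuot n => ‖autFactor q.out.toGSpPos (iPt n)‖ ^ (-2 * σ) := by
  obtain ⟨κ, hκ⟩ := exists_reduced_representative n
  choose η hη hred hX using hκ
  set R : ℝ := 3 * (n * (n * (4 * (1 + κ * (Nat.factorial n * (8 * n + 1 : ℝ) ^ n))))) with hR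
  let F := {M : Matrix (Fin n ⊕ Fin n) (Fin n ⊕ Fin n) ℤ // ∀ i j, |(M i j : ℝ)| ≤ R}
  have : Finite F := finite_bounded_matrices _ R
  have := Fintype.ofFinite F
  let g : ParQuot n → SpZ n := fun q => η q.out * q.out
  have hg : ∀ q, (Quotient.mk _ (g q) : ParQuot n) = q := fun q => by
    conv_rhs => rw [← q.out_eq]
    refine Quotient.sound ?_
    change QuotientGroup.rightRel (parabolic n) _ _
    rw [QuotientGroup.rightRel_apply]
    have : q.out * (η q.out * q.out)⁻¹ = (η q.out)⁻¹ := by group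
    rw [this]
    exact inv_mem (hη _)
  let code : ParQuot n → (Fin n → ℕ) × (Fin n → Fin n → ℕ) := fun q => (rowExp (g q), boxIdx (g q))
  classical
  -- One representative is fixed for each pair of row sizes and box. Any other one with the same
  -- pair differs from it by a matrix in the finite set `F`, which makes the coding map `f`
  -- injective.
  let base : (Fin n → ℕ) × (Fin n → Fin n → ℕ) → SpZ n := fun c =>
    if h : ∃ q, code q = c then g h.choose else 1
  have hbase : ∀ q, ∃ q', code q' = code q ∧ base (code q) = g q' := fun q => by
    have h : ∃ q', code q' = code q := ⟨q, rfl⟩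
    exact ⟨h.choose, h.choose_spec, dif_pos h⟩
  let T := Σ a : Fin n → ℕ, (∀ i j, Fin (boxBound a i j)) × F
  let f : ParQuot n → T := fun q => ⟨rowExp (g q), fun i j => ⟨boxIdx (g q) i j,
    boxIdx_lt (hX q.out) i j⟩, ⟨((base (code q))⁻¹ * g q).1, by
      obtain ⟨q', h1, h2⟩ := hbase q
      have h3 : rowExp (g q') = rowExp (g q) := congrArg Prod.fst h1
      have h4 : boxIdx (g q') = boxIdx (g q) := congrArg Prod.snd h1
      rw [h2]
      exact abs_inv_mul_le (hred _) (hred _) h3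
        (abs_rePt_sub_le (fun i j => (hX _ i j).1) (fun i j => (hX _ i j).1) h3 h4)⟩⟩
  have hf : Function.Injective f := by
    intro q q' h
    let π : T → (Fin n → ℕ) × (Fin n → Fin n → ℕ) × Matrix (Fin n ⊕ Fin n) (Fin n ⊕ Fin n) ℤ :=
      fun t => (t.1, fun i j => (t.2.1 i j).1, t.2.2.1)
    have h1 := congrArg π h
    have a1 : rowExp (g q) = rowExp (g q') := congrArg (fun x => x.1) h1
    have a2 : boxIdx (g q) = boxIdx (g q') := congrArg (fun x => x.2.1) h1
    have h2 : code q = code q' := Prod.ext a1 a2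
    have h3 : ((base (code q))⁻¹ * g q).1 = ((base (code q'))⁻¹ * g q').1 :=
      congrArg (fun x => x.2.2) h1
    rw [h2] at h3
    have h4 := mul_left_cancel (Subtype.ext h3)
    rw [← hg q, ← hg q', h4]
  -- For row sizes `2 ^ a i` the number of codes is `|F| ∏ 2^(a i (n+1))` and each has weight `∏
  -- 2^(-2σ a i)`: a product of geometric series of ratio `x`.
  set x : ℝ := 2 ^ ((n : ℝ) + 1 - 2 * σ) with hx
  have hx0 : 0 < x := Real.rpow_pos_of_pos two_pos _
  have hx1 : x < 1 := Real.rpow_lt_one_of_one_lt_of_neg one_lt_two (by linarith)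
  let wt : T → ℝ := fun t => ∏ i, ((2 : ℝ) ^ t.1 i) ^ (-2 * σ)
  have hwt0 : ∀ t, 0 ≤ wt t := fun t => Finset.prod_nonneg fun i _ => by positivity
  have hwt : Summable wt := by
    rw [summable_sigma_of_nonneg hwt0]
    refine ⟨fun a => Summable.of_finite, ?_⟩
    refine ((summable_prod_pow n hx0.le hx1).mul_left (Fintype.card F : ℝ)).congr fun a => ?_
    simp only [wt]
    rw [tsum_fintype, Finset.sum_const, nsmul_eq_mul, Finset.card_univ, Fintype.card_prod,
      Fintype.card_pi]
    simp only [Fintype.card_pi, Fintype.card_fin]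
    have e : ((∏ i, ∏ j, boxBound a i j : ℕ) : ℝ) = ∏ i, ((2 : ℝ) ^ a i) ^ (n + 1) := by
      rw [← prod_prod_ite_le]
      push_cast
      refine Finset.prod_congr rfl fun i _ => Finset.prod_congr rfl fun j _ => ?_
      rw [boxBound]
      split_ifs <;> simp
    rw [Nat.cast_mul, e, mul_comm _ (Fintype.card F : ℝ), mul_assoc, ← Finset.prod_mul_distrib]
    congr 1
    refine Finset.prod_congr rfl fun i _ => ?_
    rw [hx, ← Real.rpow_natCast, ← Real.rpow_natCast, ← Real.rpow_natCast, ← Real.rpow_mul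
      zero_le_two, ← Real.rpow_mul zero_le_two, ← Real.rpow_mul zero_le_two,
      ← Real.rpow_add two_pos]
    congr 1
    push_cast
    ring
  have hκ0 : (0 : ℝ) ≤ κ := Nat.cast_nonneg _
  have hcomp := (hwt.comp_injective hf).mul_left ((κ : ℝ) ^ σ)
  refine Summable.of_nonneg_of_le (fun q => Real.rpow_nonneg (norm_nonneg _) _) (fun q => ?_) hcomp
  have hσ0 : 0 < σ := by
    have : (0 : ℝ) ≤ n := Nat.cast_nonneg _
    linarith
  have hpos : 0 < ‖autFactor q.out.toGSpPos (iPt n)‖ :=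
    norm_pos_iff.2 (autFactor_ne_zero _ _)
  set y := ‖autFactor q.out.toGSpPos (iPt n)‖ with hy
  have hy2 : y ^ 2 = ((gram (g q)).det : ℝ) := by
    rw [hy, ← norm_autFactor_rep q.out _ (hη q.out), norm_sq_autFactor_iPt]
  set m : ℝ := ∏ i, (2 : ℝ) ^ rowExp (g q) i with hm
  have hm0 : 0 < m := Finset.prod_pos fun i _ => by positivity
  -- Reducedness: the product of the squared row lengths is at most `κ` times the determinant `|j(γ,
  -- i)|²`.
  have hmy : m ^ 2 ≤ κ * y ^ 2 := by
    have h1 : m ^ 2 ≤ ∏ i, (gram (g q) i i : ℝ) := by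
      rw [hm, ← Finset.prod_pow]
      exact Finset.prod_le_prod (fun i _ => by positivity) fun i _ => (rowExp_bounds (g q) i).1
    have h2 : ∏ i, (gram (g q) i i : ℝ) ≤ κ * ((gram (g q)).det : ℝ) := by
      exact_mod_cast hred q.out
    rw [hy2]
    exact h1.trans h2
  have hwtq : wt (f q) = m ^ (-2 * σ) := by
    simp only [wt, hm]
    exact Real.finsetProd_rpow _ _ (fun i _ => by positivity) _
  change y ^ (-2 * σ) ≤ (κ : ℝ) ^ σ * wt (f q)
  rw [hwtq]
  have h1 : (m ^ 2) ^ σ ≤ (κ * y ^ 2) ^ σ := Real.rpow_le_rpow (by positivity) hmy hσ0.le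
  rw [Real.mul_rpow hκ0 (by positivity), ← Real.rpow_natCast, ← Real.rpow_natCast,
    ← Real.rpow_mul hm0.le, ← Real.rpow_mul hpos.le] at h1
  have e1 : ∀ z : ℝ, 0 < z → z ^ (-2 * σ) = (z ^ ((2 : ℕ) * σ))⁻¹ := fun z hz => by
    rw [← Real.rpow_neg hz.le]; congr 1; push_cast; ring
  rw [e1 y hpos, e1 m hm0, ← div_eq_mul_inv, le_div_iff₀ (Real.rpow_pos_of_pos hm0 _),
    inv_mul_le_iff₀ (Real.rpow_pos_of_pos hpos _)]
  linarith

/-- Absolute convergence of the Siegel Eisenstein series. -/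
lemma summable_autFactor {σ : ℝ} (hσ : (n : ℝ) + 1 < 2 * σ) (Z : UpperHalfSpace n) :
    Summable fun q : ParQuot n => ‖autFactor q.out.toGSpPos Z‖ ^ (-2 * σ) := by
  obtain ⟨K, hK, h⟩ := exists_norm_autFactor_le Z (iPt n)
  have hσ0 : 0 < σ := by
    have : (0 : ℝ) ≤ n := Nat.cast_nonneg _
    linarith
  refine Summable.of_nonneg_of_le (fun q => Real.rpow_nonneg (norm_nonneg _) _) (fun q => ?_)
    ((summable_autFactor_iPt hσ).mul_left (K ^ (2 * σ)))
  have h1 := h q.out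
  have p1 : 0 < ‖autFactor q.out.toGSpPos Z‖ := norm_pos_iff.2 (autFactor_ne_zero _ _)
  have p2 : 0 < ‖autFactor q.out.toGSpPos (iPt n)‖ := norm_pos_iff.2 (autFactor_ne_zero _ _)
  have h2 := Real.rpow_le_rpow_of_nonpos p2 h1 (show -2 * σ ≤ 0 by linarith)
  rw [Real.mul_rpow hK.le p1.le] at h2
  have h3 : K ^ (2 * σ) * K ^ (-2 * σ) = 1 := by
    rw [← Real.rpow_add hK, show 2 * σ + -2 * σ = 0 by ring, Real.rpow_zero]
  calc ‖autFactor q.out.toGSpPos Z‖ ^ (-2 * σ)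
      = K ^ (2 * σ) * (K ^ (-2 * σ) * ‖autFactor q.out.toGSpPos Z‖ ^ (-2 * σ)) := by
        rw [← mul_assoc, h3, one_mul]
    _ ≤ _ := mul_le_mul_of_nonneg_left h2 (Real.rpow_nonneg hK.le _)

end Convergence

/-! ### Left cosets in the Hecke double coset -/

section HeckeCosets

variable {n p : ℕ}

lemma eq_zero_of_mul_left_eq_zero {M X : Matrix (Fin n) (Fin n) ℤ} (hM : M.det ≠ 0)
    (h : M * X = 0) : X = 0 := by
  have h1 : M.adjugate * (M * X) = M.det • X := by
    rw [← Matrix.mul_assoc, adjugate_mul, smul_mul_assoc, one_mul]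
  rw [h, mul_zero] at h1
  exact (smul_eq_zero.1 h1.symm).resolve_left hM

lemma eq_zero_of_mul_right_eq_zero {M X : Matrix (Fin n) (Fin n) ℤ} (hM : M.det ≠ 0)
    (h : X * M = 0) : X = 0 := by
  have h1 : (X * M) * M.adjugate = M.det • X := by
    rw [Matrix.mul_assoc, mul_adjugate, mul_smul_comm, mul_one]
  rw [h, zero_mul] at h1
  exact (smul_eq_zero.1 h1.symm).resolve_left hM

/-- Left multiplication by an element of `Γ₀(p)` on the double coset. -/
def HeckeCoset.leftMul {κ : SpZ n} (hκ : κ ∈ Gamma0 n p) (g : HeckeCoset n p) : HeckeCoset n p :=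
  ⟨κ.1 * g.1, by
    obtain ⟨a, ha, b, hb, h⟩ := g.2
    exact ⟨κ * a, mul_mem hκ ha, b, hb, by rw [h, Submonoid.coe_mul]; simp only [Matrix.mul_assoc]⟩⟩

/-- Right multiplication by an element of `Γ₀(p)` on the double coset. -/
def HeckeCoset.rightMul {κ : SpZ n} (hκ : κ ∈ Gamma0 n p) (g : HeckeCoset n p) :
    HeckeCoset n p :=
  ⟨g.1 * κ.1, by
    obtain ⟨a, ha, b, hb, h⟩ := g.2
    exact ⟨a, ha, b * κ, mul_mem hb hκ, by
      rw [h, Submonoid.coe_mul]; simp only [Matrix.mul_assoc]⟩⟩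

lemma HeckeCoset.det_ne_zero [Fact p.Prime] (g : HeckeCoset n p) : g.1.det ≠ 0 := by
  obtain ⟨a, ha, b, hb, h⟩ := g.2
  have hu : ∀ c : SpZ n, c.1.det ≠ 0 := fun c h0 => by
    have := congrArg det (coe_mul_inv_cancel c)
    rw [det_mul, h0, zero_mul, det_one] at this
    exact zero_ne_one this
  have hp : (p : ℤ) ≠ 0 := by exact_mod_cast (Fact.out : p.Prime).ne_zero
  rw [h, det_mul, det_mul]
  refine mul_ne_zero (mul_ne_zero (hu a) ?_) (hu b)
  rw [tau, det_fromBlocks_zero₂₁, det_one, one_mul, det_smul, det_one, mul_one]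
  exact pow_ne_zero _ hp

lemma tau_mul_toBlocks (κ : SpZ n) : tau n p * κ.1 = fromBlocks κ.1.toBlocks₁₁ κ.1.toBlocks₁₂
    ((p : ℤ) • κ.1.toBlocks₂₁) ((p : ℤ) • κ.1.toBlocks₂₂) := by
  conv_lhs => rw [← fromBlocks_toBlocks κ.1]
  rw [tau, fromBlocks_multiply]
  simp

lemma mul_tau_toBlocks (κ : SpZ n) : κ.1 * tau n p = fromBlocks κ.1.toBlocks₁₁
    ((p : ℤ) • κ.1.toBlocks₁₂) κ.1.toBlocks₂₁ ((p : ℤ) • κ.1.toBlocks₂₂) := by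
  conv_lhs => rw [← fromBlocks_toBlocks κ.1]
  rw [tau, fromBlocks_multiply]
  simp only [mul_smul_comm, mul_one, mul_zero, zero_add, add_zero]

lemma HeckeCoset.red_toBlocks (g : HeckeCoset n p) :
    red p g.1.toBlocks₂₁ = 0 ∧ IsUnit (red p g.1.toBlocks₁₁).det := by
  obtain ⟨a, ha, b, hb, h⟩ := g.2
  have h1 : ∀ κ ∈ Gamma0 n p, IsUnit (red p κ.1.toBlocks₁₁).det := fun κ hκ => by
    have := congrArg det (Gamma0_relation hκ)
    rw [det_mul, det_one, det_transpose] at this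
    exact .of_mul_eq_one _ this
  rw [h, Matrix.mul_assoc, tau_mul_toBlocks, toBlocks₂₁_mul', toBlocks₁₁_mul',
    toBlocks_fromBlocks₁₁, toBlocks_fromBlocks₂₁, red_add, red_mul, red_mul, red_add, red_mul,
    red_mul, red_smul_self, mem_Gamma0.1 ha, zero_mul, mul_zero, mul_zero, add_zero, add_zero,
    det_mul]
  exact ⟨rfl, (h1 a ha).mul (h1 b hb)⟩

lemma charDet_leftMul (ψ : DirichletCharacter ℂ p) {κ : SpZ n} (hκ : κ ∈ Gamma0 n p)
    (g : HeckeCoset n p) : charDet ψ (g.leftMul hκ).1.toBlocks₁₁ =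
      charDet ψ κ.1.toBlocks₁₁ * charDet ψ g.1.toBlocks₁₁ := by
  rw [HeckeCoset.leftMul, toBlocks₁₁_mul', charDet_eq, charDet_eq, charDet_eq, red_add, red_mul,
    red_mul, g.red_toBlocks.1, mul_zero, add_zero, det_mul, map_mul]

lemma charDet_rightMul (ψ : DirichletCharacter ℂ p) {κ : SpZ n} (hκ : κ ∈ Gamma0 n p)
    (g : HeckeCoset n p) : charDet ψ (g.rightMul hκ).1.toBlocks₁₁ =
      charDet ψ g.1.toBlocks₁₁ * charDet ψ κ.1.toBlocks₁₁ := by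
  rw [HeckeCoset.rightMul, toBlocks₁₁_mul', charDet_eq, charDet_eq, charDet_eq, red_add, red_mul,
    red_mul, mem_Gamma0.1 hκ, mul_zero, add_zero, det_mul, map_mul]

variable (n p) in
/-- Symmetric matrices modulo `p`. -/
abbrev SymMod : Type := {S : Matrix (Fin n) (Fin n) (ZMod p) // S.IsSymm}

/-- The representative `(1 S; 0 p)` of a left coset in the double coset. -/
def heckeRep (S : SymMod n p) : HeckeCoset n p :=
  ⟨tau n p * (unip (lift S.1) (lift_isSymm S.2)).1, 1, one_mem _, unip _ (lift_isSymm S.2),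
    parabolic_le_Gamma0 (unip_mem _ _), by rw [Submonoid.coe_one, one_mul]⟩

lemma heckeRep_coe (S : SymMod n p) :
    (heckeRep S).1 = fromBlocks 1 (lift S.1) 0 ((p : ℤ) • 1) := by
  change tau n p * (unip (lift S.1) (lift_isSymm S.2)).1 = _
  rw [tau_mul_toBlocks, unip, toBlocks_fromBlocks₁₁, toBlocks_fromBlocks₁₂,
      toBlocks_fromBlocks₂₁, toBlocks_fromBlocks₂₂, smul_zero]

variable [Fact p.Prime]

/-- If `B ≡ 0 mod p` then `τ m τ⁻¹` lies in `Γ₀(p)`. -/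
lemma exists_Gamma0_mul_tau (m : SpZ n) (h : red p m.1.toBlocks₁₂ = 0) :
    ∃ κ ∈ Gamma0 n p, κ.1 * tau n p = tau n p * m.1 := by
  obtain ⟨N, hN⟩ := exists_smul_of_red_eq_zero _ h
  have hp : (p : ℤ) ≠ 0 := by exact_mod_cast (Fact.out : p.Prime).ne_zero
  obtain ⟨h1, h2, h3⟩ := symplectic_relations m
  rw [hN, transpose_smul, smul_mul_assoc, mul_smul_comm] at h2
  rw [hN, mul_smul_comm] at h3
  refine ⟨⟨fromBlocks m.1.toBlocks₁₁ N ((p : ℤ) • m.1.toBlocks₂₁) m.1.toBlocks₂₂, ?_⟩, ?_, ?_⟩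
  · rw [SymplecticGroup.fromBlocks_mem_iff, transpose_smul, mul_smul_comm, smul_mul_assoc, h1,
      smul_mul_assoc]
    exact ⟨rfl, smul_right_injective _ hp h2, h3⟩
  · rw [mem_Gamma0, toBlocks_fromBlocks₂₁, red_smul_self]
  · rw [mul_tau_toBlocks, tau_mul_toBlocks, toBlocks_fromBlocks₁₁, toBlocks_fromBlocks₁₂,
      toBlocks_fromBlocks₂₁, toBlocks_fromBlocks₂₂, hN]

/-- `τ⁻¹ κ τ` is integral for `κ ∈ Γ₀(p)`. -/
lemma exists_tau_mul {κ : SpZ n} (h : κ ∈ Gamma0 n p) :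
    ∃ m : SpZ n, κ.1 * tau n p = tau n p * m.1 := by
  obtain ⟨N, hN⟩ := exists_smul_of_red_eq_zero _ (mem_Gamma0.1 h)
  have hp : (p : ℤ) ≠ 0 := by exact_mod_cast (Fact.out : p.Prime).ne_zero
  obtain ⟨h1, h2, h3⟩ := symplectic_relations κ
  rw [hN, transpose_smul, smul_mul_assoc, mul_smul_comm] at h1
  rw [hN, transpose_smul, smul_mul_assoc] at h3
  refine ⟨⟨fromBlocks κ.1.toBlocks₁₁ ((p : ℤ) • κ.1.toBlocks₁₂) N κ.1.toBlocks₂₂, ?_⟩, ?_⟩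
  · rw [SymplecticGroup.fromBlocks_mem_iff, transpose_smul, mul_smul_comm, smul_mul_assoc, h2,
      mul_smul_comm]
    exact ⟨smul_right_injective _ hp h1, rfl, h3⟩
  · rw [mul_tau_toBlocks, tau_mul_toBlocks, toBlocks_fromBlocks₁₁, toBlocks_fromBlocks₁₂,
      toBlocks_fromBlocks₂₁, toBlocks_fromBlocks₂₂, hN]

variable (n p) in
lemma heckeRep_bijective : Function.Bijective fun S : SymMod n p =>
    (Quotient.mk (heckeSetoid n p) (heckeRep S)) := by
  constructor
  · intro S S' h
    obtain ⟨κ, hκ, e⟩ := Quotient.exact h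
    rw [heckeRep_coe, heckeRep_coe] at e
    have e1 := congrArg toBlocks₁₁ e
    have e2 := congrArg toBlocks₁₂ e
    simp only [toBlocks₁₁_mul', toBlocks₁₂_mul', toBlocks_fromBlocks₁₁, toBlocks_fromBlocks₁₂,
      toBlocks_fromBlocks₂₁, toBlocks_fromBlocks₂₂, mul_one, mul_zero, add_zero,
      mul_smul_comm] at e1 e2
    rw [← e1, one_mul] at e2
    have e3 := congrArg (red p) e2
    rw [red_add, red_smul_self, red_lift, red_lift, add_zero] at e3
    exact Subtype.ext e3.symm
  · intro q
    induction q using Quotient.inductionOn with | h g => ?_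
    obtain ⟨a, ha, b, hb, h⟩ := g.2
    -- The coset of `τ b` is represented by `S ≡ ᵗD B`: since `A ᵗD ≡ 1`, the upper right block `B -
    -- A S` of `b u⁻¹` vanishes modulo `p`, and `τ` can be moved past `b u⁻¹`.
    have hs : (red p (b.1.toBlocks₂₂ᵀ * b.1.toBlocks₁₂)).IsSymm := by
      rw [IsSymm, ← red_transpose, transpose_mul, transpose_transpose, (symplectic_relations b).2.1]
    let S : SymMod n p := ⟨_, hs⟩
    let u := unip (lift S.1) (lift_isSymm S.2)
    have hAD : red p b.1.toBlocks₁₁ * (red p b.1.toBlocks₂₂)ᵀ = 1 := by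
      have := mul_eq_one_comm.1 (Gamma0_relation hb)
      simpa [transpose_mul] using congrArg transpose this
    obtain ⟨κ, hκ, e⟩ := exists_Gamma0_mul_tau (p := p) (b * u⁻¹) (by
      rw [Submonoid.coe_mul, toBlocks₁₂_mul', coe_inv_eq_fromBlocks, toBlocks_fromBlocks₁₂,
        toBlocks_fromBlocks₂₂]
      simp only [u, unip, toBlocks_fromBlocks₁₁, toBlocks_fromBlocks₁₂, transpose_one, mul_one]
      rw [(lift_isSymm S.2).eq, red_add, red_mul, red_neg, red_lift]
      simp only [S, red_mul, red_transpose]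
      rw [mul_neg, ← Matrix.mul_assoc, hAD, one_mul, neg_add_cancel])
    refine ⟨S, Quotient.sound ⟨a * κ, mul_mem ha hκ, ?_⟩⟩
    have e' : κ.1 * (heckeRep S).1 = tau n p * b.1 := by
      change κ.1 * (tau n p * u.1) = _
      rw [← Matrix.mul_assoc, e, Submonoid.coe_mul, Matrix.mul_assoc, Matrix.mul_assoc,
        coe_inv_mul_cancel, mul_one]
    rw [h, Submonoid.coe_mul, Matrix.mul_assoc, Matrix.mul_assoc, e']

instance : Finite (Quotient (heckeSetoid n p)) :=
  Finite.of_surjective _ (heckeRep_bijective n p).2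

end HeckeCosets

/-! ### The correspondence γ g = b δ on parabolic orbits -/

section Correspondence

variable {n p : ℕ}

/-- The relation `γ g = b δ` with `b` block upper triangular. -/
structure HeckeRel (g : HeckeCoset n p) (γ δ : SpZ n)
    (b : Matrix (Fin n ⊕ Fin n) (Fin n ⊕ Fin n) ℤ) : Prop where
  zero : b.toBlocks₂₁ = 0
  eq : γ.1 * g.1 = b * δ.1

variable {g : HeckeCoset n p} {γ γ' δ δ' : SpZ n}
  {b b' : Matrix (Fin n ⊕ Fin n) (Fin n ⊕ Fin n) ℤ}

lemma HeckeRel.det_ne_zero [Fact p.Prime] (h : HeckeRel g γ δ b) :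
    b.toBlocks₁₁.det ≠ 0 ∧ b.toBlocks₂₂.det ≠ 0 := by
  have h1 := congrArg det h.eq
  have hb : b.det = b.toBlocks₁₁.det * b.toBlocks₂₂.det := by
    conv_lhs => rw [← fromBlocks_toBlocks b, h.zero]
    rw [det_fromBlocks_zero₂₁]
  have hγ : γ.1.det ≠ 0 := fun h0 => by
    have := congrArg det (coe_mul_inv_cancel γ)
    rw [det_mul, h0, zero_mul, det_one] at this
    exact zero_ne_one this
  rw [det_mul, det_mul, hb] at h1
  constructor <;> intro h0 <;> rw [h0] at h1 <;>
    simp [hγ, g.det_ne_zero] at h1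

lemma HeckeRel.left {η : SpZ n} (hη : η ∈ parabolic n) (h : HeckeRel g γ δ b) :
    HeckeRel g (η * γ) δ (η.1 * b) where
  zero := by rw [toBlocks₂₁_mul', mem_parabolic.1 hη, h.zero, zero_mul, mul_zero, add_zero]
  eq := by rw [Submonoid.coe_mul, Matrix.mul_assoc, h.eq, Matrix.mul_assoc]

lemma HeckeRel.right {η : SpZ n} (hη : η ∈ parabolic n) (h : HeckeRel g γ δ b) :
    HeckeRel g γ (η * δ) (b * (η⁻¹).1) where
  zero := by
    rw [toBlocks₂₁_mul', mem_parabolic.1 (inv_mem hη), h.zero, zero_mul, mul_zero, add_zero]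
  eq := by
    rw [Submonoid.coe_mul, Matrix.mul_assoc, ← Matrix.mul_assoc _ η.1, coe_inv_mul_cancel, one_mul,
      h.eq]

/-- The quotient of the two `δ` carries one nonsingular block upper triangular matrix to another, so
it is itself block upper triangular. Thus the orbit `P δ` depends only on `γ`. -/
lemma HeckeRel.mul_inv_mem_right [Fact p.Prime] (h : HeckeRel g γ δ b) (h' : HeckeRel g γ δ' b') :
    δ' * δ⁻¹ ∈ parabolic n := by
  have e : b = b' * (δ' * δ⁻¹).1 := by
    rw [Submonoid.coe_mul, ← Matrix.mul_assoc, ← h'.eq, h.eq, Matrix.mul_assoc, coe_mul_inv_cancel,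
      mul_one]
  have e1 := congrArg toBlocks₂₁ e
  rw [toBlocks₂₁_mul', h.zero, h'.zero, zero_mul, zero_add] at e1
  exact eq_zero_of_mul_left_eq_zero h'.det_ne_zero.2 e1.symm

/-- Conversely `δ` determines `P γ`, so the correspondence is injective on orbits. -/
lemma HeckeRel.exists_left [Fact p.Prime] (h : HeckeRel g γ δ b) (h' : HeckeRel g γ' δ b') :
    ∃ η ∈ parabolic n, γ' = η * γ ∧ b' = η.1 * b := by
  have e : b' = (γ' * γ⁻¹).1 * b := by
    have e0 : b' * δ.1 = ((γ' * γ⁻¹).1 * b) * δ.1 := by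
      rw [Matrix.mul_assoc, ← h.eq, ← Matrix.mul_assoc, ← Submonoid.coe_mul, inv_mul_cancel_right,
        h'.eq]
    have := congrArg (· * (δ⁻¹).1) e0
    simpa only [Matrix.mul_assoc, coe_mul_inv_cancel, mul_one] using this
  refine ⟨γ' * γ⁻¹, ?_, by group, e⟩
  have e1 := congrArg toBlocks₂₁ e
  rw [toBlocks₂₁_mul', h.zero, h'.zero, mul_zero, add_zero] at e1
  exact eq_zero_of_mul_right_eq_zero h.det_ne_zero.1 e1.symm

/-- The value of `ψ` at the sign of the determinant of the lower right block. -/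
def signChar (ψ : DirichletCharacter ℂ p) (b : Matrix (Fin n ⊕ Fin n) (Fin n ⊕ Fin n) ℤ) : ℂ :=
  ψ ((Int.sign b.toBlocks₂₂.det : ℤ) : ZMod p)

variable {ψ : DirichletCharacter ℂ p}

lemma sign_parabolic_det {η : SpZ n} (hη : η ∈ parabolic n) :
    Int.sign η.1.toBlocks₂₂.det = η.1.toBlocks₂₂.det := by
  rcases Int.isUnit_iff.1 (parabolic_det hη) with h | h <;> rw [h] <;> rfl

lemma signChar_parabolic_mul {η : SpZ n} (hη : η ∈ parabolic n) :
    signChar ψ (η.1 * b) = charDet ψ η.1.toBlocks₂₂ * signChar ψ b := by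
  rw [signChar, toBlocks₂₂_mul', mem_parabolic.1 hη, zero_mul, zero_add, det_mul, Int.sign_mul,
    sign_parabolic_det hη, Int.cast_mul, map_mul, signChar, charDet]

lemma signChar_mul_parabolic {η : SpZ n} (hη : η ∈ parabolic n) (h : b.toBlocks₂₁ = 0) :
    signChar ψ (b * η.1) = charDet ψ η.1.toBlocks₂₂ * signChar ψ b := by
  rw [signChar, toBlocks₂₂_mul', h, zero_mul, zero_add, det_mul, Int.sign_mul,
    sign_parabolic_det hη, Int.cast_mul, map_mul, signChar, charDet, mul_comm]

lemma norm_signChar_le (b : Matrix (Fin n ⊕ Fin n) (Fin n ⊕ Fin n) ℤ) : ‖signChar ψ b‖ ≤ 1 :=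
  ψ.norm_le_one _

/-- Right equivariance of functions on `Sp(n, ℤ)` under `Γ₀(p)`. -/
def RightEquivariant (ψ : DirichletCharacter ℂ p) (φ : SpZ n → ℂ) : Prop :=
  ∀ κ ∈ Gamma0 n p, ∀ γ, φ (γ * κ) = charDet ψ κ.1.toBlocks₂₂ * φ γ

open Classical in
/-- The action of an element of the double coset on functions on `Sp(n, ℤ)`. -/
def heckeT (ψ : DirichletCharacter ℂ p) (g : HeckeCoset n p) (φ : SpZ n → ℂ) (δ : SpZ n) : ℂ :=
  if h : ∃ x : SpZ n × Matrix (Fin n ⊕ Fin n) (Fin n ⊕ Fin n) ℤ, HeckeRel g x.1 δ x.2 then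
    signChar ψ h.choose.2 * φ h.choose.1
  else 0

variable {φ : SpZ n → ℂ}

lemma heckeT_eq_zero (h : ∀ γ b, ¬ HeckeRel g γ δ b) : heckeT ψ g φ δ = 0 :=
  dif_neg fun ⟨x, hx⟩ => h x.1 x.2 hx

lemma norm_heckeT_le {C : ℝ} (hC : 0 ≤ C) (hφ : ∀ γ, ‖φ γ‖ ≤ C) (g : HeckeCoset n p) (δ : SpZ n) :
    ‖heckeT ψ g φ δ‖ ≤ C := by
  rw [heckeT]
  split_ifs with h
  · rw [norm_mul]
    exact (mul_le_of_le_one_left (norm_nonneg _) (norm_signChar_le _)).trans (hφ _)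
  · rwa [norm_zero]

variable [Fact p.Prime]

/-- Changing `γ` and `b` by the same `η` multiplies both factors by `ψ(det D_η)`, whose square is
`1`. The sign character in `heckeT` makes this cancellation possible. -/
lemma heckeT_eq (hq : IsSquareTrivial ψ) (hφ : LeftEquivariant ψ φ) (h : HeckeRel g γ δ b) :
    heckeT ψ g φ δ = signChar ψ b * φ γ := by
  have hex : ∃ x : SpZ n × Matrix (Fin n ⊕ Fin n) (Fin n ⊕ Fin n) ℤ, HeckeRel g x.1 δ x.2 :=
    ⟨(γ, b), h⟩
  rw [heckeT, dif_pos hex]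
  obtain ⟨η, hη, e1, e2⟩ := h.exists_left hex.choose_spec
  rw [e1, e2, signChar_parabolic_mul hη, hφ η hη]
  linear_combination (signChar ψ b * φ γ) * hq.parabolic_mul_self hη

lemma LeftEquivariant.heckeT (hq : IsSquareTrivial ψ) (hφ : LeftEquivariant ψ φ)
    (g : HeckeCoset n p) : LeftEquivariant ψ (heckeT ψ g φ) := by
  intro η hη δ
  by_cases h : ∃ γ b, HeckeRel g γ δ b
  · obtain ⟨γ, b, h⟩ := h
    have hu : charDet ψ (η⁻¹).1.toBlocks₂₂ = charDet ψ η.1.toBlocks₂₂ := by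
      rw [coe_inv_eq_fromBlocks, toBlocks_fromBlocks₂₂, charDet_transpose,
        hq.Gamma0_charDet_eq (parabolic_le_Gamma0 hη)]
    rw [heckeT_eq hq hφ h, heckeT_eq hq hφ (h.right hη), signChar_mul_parabolic (inv_mem hη) h.zero,
      hu, mul_assoc]
  · push Not at h
    rw [heckeT_eq_zero h, heckeT_eq_zero, mul_zero]
    intro γ b hb
    have := hb.right (inv_mem hη)
    rw [inv_mul_cancel_left] at this
    exact h _ _ this

lemma heckeT_leftMul (hq : IsSquareTrivial ψ) (hφ : LeftEquivariant ψ φ)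
    (hφ' : RightEquivariant ψ φ) {κ : SpZ n} (hκ : κ ∈ Gamma0 n p) (g : HeckeCoset n p)
    (δ : SpZ n) : heckeT ψ g φ δ = charDet ψ κ.1.toBlocks₂₂ * heckeT ψ (g.leftMul hκ) φ δ := by
  by_cases h : ∃ γ b, HeckeRel (g.leftMul hκ) γ δ b
  · obtain ⟨γ, b, h⟩ := h
    have h' : HeckeRel g (γ * κ) δ b :=
      ⟨h.zero, by rw [← h.eq, Submonoid.coe_mul, Matrix.mul_assoc]; rfl⟩
    rw [heckeT_eq hq hφ h, heckeT_eq hq hφ h', hφ' κ hκ]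
    ring
  · push Not at h
    rw [heckeT_eq_zero h, heckeT_eq_zero, mul_zero]
    intro γ b hb
    refine h (γ * κ⁻¹) b ⟨hb.zero, ?_⟩
    rw [← hb.eq, HeckeCoset.leftMul, ← Matrix.mul_assoc, ← Submonoid.coe_mul, inv_mul_cancel_right]

lemma heckeT_rightMul (hq : IsSquareTrivial ψ) (hφ : LeftEquivariant ψ φ) {κ : SpZ n}
    (hκ : κ ∈ Gamma0 n p) (g : HeckeCoset n p) (δ : SpZ n) :
    heckeT ψ (g.rightMul hκ) φ (δ * κ) = heckeT ψ g φ δ := by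
  by_cases h : ∃ γ b, HeckeRel g γ δ b
  · obtain ⟨γ, b, h⟩ := h
    have h' : HeckeRel (g.rightMul hκ) γ (δ * κ) b :=
      ⟨h.zero, by rw [HeckeCoset.rightMul, ← Matrix.mul_assoc, h.eq, Submonoid.coe_mul,
        Matrix.mul_assoc]⟩
    rw [heckeT_eq hq hφ h, heckeT_eq hq hφ h']
  · push Not at h
    rw [heckeT_eq_zero h, heckeT_eq_zero]
    intro γ b hb
    refine h γ b ⟨hb.zero, ?_⟩
    have := congrArg (· * (κ⁻¹).1) hb.eq
    simpa only [HeckeCoset.rightMul, Submonoid.coe_mul, Matrix.mul_assoc, coe_mul_inv_cancel,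
      mul_one] using this

end Correspondence

/-! ### The action of U(p) in the basis ψ* -/

section HeckeAction

variable {n p : ℕ}

/-- The block diagonal matrix `w_r τ w_r⁻¹`. -/
def tauConj (n p r : ℕ) : Matrix (Fin n ⊕ Fin n) (Fin n ⊕ Fin n) ℤ :=
  fromBlocks ((p : ℤ) • prL ℤ n r + prR ℤ n r) 0 0 (prL ℤ n r + (p : ℤ) • prR ℤ n r)

lemma w_mul_tau (r : ℕ) : (w n r).1 * tau n p = tauConj n p r * (w n r).1 := by
  rw [mul_tau_toBlocks, coe_w, tauConj, fromBlocks_multiply, toBlocks_fromBlocks₁₁,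
    toBlocks_fromBlocks₁₂, toBlocks_fromBlocks₂₁, toBlocks_fromBlocks₂₂]
  simp only [add_mul, smul_mul_assoc, prL_mul_prL, prR_mul_prR, prL_mul_prR, prR_mul_prL, mul_neg,
    smul_neg, smul_zero, zero_mul, add_zero, zero_add, neg_zero]

lemma det_tauConj_toBlocks₂₂ {r : ℕ} (hr : r ≤ n) :
    (tauConj n p r).toBlocks₂₂.det = (p : ℤ) ^ (n - r) := by
  have e : prL ℤ n r + (p : ℤ) • prR ℤ n r =
      diagonal fun i : Fin n => if i.1 < r then (1 : ℤ) else p := by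
    rw [prL, prR, ← diagonal_smul, diagonal_add]
    congr 1
    funext i
    simp only [Pi.smul_apply]
    split_ifs <;> simp
  rw [tauConj, toBlocks_fromBlocks₂₂, e, det_diagonal, Finset.prod_ite, Finset.prod_const_one,
    one_mul, Finset.prod_const]
  congr 1
  have h1 := Finset.card_filter_add_card_filter_not (s := Finset.univ) fun i : Fin n => i.1 < r
  rw [Fin.card_filter_val_lt, min_eq_right hr, Finset.card_univ, Fintype.card_fin] at h1
  omega

variable {ψ : DirichletCharacter ℂ p}

lemma psiStar_leftEquivariant (hq : IsSquareTrivial ψ) (r : ℕ) :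
    LeftEquivariant (n := n) ψ (psiStar ψ r) := fun _ hη γ => psiStar_parabolic_mul hq hη γ

lemma psiStar_rightEquivariant (hq : IsSquareTrivial ψ) (r : ℕ) :
    RightEquivariant (n := n) ψ (psiStar ψ r) := fun _ hκ γ => psiStar_mul_Gamma0 hq hκ γ

variable [Fact p.Prime] {g : HeckeCoset n p} {γ δ : SpZ n}
  {b b' : Matrix (Fin n ⊕ Fin n) (Fin n ⊕ Fin n) ℤ} {r : ℕ}

/-- Write `g = a τ c` and `γ a = η w_r κ`. Moving `τ` to the left past `κ` and then past `w_r` gives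
`γ g = (η · w_r τ w_r⁻¹)(w_r m c)`; the block diagonal factor has `D`-determinant `p^(n-r)`. -/
lemma exists_heckeRel (g : HeckeCoset n p) (hr : r ≤ n) (hγ : γ ∈ cell n p r) :
    ∃ δ b, HeckeRel g γ δ b ∧ |b.toBlocks₂₂.det| = (p : ℤ) ^ (n - r) := by
  obtain ⟨a, ha, c, hc, h⟩ := g.2
  obtain ⟨⟨η, κ⟩, hη, hκ, e⟩ := cell_mul_Gamma0 hγ ha
  simp only at hη hκ e
  obtain ⟨m, hm⟩ := exists_tau_mul hκ
  refine ⟨w n r * m * c, η.1 * tauConj n p r, ⟨?_, ?_⟩, ?_⟩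
  · rw [toBlocks₂₁_mul', mem_parabolic.1 hη, tauConj, toBlocks_fromBlocks₂₁, zero_mul, mul_zero,
      add_zero]
  · calc γ.1 * g.1 = (γ * a).1 * tau n p * c.1 := by
          rw [h, Submonoid.coe_mul]; simp only [Matrix.mul_assoc]
      _ = η.1 * (w n r).1 * (κ.1 * tau n p) * c.1 := by
          rw [e, Submonoid.coe_mul, Submonoid.coe_mul]; simp only [Matrix.mul_assoc]
      _ = η.1 * ((w n r).1 * tau n p) * m.1 * c.1 := by
          rw [hm]; simp only [Matrix.mul_assoc]
      _ = _ := by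
          rw [w_mul_tau, Submonoid.coe_mul, Submonoid.coe_mul]; simp only [Matrix.mul_assoc]
  · rw [toBlocks₂₂_mul', mem_parabolic.1 hη, zero_mul, zero_add, det_mul, abs_mul,
      det_tauConj_toBlocks₂₂ hr, Int.isUnit_iff_abs_eq.1 (parabolic_det hη), one_mul,
      abs_of_nonneg (by positivity)]

omit [Fact p.Prime] in
lemma HeckeRel.unique (h : HeckeRel g γ δ b) (h' : HeckeRel g γ δ b') : b = b' := by
  have := congrArg (· * (δ⁻¹).1) (h.eq.symm.trans h'.eq)
  simpa only [Matrix.mul_assoc, coe_mul_inv_cancel, mul_one] using this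

lemma HeckeRel.abs_det (h : HeckeRel g γ δ b) (hr : r ≤ n) (hγ : γ ∈ cell n p r) :
    |b.toBlocks₂₂.det| = (p : ℤ) ^ (n - r) := by
  obtain ⟨δ₀, b₀, h₀, e⟩ := exists_heckeRel g hr hγ
  have hε := h₀.mul_inv_mem_right h
  have h1 := h₀.right hε
  rw [inv_mul_cancel_right] at h1
  rw [h.unique h1, toBlocks₂₂_mul', h₀.zero, zero_mul, zero_add, det_mul, abs_mul, e,
    Int.isUnit_iff_abs_eq.1 (parabolic_det (inv_mem hε)), mul_one]

omit [Fact p.Prime] in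
lemma HeckeRel.similitude (h : HeckeRel g γ δ b) :
    bᵀ * J (Fin n) ℤ * b = (p : ℤ) • J (Fin n) ℤ := by
  have e : b = γ.1 * g.1 * (δ⁻¹).1 := by
    rw [h.eq, Matrix.mul_assoc, coe_mul_inv_cancel, mul_one]
  have h1 := SymplecticGroup.mem_iff'.1 γ.2
  have h2 := SymplecticGroup.mem_iff'.1 (δ⁻¹).2
  rw [e, transpose_mul, transpose_mul]
  calc _ = (δ⁻¹).1ᵀ * (g.1ᵀ * (γ.1ᵀ * J (Fin n) ℤ * γ.1) * g.1) * (δ⁻¹).1 := by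
        simp only [Matrix.mul_assoc]
    _ = _ := by rw [h1, g.similitude, mul_smul_comm, smul_mul_assoc, h2]

variable {k : ℤ}

/-- The upper triangular factor has similitude `p` and `det D_b = ± p^(n-r)`, hence `j(b, ·) = ±
p^(n/2 - r)`. Only the cell of `γ` matters, and this is how `s` enters the eigenvalues. -/
lemma hFac_of_rel (hk : ψ (-1) = (-1) ^ k) (h : HeckeRel g γ δ b) (hr : r ≤ n)
    (hγ : γ ∈ cell n p r) (s : ℂ) (Z : UpperHalfSpace n) :
    hFac k s (gmul γ.toGSpPos g.toGSpPos) Z =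
      signChar ψ b * (p : ℂ) ^ (s * (2 * r - n)) * hFac k s δ.toGSpPos Z := by
  have hp := (Fact.out : p.Prime).pos
  have hp' : (0 : ℝ) < p := by exact_mod_cast hp
  let B : GSpPos n := GSpPos.ofInt b p hp h.similitude
  have e : gmul γ.toGSpPos g.toGSpPos = gmul B δ.toGSpPos := by
    refine GSpPos.ext' ?_ ?_
    · change γ.1.map (Int.castRingHom ℝ) * g.1.map (Int.castRingHom ℝ) =
        b.map (Int.castRingHom ℝ) * δ.1.map (Int.castRingHom ℝ)
      rw [← Matrix.map_mul, ← Matrix.map_mul, h.eq]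
    · simp [gmul, SpZ.toGSpPos, GSpPos.ofInt, HeckeCoset.toGSpPos, B]
  rw [e, hFac_gmul]
  congr 1
  set W := act δ.toGSpPos Z
  set ε := Int.sign b.toBlocks₂₂.det with hε
  have hε1 : ε = 1 ∨ ε = -1 := by
    rcases lt_trichotomy b.toBlocks₂₂.det 0 with h0 | h0 | h0
    · exact Or.inr (Int.sign_eq_neg_one_of_neg h0)
    · exact absurd h0 h.det_ne_zero.2
    · exact Or.inl (Int.sign_eq_one_of_pos h0)
  set x : ℝ := (p : ℝ) ^ ((n : ℝ) / 2 - r) with hx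
  have hx0 : 0 < x := Real.rpow_pos_of_pos hp' _
  have hj : autFactor B W = (ε : ℝ) * (x : ℂ) := by
    have hd : B.mat.toBlocks₂₂.det = (b.toBlocks₂₂.det : ℝ) :=
      (RingHom.map_det (Int.castRingHom ℝ) _).symm
    have hd' : (b.toBlocks₂₂.det : ℝ) = ε * (p : ℝ) ^ (n - r) := by
      have h1 := Int.sign_mul_abs b.toBlocks₂₂.det
      rw [h.abs_det hr hγ] at h1
      exact_mod_cast h1.symm
    rw [autFactor_of_toBlocks₂₁_eq_zero, hd, hd']
    · have : (p : ℝ) ^ (-(n : ℝ) / 2) * (p : ℝ) ^ (n - r) = x := by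
        rw [hx, ← Real.rpow_natCast, ← Real.rpow_add hp', Nat.cast_sub hr]
        congr 1
        ring
      rw [← this]
      push_cast
      change (((p : ℝ) ^ (-(n : ℝ) / 2) : ℝ) : ℂ) * _ = _
      ring
    · ext i j
      have := congrFun (congrFun h.zero i) j
      simp only [toBlocks₂₁, of_apply, Matrix.zero_apply] at this
      simp [B, GSpPos.ofInt, toBlocks₂₁, this]
  have hn : ‖autFactor B W‖ = x := by
    rw [hj, norm_mul, Complex.norm_real, Complex.norm_real, Real.norm_of_nonneg hx0.le]
    rcases hε1 with h1 | h1 <;> simp [h1]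
  rw [hFac, hn, hj, mul_zpow, character_sign hk hε1, signChar, mul_assoc]
  congr 1
  have hxc : (x : ℂ) ≠ 0 := by exact_mod_cast hx0.ne'
  rw [← Complex.cpow_intCast, ← Complex.cpow_add _ _ hxc, hx, Complex.ofReal_cpow hp'.le,
    Complex.ofReal_natCast]
  have him : (Complex.log p * (((n : ℝ) / 2 - r : ℝ) : ℂ)).im = 0 := by
    rw [← Complex.natCast_log, ← Complex.ofReal_mul, Complex.ofReal_im]
  rw [← Complex.cpow_mul _ (by rw [him]; linarith [Real.pi_pos])
    (by rw [him]; exact Real.pi_pos.le)]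
  congr 1
  push_cast
  ring

lemma exists_heckeRel_out (g : HeckeCoset n p) (q : ParQuot n) :
    ∃ q' : ParQuot n, ∃ b, HeckeRel g q.out q'.out b := by
  obtain ⟨r, hr, hγ⟩ := exists_mem_cell (p := p) q.out
  obtain ⟨δ, b, h, -⟩ := exists_heckeRel g hr hγ
  obtain ⟨η, hη, e⟩ := exists_out_eq δ
  exact ⟨_, _, e ▸ h.right hη⟩

omit [Fact p.Prime] in
lemma eq_of_out_eq_mul {q q' : ParQuot n} {η : SpZ n} (hη : η ∈ parabolic n)
    (h : q'.out = η * q.out) : q = q' := by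
  rw [← q.out_eq, ← q'.out_eq]
  refine Quotient.sound ?_
  change QuotientGroup.rightRel (parabolic n) _ _
  rw [QuotientGroup.rightRel_apply, h, mul_inv_cancel_right]
  exact hη

lemma slash_eisOf_psiStar (hq : IsSquareTrivial ψ) (hk : ψ (-1) = (-1) ^ k) (hr : r ≤ n) (s : ℂ)
    (g : HeckeCoset n p) (Z : UpperHalfSpace n) :
    slash k (fun Z => eisOf k (psiStar ψ r) Z s) g.toGSpPos Z =
      (p : ℂ) ^ (s * (2 * r - n)) * eisOf k (heckeT ψ g (psiStar ψ r)) Z s := by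
  have hφ := psiStar_leftEquivariant (n := n) hq r
  rw [slash_eisOf, eisOf, mul_left_comm, ← tsum_mul_left (a := (p : ℂ) ^ (s * (2 * r - n)))]
  congr 1
  choose e he using exists_heckeRel_out g
  choose b hb using he
  have hinj : Function.Injective e := by
    intro q q' h
    have h' := hb q'
    rw [← h] at h'
    obtain ⟨η, hη, e1, -⟩ := (hb q).exists_left h'
    exact eq_of_out_eq_mul hη e1
  -- The sum is reindexed along the injection `P γ ↦ P δ`; orbits outside its image have `heckeT =
  -- 0`.
  refine Eq.trans ?_ (hinj.tsum_eq (f := fun q => (p : ℂ) ^ (s * (2 * r - n)) *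
    (heckeT ψ g (psiStar ψ r) q.out * hFac k s q.out.toGSpPos Z)) ?_)
  · refine tsum_congr fun q => ?_
    rw [heckeT_eq hq hφ (hb q)]
    by_cases hc : q.out ∈ cell n p r
    · rw [hFac_of_rel hk (hb q) hr hc]
      ring
    · rw [psiStar_eq_zero hc]
      ring
  · intro q' hq'
    by_contra hne
    apply hq'
    simp only
    rw [heckeT_eq_zero, zero_mul, mul_zero]
    intro γ b' h
    apply hne
    obtain ⟨η, hη, e1⟩ := exists_out_eq γ
    have h1 := h.left hη
    rw [← e1] at h1
    refine ⟨Quotient.mk _ γ, ?_⟩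
    have h2 := (hb (Quotient.mk _ γ)).mul_inv_mem_right h1
    exact eq_of_out_eq_mul h2 (by group)

/-- The operator on functions on `Sp(n, ℤ)` that corresponds to `U(p)`. -/
def heckeSum (ψ : DirichletCharacter ℂ p) (φ : SpZ n → ℂ) (δ : SpZ n) : ℂ :=
  ∑ᶠ q : Quotient (heckeSetoid n p), charDet ψ q.out.1.toBlocks₁₁ * heckeT ψ q.out φ δ

variable {φ : SpZ n → ℂ}

lemma heckeT_out (hq : IsSquareTrivial ψ) (hφ : LeftEquivariant ψ φ) (hφ' : RightEquivariant ψ φ)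
    (g : HeckeCoset n p) (δ : SpZ n) :
    charDet ψ (Quotient.mk (heckeSetoid n p) g).out.1.toBlocks₁₁ *
      heckeT ψ (Quotient.mk (heckeSetoid n p) g).out φ δ =
    charDet ψ g.1.toBlocks₁₁ * heckeT ψ g φ δ := by
  obtain ⟨κ, hκ, e⟩ := Quotient.mk_out (s := heckeSetoid n p) g
  have e' : g = (Quotient.mk (heckeSetoid n p) g).out.leftMul hκ := Subtype.ext e
  conv_rhs => rw [e']
  rw [charDet_leftMul, heckeT_leftMul hq hφ hφ' hκ, hq.Gamma0_charDet_eq hκ]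
  ring

lemma LeftEquivariant.heckeSum (hq : IsSquareTrivial ψ) (hφ : LeftEquivariant ψ φ) :
    LeftEquivariant ψ (heckeSum ψ φ) := by
  intro η hη δ
  refine Eq.trans ?_ (mul_finsum _ _).symm
  refine finsum_congr fun q => ?_
  rw [hφ.heckeT hq q.out η hη]
  ring

/-- Right multiplication by `κ` permutes the left cosets, and the character of `det A_κ` that
appears equals that of `det D_κ`. -/
lemma RightEquivariant.heckeSum (hq : IsSquareTrivial ψ) (hφ : LeftEquivariant ψ φ)
    (hφ' : RightEquivariant ψ φ) : RightEquivariant ψ (heckeSum ψ φ) := by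
  intro κ hκ δ
  refine Eq.trans ?_ (mul_finsum _ _).symm
  symm
  let e : Quotient (heckeSetoid n p) → Quotient (heckeSetoid n p) := fun q =>
    Quotient.mk _ (q.out.rightMul hκ)
  have he : Function.Injective e := by
    intro q q' h
    obtain ⟨ε, hε, h1⟩ := Quotient.exact h
    rw [← q.out_eq, ← q'.out_eq]
    refine Quotient.sound ⟨ε, hε, ?_⟩
    have := congrArg (· * (κ⁻¹).1) h1
    simpa only [HeckeCoset.rightMul, Matrix.mul_assoc, coe_mul_inv_cancel, mul_one] using this
  refine finsum_eq_of_bijective e (Finite.injective_iff_bijective.1 he) fun q => ?_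
  rw [heckeT_out hq hφ hφ', charDet_rightMul, heckeT_rightMul hq hφ, hq.Gamma0_charDet_eq hκ]
  ring

lemma heckeSum_eq_sum (hq : IsSquareTrivial ψ) (hφ : LeftEquivariant ψ φ)
    (hφ' : RightEquivariant ψ φ) (δ : SpZ n) :
    heckeSum ψ φ δ = ∑ S : SymMod n p, heckeT ψ (heckeRep S) φ δ := by
  rw [← finsum_eq_sum_of_fintype]
  symm
  refine finsum_eq_of_bijective _ (heckeRep_bijective n p) fun S => ?_
  rw [heckeT_out hq hφ hφ', heckeRep_coe, toBlocks_fromBlocks₁₁, charDet_one, one_mul]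

lemma eq_sum_psiStar (hq : IsSquareTrivial ψ) (hφ : LeftEquivariant ψ φ)
    (hφ' : RightEquivariant ψ φ) (γ : SpZ n) :
    φ γ = ∑ j : Fin (n + 1), φ (w n j) * psiStar ψ j γ := by
  obtain ⟨r, hr, hγ⟩ := exists_mem_cell (p := p) γ
  rw [Finset.sum_eq_single (⟨r, by omega⟩ : Fin (n + 1))]
  · obtain ⟨⟨η, κ⟩, hη, hκ, rfl⟩ := hγ
    simp only at hη hκ ⊢
    rw [psiStar_eq hq hη hκ, hφ' κ hκ, hφ η hη]
    ring
  · intro j _ hj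
    rw [psiStar_eq_zero, mul_zero]
    intro hc
    exact hj (Fin.ext (cell_disjoint (by omega) hr hc hγ))
  · simp

/-- From `γ g = b w_j` one gets `C_γ A_g ≡ D_b I_j` modulo `p` with `A_g` invertible. So `rank C_γ ≤
j < r`, and `γ` is not in the cell of `w_r`. -/
lemma heckeT_psiStar_eq_zero_of_lt (hq : IsSquareTrivial ψ) (hr : r ≤ n) {j : ℕ} (hj : j < r)
    (g : HeckeCoset n p) : heckeT ψ g (psiStar ψ r) (w n j) = 0 := by
  by_cases h : ∃ γ b, HeckeRel g γ (w n j) b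
  · obtain ⟨γ, b, h⟩ := h
    rw [heckeT_eq hq (psiStar_leftEquivariant hq r) h, psiStar_eq_zero, mul_zero]
    intro hc
    have h1 := congrArg (fun M => red p M.toBlocks₂₁) h.eq
    simp only [toBlocks₂₁_mul', h.zero, coe_w, toBlocks_fromBlocks₂₁, zero_mul, zero_add, red_add,
      red_mul, g.red_toBlocks.1, mul_zero, add_zero, red_prL] at h1
    have h2 := rank_mul_eq_left_of_isUnit_det _ (red p γ.1.toBlocks₂₁) g.red_toBlocks.2
    rw [h1, rank_of_mem_cell hr hc] at h2
    have h3 := rank_mul_le_right (red p b.toBlocks₂₂) (prL (ZMod p) n j)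
    rw [rank_prL _ (by omega)] at h3
    omega
  · push Not at h
    exact heckeT_eq_zero h

end HeckeAction

/-! ### The diagonal coefficients -/

section Counting

variable {n p : ℕ}

lemma prL_mul_mul_prL_eq_zero_iff {R : Type*} [CommRing R] {r : ℕ} {S : Matrix (Fin n) (Fin n) R} :
    prL R n r * S * prL R n r = 0 ↔ ∀ i j : Fin n, i.1 < r → j.1 < r → S i j = 0 := by
  rw [← Matrix.ext_iff]
  refine forall₂_congr fun i j => ?_
  rw [prL, mul_diagonal, diagonal_mul, Matrix.zero_apply]
  split_ifs <;> simp [*]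

/-- The index set of the free entries of a symmetric matrix whose upper left block vanishes. -/
abbrev FreeEntry (n r : ℕ) : Type := {x : Fin n × Fin n // x.1 ≤ x.2 ∧ r ≤ x.2.1}

lemma card_freeEntry_eq_sum (n r : ℕ) : Fintype.card (FreeEntry n r) =
    ∑ j ∈ Finset.range n, if r ≤ j then j + 1 else 0 := by
  rw [Fintype.card_subtype, Finset.card_filter, ← Finset.univ_product_univ,
    Finset.sum_product_right, ← Fin.sum_univ_eq_sum_range (fun j => if r ≤ j then j + 1 else 0)]
  refine Finset.sum_congr rfl fun j _ => ?_
  by_cases h : r ≤ j.1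
  · simp only [h, and_true, if_true]
    rw [← Finset.card_filter, ← Fin.card_Iic j]
    congr 1
    ext i
    simp
  · simp [h]

lemma card_freeEntry {r : ℕ} (hr : r ≤ n) :
    2 * Fintype.card (FreeEntry n r) + r * (r + 1) = n * (n + 1) := by
  rw [card_freeEntry_eq_sum]
  induction n, hr using Nat.le_induction with
  | base =>
    rw [Finset.sum_eq_zero, mul_zero, zero_add]
    intro j hj
    rw [if_neg]
    simpa using hj
  | succ m hm ih =>
    rw [Finset.sum_range_succ, if_pos hm]
    linarith

/-- Symmetric matrices with vanishing upper left block are given by their free entries. -/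
def symModEquiv (n p r : ℕ) :
    {S : SymMod n p // prL (ZMod p) n r * S.1 * prL (ZMod p) n r = 0} ≃
      (FreeEntry n r → ZMod p) where
  toFun S x := S.1.1 x.1.1 x.1.2
  invFun f := ⟨⟨of fun i j => if h : r ≤ (max i j).1 then
      f ⟨(min i j, max i j), min_le_max, h⟩ else 0, by
        ext i j
        simp only [transpose_apply, of_apply, max_comm j i, min_comm j i]⟩, by
      rw [prL_mul_mul_prL_eq_zero_iff]
      intro i j hi hj
      refine dif_neg (c := r ≤ (max i j).1) ?_
      rcases max_choice i j with h | h <;> rw [h] <;> omega⟩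
  left_inv S := by
    apply Subtype.ext; apply Subtype.ext
    ext i j
    have hS := prL_mul_mul_prL_eq_zero_iff.1 S.2
    simp only [of_apply]
    split_ifs with h
    · rcases le_total i j with hij | hij
      · rw [min_eq_left hij, max_eq_right hij]
      · rw [min_eq_right hij, max_eq_left hij, S.1.2.apply]
    · have hi : i ≤ max i j := le_max_left _ _
      have hj : j ≤ max i j := le_max_right _ _
      rw [Fin.le_def] at hi hj
      exact (hS i j (by omega) (by omega)).symm
  right_inv f := by
    funext x
    obtain ⟨⟨i, j⟩, hij, hr⟩ := x
    simp only [of_apply]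
    simp only at hij hr
    simp only [max_eq_right hij, min_eq_left hij, hr, dite_true]

variable [Fact p.Prime] {r : ℕ} {ψ : DirichletCharacter ℂ p}

/-- Under the vanishing condition `w_r` conjugates the translation by `S` into `P`, so `w_r (1 S; 0
p) = b w_r` with `b` block upper triangular: the correspondence fixes the orbit of `w_r`. -/
lemma heckeT_heckeRep_w (hq : IsSquareTrivial ψ) (S : SymMod n p)
    (hS : prL (ZMod p) n r * S.1 * prL (ZMod p) n r = 0) (hr : r ≤ n) :
    heckeT ψ (heckeRep S) (psiStar ψ r) (w n r) = 1 := by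
  -- The lift sends the residue `0` to the integer `0`, so the block vanishes over `ℤ` and not only
  -- modulo `p`.
  have hS' : prL ℤ n r * lift S.1 * prL ℤ n r = 0 := by
    rw [prL_mul_mul_prL_eq_zero_iff] at hS ⊢
    intro i j hi hj
    simp [lift, hS i j hi hj]
  let u := unip (lift S.1) (lift_isSymm S.2)
  let η := w n r * u * (w n r)⁻¹
  have hη1 : η.1 = (w n r).1 * u.1 * ((w n r)⁻¹).1 := rfl
  have hη : η ∈ parabolic n := by
    rw [mem_parabolic, hη1, coe_inv_eq_fromBlocks, coe_w]
    simp only [u, unip, fromBlocks_multiply, toBlocks_fromBlocks₁₁, toBlocks_fromBlocks₁₂,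
      toBlocks_fromBlocks₂₁, toBlocks_fromBlocks₂₂, prL_transpose, prR_transpose, mul_one, mul_zero,
      add_zero, prL_mul_prR, mul_neg, add_mul, prR_mul_prL, hS', neg_zero]
  have hη2 : charDet ψ η.1.toBlocks₂₂ = 1 := by
    have e : η.1.toBlocks₂₂ = 1 + (prL ℤ n r * lift S.1) * prR ℤ n r := by
      rw [hη1, coe_inv_eq_fromBlocks, coe_w]
      simp only [u, unip, fromBlocks_multiply, toBlocks_fromBlocks₁₁, toBlocks_fromBlocks₁₂,
        toBlocks_fromBlocks₂₁, toBlocks_fromBlocks₂₂, prL_transpose, prR_transpose, mul_one,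
        mul_zero, add_zero, add_mul, prR_mul_prR, transpose_neg, neg_neg, prL_mul_prL]
      rw [add_comm (prL ℤ n r * lift S.1 * prR ℤ n r), ← add_assoc, prL_add_prR]
    rw [charDet, e, det_one_add_mul_comm, ← Matrix.mul_assoc, prR_mul_prL, zero_mul, add_zero,
      det_one]
    simp
  have hrel : HeckeRel (heckeRep S) (w n r) (w n r) (tauConj n p r * η.1) := by
    constructor
    · rw [toBlocks₂₁_mul', mem_parabolic.1 hη, tauConj, toBlocks_fromBlocks₂₁, zero_mul, mul_zero,
        add_zero]
    · change (w n r).1 * (tau n p * u.1) = _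
      rw [← Matrix.mul_assoc, w_mul_tau, hη1]
      simp only [Matrix.mul_assoc, coe_inv_mul_cancel, mul_one]
  have ht : signChar ψ (tauConj n p r) = 1 := by
    have hp : (0 : ℤ) < p := by exact_mod_cast (Fact.out : p.Prime).pos
    rw [signChar, det_tauConj_toBlocks₂₂ hr, Int.sign_eq_one_of_pos (pow_pos hp _)]
    simp
  rw [heckeT_eq hq (psiStar_leftEquivariant hq r) hrel, psiStar_w hq, signChar_mul_parabolic hη
    (by rw [tauConj, toBlocks_fromBlocks₂₁]), hη2, ht]
  norm_num

/-- The kernel of `I_r` lies in that of `D I_r`; equal ranks force equality of the kernels. -/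
lemma mul_eq_zero_of_rank_eq {K : Type*} [Field K] {D Y : Matrix (Fin n) (Fin n) K} (hr : r ≤ n)
    (hD : (D * prL K n r).rank = r) (h : D * prL K n r * Y = 0) : prL K n r * Y = 0 := by
  have hker : LinearMap.ker (prL K n r).mulVecLin = LinearMap.ker (D * prL K n r).mulVecLin := by
    refine Submodule.eq_of_le_of_finrank_eq ?_ ?_
    · intro x hx
      rw [LinearMap.mem_ker, mulVecLin_apply] at hx ⊢
      rw [← mulVec_mulVec, hx, mulVec_zero]
    · have h1 := (prL K n r).mulVecLin.finrank_range_add_finrank_ker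
      have h2 := (D * prL K n r).mulVecLin.finrank_range_add_finrank_ker
      change (prL K n r).rank + _ = _ at h1
      change (D * prL K n r).rank + _ = _ at h2
      rw [rank_prL K hr] at h1
      omega
  ext i j
  have h1 : Y.col j ∈ LinearMap.ker (D * prL K n r).mulVecLin := by
    rw [LinearMap.mem_ker, mulVecLin_apply]
    funext l
    exact congrFun (congrFun h l) j
  rw [← hker, LinearMap.mem_ker, mulVecLin_apply] at h1
  exact congrFun h1 i

/-- A relation `γ (1 S; 0 p) = b w_r` gives `C_γ ≡ D_b I_r` and `C_γ S ≡ D_b I'_r`, hence `D_b I_r S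
I_r ≡ 0`. If `γ` were in the cell of `w_r`, the rank of `D_b I_r` would be `r` and `I_r S I_r` would
vanish. -/
lemma heckeT_heckeRep_w_eq_zero (hq : IsSquareTrivial ψ) (S : SymMod n p)
    (hS : prL (ZMod p) n r * S.1 * prL (ZMod p) n r ≠ 0) (hr : r ≤ n) :
    heckeT ψ (heckeRep S) (psiStar ψ r) (w n r) = 0 := by
  by_cases h : ∃ γ b, HeckeRel (heckeRep S) γ (w n r) b
  · obtain ⟨γ, b, h⟩ := h
    rw [heckeT_eq hq (psiStar_leftEquivariant hq r) h, psiStar_eq_zero, mul_zero]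
    intro hc
    apply hS
    have h1 := congrArg (fun M => red p M.toBlocks₂₁) h.eq
    have h2 := congrArg (fun M => red p M.toBlocks₂₂) h.eq
    simp only [heckeRep_coe, toBlocks₂₁_mul', toBlocks₂₂_mul', h.zero, coe_w, toBlocks_fromBlocks₁₁,
      toBlocks_fromBlocks₁₂, toBlocks_fromBlocks₂₁, toBlocks_fromBlocks₂₂, zero_mul, zero_add,
      mul_zero, add_zero, mul_one, mul_smul_comm, red_add, red_smul_self, red_mul, red_prL, red_prR,
      red_lift] at h1 h2
    have h3 := rank_of_mem_cell hr hc
    rw [h1] at h3 h2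
    rw [Matrix.mul_assoc]
    refine mul_eq_zero_of_rank_eq hr h3 ?_
    rw [← Matrix.mul_assoc, h2, Matrix.mul_assoc, prR_mul_prL, mul_zero]
  · push Not at h
    exact heckeT_eq_zero h

lemma heckeSum_psiStar_w_self (hq : IsSquareTrivial ψ) (hr : r ≤ n) :
    heckeSum ψ (psiStar ψ r) (w n r) = (p : ℂ) ^ Fintype.card (FreeEntry n r) := by
  classical
  rw [heckeSum_eq_sum hq (psiStar_leftEquivariant hq r) (psiStar_rightEquivariant hq r)]
  have h1 : ∀ S : SymMod n p, heckeT ψ (heckeRep S) (psiStar ψ r) (w n r) =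
      if prL (ZMod p) n r * S.1 * prL (ZMod p) n r = 0 then 1 else 0 := fun S => by
    split_ifs with h
    · exact heckeT_heckeRep_w hq S h hr
    · exact heckeT_heckeRep_w_eq_zero hq S h hr
  simp only [h1]
  rw [Finset.sum_boole, ← Fintype.card_subtype, Fintype.card_congr (symModEquiv n p r),
    Fintype.card_fun, ZMod.card]
  push_cast
  rfl

lemma heckeSum_psiStar_w_of_lt (hq : IsSquareTrivial ψ) (hr : r ≤ n) {j : ℕ} (hj : j < r) :
    heckeSum ψ (psiStar ψ r) (w n j) = 0 := by
  rw [heckeSum]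
  refine Eq.trans (finsum_congr fun q => ?_) finsum_zero
  rw [heckeT_psiStar_eq_zero_of_lt hq hr hj, mul_zero]

end Counting

/-! ### U(p) on the Eisenstein series -/

section HeckeEisenstein

variable {n p : ℕ} {ψ : DirichletCharacter ℂ p} {k : ℤ}

lemma norm_psiStar_le (r : ℕ) (γ : SpZ n) : ‖psiStar ψ r γ‖ ≤ 1 := by
  rw [psiStar]
  split_ifs with h
  · rw [norm_mul]
    exact mul_le_one₀ (ψ.norm_le_one _) (norm_nonneg _) (ψ.norm_le_one _)
  · simp

lemma summable_mul_hFac {s : ℂ} (hs : (n : ℝ) + 1 < 2 * s.re) {φ : SpZ n → ℂ}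
    (hφ : ∀ γ, ‖φ γ‖ ≤ 1) (Z : UpperHalfSpace n) :
    Summable fun q : ParQuot n => φ q.out * hFac k s q.out.toGSpPos Z := by
  refine Summable.of_norm_bounded (summable_autFactor hs Z) fun q => ?_
  rw [norm_mul, norm_hFac]
  exact mul_le_of_le_one_left (Real.rpow_nonneg (norm_nonneg _) _) (hφ _)

lemma eisOf_sum {s : ℂ} (hs : (n : ℝ) + 1 < 2 * s.re) {ι : Type*} [Fintype ι] (c : ι → ℂ)
    {φ : ι → SpZ n → ℂ} (hφ : ∀ i γ, ‖φ i γ‖ ≤ 1) (Z : UpperHalfSpace n) :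
    eisOf k (fun γ => ∑ i, c i * φ i γ) Z s = ∑ i, c i * eisOf k (φ i) Z s := by
  simp only [eisOf, Finset.sum_mul, mul_assoc]
  rw [Summable.tsum_finsetSum fun i _ => (summable_mul_hFac hs (hφ i) Z).mul_left (c i),
    Finset.mul_sum]
  refine Finset.sum_congr rfl fun i _ => ?_
  rw [tsum_mul_left]
  ring

variable [Fact p.Prime]

/-- The coefficients of `U(p)` with respect to the Eisenstein series. -/
def heckeCoeff (n : ℕ) (ψ : DirichletCharacter ℂ p) (k : ℤ) (s : ℂ) (r j : ℕ) : ℂ :=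
  (p : ℂ) ^ ((n : ℂ) * k / 2 - (n : ℂ) * (n + 1) / 2) * (p : ℂ) ^ (s * (2 * r - n)) *
    heckeSum ψ (psiStar ψ r) (w n j)

lemma heckeCoeff_self (hq : IsSquareTrivial ψ) (s : ℂ) {r : ℕ} (hr : r ≤ n) :
    heckeCoeff n ψ k s r r = (p : ℂ) ^ ell n k s r := by
  have hp : (p : ℂ) ≠ 0 := by exact_mod_cast (Fact.out : p.Prime).ne_zero
  have h := congrArg (Nat.cast : ℕ → ℂ) (card_freeEntry hr)
  push_cast at h
  rw [heckeCoeff, heckeSum_psiStar_w_self hq hr, ← Complex.cpow_natCast, ← Complex.cpow_add _ _ hp,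
    ← Complex.cpow_add _ _ hp, ell]
  congr 1
  linear_combination h / 2

lemma heckeCoeff_of_lt (hq : IsSquareTrivial ψ) (s : ℂ) {r j : ℕ} (hr : r ≤ n) (hj : j < r) :
    heckeCoeff n ψ k s r j = 0 := by
  rw [heckeCoeff, heckeSum_psiStar_w_of_lt hq hr hj, mul_zero]

/-- The series of `heckeSum ψ (psiStar ψ r)` is expanded in two ways: over the left cosets, which
gives `U(p)`, and over the basis `psiStar ψ j`, which gives the right side. -/
lemma heckeU_eisenstein (hq : IsSquareTrivial ψ) (hk : ψ (-1) = (-1) ^ k) {s : ℂ}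
    (hs : (n : ℝ) + 1 < 2 * s.re) {r : ℕ} (hr : r ≤ n) (Z : UpperHalfSpace n) :
    heckeU ψ k (fun Z => eisenstein ψ k r Z s) Z =
      ∑ j : Fin (n + 1), heckeCoeff n ψ k s r j * eisenstein ψ k j Z s := by
  have := Fintype.ofFinite (Quotient (heckeSetoid n p))
  have hφ := psiStar_leftEquivariant (n := n) hq r
  have hφ' := psiStar_rightEquivariant (n := n) hq r
  simp only [eisenstein_eq_eisOf, heckeU]
  simp only [slash_eisOf_psiStar hq hk hr]
  have h1 : eisOf k (heckeSum ψ (psiStar ψ r)) Z s =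
      ∑ᶠ q : Quotient (heckeSetoid n p), charDet ψ q.out.1.toBlocks₁₁ *
        eisOf k (heckeT ψ q.out (psiStar ψ r)) Z s := by
    rw [finsum_eq_sum_of_fintype, ← eisOf_sum hs _
      fun q γ => norm_heckeT_le zero_le_one (norm_psiStar_le r) _ _]
    congr 1
    funext δ
    exact finsum_eq_sum_of_fintype _
  have h2 : eisOf k (heckeSum ψ (psiStar ψ r)) Z s =
      ∑ j : Fin (n + 1), heckeSum ψ (psiStar ψ r) (w n j) * eisOf k (psiStar ψ j) Z s := by
    rw [← eisOf_sum hs _ fun j γ => norm_psiStar_le _ _]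
    congr 1
    funext γ
    exact eq_sum_psiStar hq (hφ.heckeSum hq) (hφ'.heckeSum hq hφ) γ
  simp only [heckeCoeff, mul_assoc]
  rw [← Finset.mul_sum, ← Finset.mul_sum, ← h2, h1, mul_finsum _ ((p : ℂ) ^ (s * (2 * r - n)))]
  congr 1
  refine finsum_congr fun q => ?_
  ring

end HeckeEisenstein

open Filter Topology

/-! ### Limits at the cusps and linear independence -/

section Limit

variable {n p : ℕ}

/-- A sequence of points tending to `i ∞`. -/
def cuspPt (n N : ℕ) : UpperHalfSpace n := scalarPt n ((N : ℝ) + 1) (by positivity)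

/-- Put `W = (i t C + D)⁻¹ C`. The entries of `j W = adj(i t C + D) C` are polynomials in `t`, not
all zero since `C ≠ 0`, while `|W_ij| ≤ 1/t`. So `|j|` dominates `t` times a nonzero polynomial,
even if the leading terms of `j` itself degenerate. -/
lemma tendsto_norm_autFactor_cuspPt {γ : SpZ n} (hγ : γ ∉ parabolic n) :
    Tendsto (fun N => ‖autFactor γ.toGSpPos (cuspPt n N)‖) atTop atTop := by
  set C := toC (toR γ.1.toBlocks₂₁) with hC
  set D := toC (toR γ.1.toBlocks₂₂) with hD
  let M : Matrix (Fin n) (Fin n) (Polynomial ℂ) :=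
    (Polynomial.X * Polynomial.C Complex.I) • C.map Polynomial.C + D.map Polynomial.C
  have hM : ∀ t : ℂ, M.map (Polynomial.evalRingHom t) = (t * Complex.I) • C + D := by
    intro t
    ext i j
    simp only [M, map_apply, Matrix.add_apply, Matrix.smul_apply, smul_eq_mul,
      Polynomial.coe_evalRingHom, Polynomial.eval_add, Polynomial.eval_mul, Polynomial.eval_X,
      Polynomial.eval_C]
  let W : Matrix (Fin n) (Fin n) (Polynomial ℂ) := M.adjugate * C.map Polynomial.C
  have hW : ∀ t : ℂ, W.map (Polynomial.evalRingHom t) = ((t * Complex.I) • C + D).adjugate * C := by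
    intro t
    have h1 := RingHom.map_adjugate (Polynomial.evalRingHom t) M
    rw [Matrix.map_mul, ← hM t]
    congr 1
    ext i j
    simp
  have hden : ∀ N : ℕ, den γ.toGSpPos (cuspPt n N) =
      ((((N : ℝ) + 1 : ℝ) : ℂ) * Complex.I) • C + D := by
    intro N
    rw [den_toGSpPos, cuspPt, scalarPt, mul_smul_comm, mul_one]
  have hC0 : C ≠ 0 := by
    intro h0
    apply hγ
    rw [mem_parabolic]
    ext i j
    have := congrFun (congrFun h0 i) j
    simpa [hC] using this
  obtain ⟨i, j, hij⟩ : ∃ i j, W i j ≠ 0 := by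
    by_contra! h
    apply hC0
    have h1 : W = 0 := by ext1 i j; exact h i j
    have h2 := hW (((0 : ℕ) : ℝ) + 1 : ℝ)
    rw [← hden, h1] at h2
    have h3 : (0 : Matrix (Fin n) (Fin n) (Polynomial ℂ)).map
        (Polynomial.evalRingHom ((((0 : ℕ) : ℝ) + 1 : ℝ) : ℂ)) = 0 := by
      ext i j; simp
    rw [h3] at h2
    have h4 := congrArg (den γ.toGSpPos (cuspPt n 0) * ·) h2
    simp only [mul_zero] at h4
    rw [← Matrix.mul_assoc, mul_adjugate, smul_mul_assoc, one_mul] at h4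
    exact (smul_eq_zero.1 h4.symm).resolve_left (isUnit_det_den _ _).ne_zero
  have hdeg : 0 < (Polynomial.X * W i j).degree := by
    rw [Polynomial.degree_mul, Polynomial.degree_X, Polynomial.degree_eq_natDegree hij]
    exact_mod_cast Nat.succ_pos _ |>.trans_le (by omega : 0 + 1 ≤ 1 + (W i j).natDegree)
  have hz : Tendsto (fun N : ℕ => ‖(((N : ℝ) + 1 : ℝ) : ℂ)‖) atTop atTop := by
    have : (fun N : ℕ => ‖(((N : ℝ) + 1 : ℝ) : ℂ)‖) = fun N : ℕ => (N : ℝ) + 1 := by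
      funext N
      rw [Complex.norm_real, Real.norm_of_nonneg (by positivity)]
    rw [this]
    exact tendsto_atTop_add_const_right _ _ tendsto_natCast_atTop_atTop
  refine tendsto_atTop_mono (fun N => ?_) (Polynomial.tendsto_norm_atTop _ hdeg hz)
  set t : ℝ := (N : ℝ) + 1 with ht
  have ht0 : 0 < t := by positivity
  have h1 : Polynomial.eval (t : ℂ) (W i j) =
      autFactor γ.toGSpPos (cuspPt n N) * ((den γ.toGSpPos (cuspPt n N))⁻¹ * C) i j := by
    have h2 := congrFun (congrFun (hW (t : ℂ)) i) j
    rw [← hden] at h2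
    rw [autFactor_toGSpPos, ← smul_eq_mul, ← Matrix.smul_apply, ← smul_mul_assoc]
    have h3 : (den γ.toGSpPos (cuspPt n N)).det • (den γ.toGSpPos (cuspPt n N))⁻¹ =
        (den γ.toGSpPos (cuspPt n N)).adjugate := by
      rw [← one_mul (den γ.toGSpPos (cuspPt n N))⁻¹, ← smul_mul_assoc, ← adjugate_mul,
        Matrix.mul_assoc, mul_nonsing_inv _ (isUnit_det_den _ _), mul_one]
    rw [h3, ← h2]
    rfl
  have h2 := norm_den_inv_mul_le ht0 (imLowerBound_scalarPt t ht0) γ i j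
  rw [Polynomial.eval_mul, Polynomial.eval_X, h1, norm_mul, norm_mul, Complex.norm_real,
    Real.norm_of_nonneg ht0.le]
  calc _ ≤ t * (‖autFactor γ.toGSpPos (cuspPt n N)‖ * (1 / t)) := by
        gcongr
        exact h2
    _ = _ := by field_simp

lemma summable_autFactor_mul {σ : ℝ} (hσ : (n : ℝ) + 1 < 2 * σ) (δ : SpZ n)
    (Z : UpperHalfSpace n) :
    Summable fun q : ParQuot n => ‖autFactor (q.out * δ).toGSpPos Z‖ ^ (-2 * σ) := by
  refine ((summable_autFactor hσ (act δ.toGSpPos Z)).mul_right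
    (‖autFactor δ.toGSpPos Z‖ ^ (-2 * σ))).congr fun q => ?_
  rw [toGSpPos_mul, autFactor_gmul, norm_mul, Real.mul_rpow (norm_nonneg _) (norm_nonneg _)]

variable {ψ : DirichletCharacter ℂ p} {k : ℤ}

/-- The constant term of an Eisenstein series at a cusp. -/
lemma tendsto_slash_eisOf (hq : IsSquareTrivial ψ) (hk : ψ (-1) = (-1) ^ k) {s : ℂ}
    (hs : (n : ℝ) + 1 < 2 * s.re) {φ : SpZ n → ℂ} (hφ : LeftEquivariant ψ φ)
    (hφ1 : ∀ γ, ‖φ γ‖ ≤ 1) (δ : SpZ n) :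
    Tendsto (fun N => ∑' q : ParQuot n,
      φ q.out * hFac k s (gmul q.out.toGSpPos δ.toGSpPos) (cuspPt n N)) atTop (𝓝 (φ δ⁻¹)) := by
  have hs0 : 0 < s.re := by
    have : (0 : ℝ) ≤ n := Nat.cast_nonneg _
    linarith
  set q₀ : ParQuot n := Quotient.mk _ δ⁻¹ with hq₀
  classical
  -- Only the orbit of `δ⁻¹` survives: its term is constant in `N`, and every other term tends to
  -- `0` under a bound uniform in `N`.
  have hsum : ∑' q : ParQuot n, (if q = q₀ then φ δ⁻¹ else 0) = φ δ⁻¹ := tsum_ite_eq _ _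
  rw [← hsum]
  set K : ℝ := Nat.factorial n * 2 ^ n with hK
  have hK0 : 0 < K := by positivity
  refine tendsto_tsum_of_dominated_convergence
    ((summable_autFactor_mul hs δ (iPt n)).mul_left (K ^ (2 * s.re))) (fun q => ?_)
    (Eventually.of_forall fun N q => ?_)
  · simp only [← toGSpPos_mul]
    by_cases hP : q.out * δ ∈ parabolic n
    · have hqq : q = q₀ := by
        rw [← q.out_eq, hq₀]
        refine Quotient.sound ?_
        change QuotientGroup.rightRel (parabolic n) _ _
        rw [QuotientGroup.rightRel_apply]
        have := inv_mem hP
        rwa [_root_.mul_inv_rev] at this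
      rw [if_pos hqq]
      have h1 : q.out = q.out * δ * δ⁻¹ := by group
      have h2 : ∀ N, φ q.out * hFac k s (q.out * δ).toGSpPos (cuspPt n N) = φ δ⁻¹ := fun N => by
        rw [hFac_parabolic hk s hP]
        conv_lhs => rw [h1, hφ _ hP]
        rw [← h1]
        linear_combination φ δ⁻¹ * hq.parabolic_mul_self hP
      simp only [h2]
      exact tendsto_const_nhds
    · have hqq : q ≠ q₀ := by
        intro h
        apply hP
        obtain ⟨η, hη, e⟩ := exists_out_eq δ⁻¹
        rw [h, hq₀, e, inv_mul_cancel_right]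
        exact hη
      rw [if_neg hqq]
      refine squeeze_zero_norm (a := fun N =>
        ‖autFactor (q.out * δ).toGSpPos (cuspPt n N)‖ ^ (-2 * s.re)) (fun N => ?_) ?_
      · rw [norm_mul, norm_hFac]
        exact mul_le_of_le_one_left (Real.rpow_nonneg (norm_nonneg _) _) (hφ1 _)
      · have := (tendsto_rpow_neg_atTop (show 0 < 2 * s.re by linarith)).comp
          (tendsto_norm_autFactor_cuspPt hP)
        simpa only [Function.comp_def, neg_mul] using this
  · rw [norm_mul, norm_hFac, ← toGSpPos_mul]
    refine (mul_le_of_le_one_left (Real.rpow_nonneg (norm_nonneg _) _) (hφ1 _)).trans ?_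
    have h1 := norm_autFactor_scalarPt_le (n := n) ((N : ℝ) + 1) (by simp) (q.out * δ)
    have p1 : 0 < ‖autFactor (q.out * δ).toGSpPos (iPt n)‖ :=
      norm_pos_iff.2 (autFactor_ne_zero _ _)
    have p2 : 0 < ‖autFactor (q.out * δ).toGSpPos (cuspPt n N)‖ :=
      norm_pos_iff.2 (autFactor_ne_zero _ _)
    have h2 := Real.rpow_le_rpow_of_nonpos p1 h1 (show -2 * s.re ≤ 0 by linarith)
    change (K * ‖autFactor (q.out * δ).toGSpPos (cuspPt n N)‖) ^ (-2 * s.re) ≤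
      ‖autFactor (q.out * δ).toGSpPos (iPt n)‖ ^ (-2 * s.re) at h2
    rw [Real.mul_rpow hK0.le p2.le] at h2
    have h3 : K ^ (2 * s.re) * K ^ (-2 * s.re) = 1 := by
      rw [← Real.rpow_add hK0, show 2 * s.re + -2 * s.re = 0 by ring, Real.rpow_zero]
    calc ‖autFactor (q.out * δ).toGSpPos (cuspPt n N)‖ ^ (-2 * s.re)
        = K ^ (2 * s.re) *
          (K ^ (-2 * s.re) * ‖autFactor (q.out * δ).toGSpPos (cuspPt n N)‖ ^ (-2 * s.re)) := by
          rw [← mul_assoc, h3, one_mul]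
      _ ≤ _ := mul_le_mul_of_nonneg_left h2 (Real.rpow_nonneg hK0.le _)

variable [Fact p.Prime]

/-- `w_j⁻¹` is `w_j` multiplied on the left by the Levi element of `I'_j - I_j`, so it lies in the
same cell. -/
lemma psiStar_w_inv (hq : IsSquareTrivial ψ) {r j : ℕ} (hr : r ≤ n) (hj : j ≤ n) :
    (r = j → psiStar ψ r (w n j)⁻¹ ≠ 0) ∧ (r ≠ j → psiStar ψ r (w n j)⁻¹ = 0) := by
  let U : Matrix (Fin n) (Fin n) ℤ := prR ℤ n j - prL ℤ n j
  have hU : U * U = 1 := by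
    simp only [U, sub_mul, mul_sub, prL_mul_prL, prR_mul_prR, prL_mul_prR, prR_mul_prL]
    rw [sub_zero, zero_sub, sub_neg_eq_add, add_comm, prL_add_prR]
  have hUT : Uᵀ = U := by simp [U]
  have e : (w n j)⁻¹ = levi U U hU * w n j := by
    apply Subtype.ext
    rw [coe_inv_eq_fromBlocks, Submonoid.coe_mul, coe_w, levi, fromBlocks_multiply]
    simp only [toBlocks_fromBlocks₁₁, toBlocks_fromBlocks₁₂, toBlocks_fromBlocks₂₁,
      toBlocks_fromBlocks₂₂, hUT, zero_mul, add_zero, zero_add, prL_transpose, prR_transpose,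
      transpose_neg, neg_neg, mul_neg]
    simp only [U, sub_mul, prL_mul_prL, prR_mul_prR, prL_mul_prR, prR_mul_prL, sub_zero, zero_sub,
      neg_neg, neg_zero, zero_add]
  have hl := levi_mem U U hU
  rw [e, psiStar_parabolic_mul hq hl]
  constructor
  · rintro rfl h0
    rw [psiStar_w hq, mul_one] at h0
    have := hq.parabolic_mul_self hl
    rw [h0, zero_mul] at this
    exact zero_ne_one this
  · intro h
    rw [psiStar_w_of_ne hr hj h, mul_zero]

/-- The Eisenstein series are linearly independent in the half plane of convergence. -/
lemma linearIndependent_eisenstein (hq : IsSquareTrivial ψ) (hk : ψ (-1) = (-1) ^ k) {s : ℂ}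
    (hs : (n : ℝ) + 1 < 2 * s.re) :
    LinearIndependent ℂ fun (r : Fin (n + 1)) (Z : UpperHalfSpace n) => eisenstein ψ k r Z s := by
  rw [Fintype.linearIndependent_iff]
  intro c hc j
  have h0 : ∀ Z, ∑ r, c r * eisOf k (psiStar ψ r) Z s = 0 := fun Z => by
    have := congrFun hc Z
    simpa only [Finset.sum_apply, Pi.smul_apply, smul_eq_mul, eisenstein_eq_eisOf, Pi.zero_apply]
      using this
  -- The relation is slashed by `w_j` and stripped of the nonzero power of `det Y`; its limit at `i
  -- ∞` isolates the coefficient of index `j`.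
  have h1 : ∀ N, ∑ r : Fin (n + 1), c r * ∑' q : ParQuot n, psiStar ψ r q.out *
      hFac k s (gmul q.out.toGSpPos (w n j).toGSpPos) (cuspPt n N) = 0 := fun N => by
    have h2 : ∀ r : Fin (n + 1), autFactor (w n j).toGSpPos (cuspPt n N) ^ (-k) *
        eisOf k (psiStar ψ r) (act (w n j).toGSpPos (cuspPt n N)) s = _ :=
      fun r => slash_eisOf k (psiStar ψ r) s (w n j).toGSpPos (cuspPt n N)
    have h3 := congrArg (autFactor (w n j).toGSpPos (cuspPt n N) ^ (-k) * ·)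
      (h0 (act (w n j).toGSpPos (cuspPt n N)))
    simp only [mul_zero, Finset.mul_sum, mul_left_comm _ (c _), h2] at h3
    simp only [mul_left_comm (c _), ← Finset.mul_sum] at h3
    refine (mul_eq_zero.1 h3).resolve_left ?_
    rw [← ne_eq, Complex.cpow_ne_zero_iff]
    left
    exact_mod_cast (det_im_pos _).ne'
  have h2 : Tendsto (fun N => ∑ r : Fin (n + 1), c r * ∑' q : ParQuot n, psiStar ψ r q.out *
      hFac k s (gmul q.out.toGSpPos (w n j).toGSpPos) (cuspPt n N)) atTop
      (𝓝 (∑ r : Fin (n + 1), c r * psiStar ψ r (w n j)⁻¹)) :=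
    tendsto_finsetSum _ fun r _ => (tendsto_slash_eisOf hq hk hs
      (psiStar_leftEquivariant hq r) (norm_psiStar_le r) _).const_mul _
  simp only [h1] at h2
  have h3 := tendsto_nhds_unique h2 tendsto_const_nhds
  rw [Finset.sum_eq_single j] at h3
  · exact (mul_eq_zero.1 h3).resolve_right
      ((psiStar_w_inv hq (by omega) (by omega)).1 rfl)
  · intro r _ hr
    rw [(psiStar_w_inv hq (by omega) (by omega)).2 fun h => hr (Fin.ext h), mul_zero]
  · simp

omit [Fact p.Prime] in
lemma continuousAt_eisenstein (r : ℕ) (Z : UpperHalfSpace n) {s : ℂ}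
    (hs : (n : ℝ) + 1 < 2 * s.re) : ContinuousAt (fun s => eisenstein ψ k r Z s) s := by
  simp only [eisenstein_eq_eisOf, eisOf]
  have hY : (((im Z).det : ℝ) : ℂ) ≠ 0 := by exact_mod_cast (det_im_pos Z).ne'
  refine ContinuousAt.mul ?_ ?_
  · exact (continuousAt_const_cpow hY).comp (by fun_prop)
  obtain ⟨σ₀, h0, h1⟩ := exists_between (show ((n : ℝ) + 1) / 2 < s.re by linarith)
  set σ₁ := s.re + 1
  have hopen : IsOpen {z : ℂ | σ₀ < z.re ∧ z.re < σ₁} :=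
    (isOpen_lt continuous_const Complex.continuous_re).inter
      (isOpen_lt Complex.continuous_re continuous_const)
  refine ContinuousOn.continuousAt (s := {z : ℂ | σ₀ < z.re ∧ z.re < σ₁}) ?_
    (hopen.mem_nhds ⟨h1, by simp [σ₁]⟩)
  have hσ₀ : (n : ℝ) + 1 < 2 * σ₀ := by linarith
  have hσ₁ : (n : ℝ) + 1 < 2 * σ₁ := by simp only [σ₁]; linarith
  -- On the strip `σ₀ < Re z < σ₁` each term is bounded by the sum of its two boundary majorants,
  -- according to whether `|j|` is at least or at most `1`.
  refine continuousOn_tsum (fun q => ?_) ((summable_autFactor hσ₀ Z).add (summable_autFactor hσ₁ Z))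
    fun q z hz => ?_
  · refine Continuous.continuousOn ?_
    unfold hFac
    have hx : ((‖autFactor q.out.toGSpPos Z‖ : ℝ) : ℂ) ≠ 0 := by
      exact_mod_cast (norm_pos_iff.2 (autFactor_ne_zero _ _)).ne'
    refine continuous_const.mul (continuous_const.mul ?_)
    exact Continuous.const_cpow (by fun_prop) (Or.inl hx)
  · have hx : 0 < ‖autFactor q.out.toGSpPos Z‖ := norm_pos_iff.2 (autFactor_ne_zero _ _)
    rw [norm_mul, norm_hFac]
    refine (mul_le_of_le_one_left (Real.rpow_nonneg (norm_nonneg _) _) (norm_psiStar_le _ _)).trans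
      ?_
    rcases le_total 1 ‖autFactor q.out.toGSpPos Z‖ with h | h
    · refine (Real.rpow_le_rpow_of_exponent_le h (show -2 * z.re ≤ -2 * σ₀ by linarith [hz.1])).trans
        ?_
      exact le_add_of_nonneg_right (Real.rpow_nonneg hx.le _)
    · refine (Real.rpow_le_rpow_of_exponent_ge hx h
        (show -2 * σ₁ ≤ -2 * z.re by linarith [hz.2])).trans ?_
      exact le_add_of_nonneg_left (Real.rpow_nonneg hx.le _)

end Limit

/-! ### Eigenvalues of a triangular action -/

section Triangular

variable {V : Type*} [AddCommGroup V] [Module ℂ V] {m : ℕ} {U : V →ₗ[ℂ] V} {E : Fin m → V}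
  {a : Matrix (Fin m) (Fin m) ℂ}

lemma map_mem_span_of_eq_sum (hU : ∀ r, U (E r) = ∑ j, a r j • E j) {f : V}
    (hf : f ∈ Submodule.span ℂ (Set.range E)) : U f ∈ Submodule.span ℂ (Set.range E) := by
  induction hf using Submodule.span_induction with
  | mem x hx =>
    obtain ⟨r, rfl⟩ := hx
    rw [hU]
    exact Submodule.sum_mem _ fun j _ => Submodule.smul_mem _ _ (Submodule.subset_span ⟨j, rfl⟩)
  | zero => rw [map_zero]; exact zero_mem _
  | add x y _ _ hx hy => rw [map_add]; exact add_mem hx hy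
  | smul c x _ hx => rw [map_smul]; exact Submodule.smul_mem _ _ hx

/-- Let `W l` be the span of the `E r` with `r ≥ l`. The operator `U - a r r` maps `W r` into `W (r
+ 1)`, so an eigenvector whose eigenvalue avoids the diagonal descends to `W m = 0`. Independence of
the `E r` plays no role. -/
lemma exists_diag_of_eigenvector (hU : ∀ r, U (E r) = ∑ j, a r j • E j)
    (ha : ∀ r j, j < r → a r j = 0) {f : V} (hf : f ∈ Submodule.span ℂ (Set.range E)) (hf0 : f ≠ 0)
    {c : ℂ} (hc : U f = c • f) : ∃ r, c = a r r := by
  by_contra! hne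
  let W : ℕ → Submodule ℂ V := fun l => Submodule.span ℂ (E '' {r | l ≤ r.1})
  have hstep : ∀ (r : Fin m) (x : V), x ∈ W r.1 → U x - a r r • x ∈ W (r.1 + 1) := by
    intro r x hx
    induction hx using Submodule.span_induction with
    | mem x hx =>
      obtain ⟨i, hi, rfl⟩ := hx
      have hi : r.1 ≤ i.1 := hi
      have hmem : ∀ j : Fin m, r < j → E j ∈ W (r.1 + 1) := fun j hj =>
        Submodule.subset_span ⟨j, hj, rfl⟩
      rcases eq_or_lt_of_le (show r ≤ i from hi) with rfl | hlt
      · rw [hU, ← Finset.add_sum_erase _ _ (Finset.mem_univ r), add_sub_cancel_left]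
        refine Submodule.sum_mem _ fun j hj => ?_
        rcases lt_trichotomy j r with h | h | h
        · rw [ha r j h, zero_smul]; exact zero_mem _
        · exact absurd h (Finset.ne_of_mem_erase hj)
        · exact Submodule.smul_mem _ _ (hmem j h)
      · refine Submodule.sub_mem _ ?_ (Submodule.smul_mem _ _ (hmem i hlt))
        rw [hU]
        refine Submodule.sum_mem _ fun j _ => ?_
        rcases lt_or_ge j i with h | h
        · rw [ha i j h, zero_smul]; exact zero_mem _
        · exact Submodule.smul_mem _ _ (hmem j (hlt.trans_le h))
    | zero => rw [map_zero, smul_zero, sub_zero]; exact zero_mem _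
    | add x y _ _ hx hy =>
      have := add_mem hx hy
      rw [map_add, smul_add, add_sub_add_comm]
      exact this
    | smul d x _ hx =>
      have := Submodule.smul_mem _ d hx
      rwa [map_smul, smul_comm, ← smul_sub]
  have hmem : ∀ l ≤ m, f ∈ W l := by
    intro l
    induction l with
    | zero =>
      intro _
      have : {r : Fin m | 0 ≤ r.1} = Set.univ := by ext; simp
      simpa only [W, this, Set.image_univ] using hf
    | succ l ih =>
      intro hl
      have h1 := hstep ⟨l, hl⟩ f (ih (by omega))
      rw [hc, ← sub_smul] at h1
      have h2 := Submodule.smul_mem _ (c - a ⟨l, hl⟩ ⟨l, hl⟩)⁻¹ h1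
      rwa [smul_smul, inv_mul_cancel₀ (sub_ne_zero.2 (hne _)), one_smul] at h2
  have h1 := hmem m le_rfl
  have h2 : {r : Fin m | m ≤ r.1} = ∅ := by
    ext r
    simp
  simp only [W, h2, Set.image_empty, Submodule.span_empty, Submodule.mem_bot] at h1
  exact hf0 h1

/-- A left null vector of `a - a r r` gives the coefficients of the eigenvector; independence
ensures that it is nonzero. -/
lemma exists_eigenvector_of_diag (hU : ∀ r, U (E r) = ∑ j, a r j • E j)
    (ha : ∀ r j, j < r → a r j = 0) (hE : LinearIndependent ℂ E) (r : Fin m) :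
    ∃ f ∈ Submodule.span ℂ (Set.range E), f ≠ 0 ∧ U f = a r r • f := by
  have htri : (a - a r r • 1).BlockTriangular id := by
    intro i j hij
    have hij : j < i := hij
    rw [Matrix.sub_apply, Matrix.smul_apply, ha i j hij, one_apply_ne hij.ne', smul_zero, sub_zero]
  have hdet : (a - a r r • 1).det = 0 := by
    rw [det_of_isUpperTriangular htri]
    refine Finset.prod_eq_zero (Finset.mem_univ r) ?_
    rw [Matrix.sub_apply, Matrix.smul_apply, one_apply_eq, smul_eq_mul, mul_one, sub_self]
  obtain ⟨v, hv0, hv⟩ := exists_vecMul_eq_zero_iff.2 hdet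
  refine ⟨∑ i, v i • E i, Submodule.sum_mem _ fun i _ => Submodule.smul_mem _ _
    (Submodule.subset_span ⟨i, rfl⟩), ?_, ?_⟩
  · intro h
    exact hv0 (funext (Fintype.linearIndependent_iff.1 hE v h))
  · have h1 : v ᵥ* a = a r r • v := by
      rw [vecMul_sub, vecMul_smul, vecMul_one, sub_eq_zero] at hv
      exact hv
    rw [map_sum, Finset.smul_sum]
    simp only [map_smul, hU, Finset.smul_sum, smul_smul]
    rw [Finset.sum_comm]
    refine Finset.sum_congr rfl fun j _ => ?_
    rw [← Finset.sum_smul]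
    congr 1
    exact congrFun h1 j

end Triangular

/-! ### Linear independence tested at finitely many points -/

section Points

/-- Linearly independent functions are independent on a finite set of points. -/
lemma exists_det_ne_zero {X : Type*} : ∀ {m : ℕ} {f : Fin m → X → ℂ}, LinearIndependent ℂ f →
    ∃ x : Fin m → X, (of fun i j => f j (x i)).det ≠ 0
  | 0, _, _ => ⟨Fin.elim0, by simp⟩
  | m + 1, f, hf => by
    obtain ⟨x, hx⟩ := exists_det_ne_zero (hf.comp Fin.succ (Fin.succ_injective m))
    by_contra! h
    -- If all determinants vanish, the Laplace expansion along the row of a variable point is a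
    -- linear relation between the functions; its coefficient of index `0` is the nonzero minor from
    -- the induction hypothesis.
    let c : Fin (m + 1) → ℂ := fun j =>
      (-1) ^ (j : ℕ) * (of fun i l => f (j.succAbove l) (x i)).det
    have hc : ∑ j, c j • f j = 0 := by
      funext y
      have h1 := h (Fin.cons y x)
      rw [det_succ_row_zero] at h1
      simp only [Finset.sum_apply, Pi.smul_apply, smul_eq_mul, Pi.zero_apply]
      rw [← h1]
      refine Finset.sum_congr rfl fun j _ => ?_
      simp only [c, of_apply, Fin.cons_zero]
      rw [mul_right_comm]
      congr 2
    have h0 := Fintype.linearIndependent_iff.1 hf c hc 0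
    simp only [c, Fin.val_zero, pow_zero, one_mul] at h0
    exact hx h0

lemma linearIndependent_of_det_ne_zero {X : Type*} {m : ℕ} {f : Fin m → X → ℂ} {x : Fin m → X}
    (h : (of fun i j => f j (x i)).det ≠ 0) : LinearIndependent ℂ f := by
  rw [Fintype.linearIndependent_iff]
  intro c hc
  refine congrFun (eq_zero_of_mulVec_eq_zero h ?_)
  funext i
  have := congrFun hc (x i)
  simp only [Finset.sum_apply, Pi.smul_apply, smul_eq_mul, Pi.zero_apply] at this
  change ∑ j, f j (x i) * c j = 0
  rw [← this]
  exact Finset.sum_congr rfl fun j _ => mul_comm _ _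

end Points

/-! ### The eigenvalue set of U(p) -/

section Operator

variable {n p : ℕ}

lemma eigenSet_half (n : ℕ) (k : ℤ) : eigenSet n p k ((k : ℂ) / 2) = holEigenSet n p k := by
  have h : ∀ j : ℕ, ell n k ((k : ℂ) / 2) j = (k : ℂ) * j - (j : ℂ) * (j + 1) / 2 := fun j => by
    rw [ell]; ring
  simp only [eigenSet, holEigenSet, h]

variable [Fact p.Prime]

/-- `U(p)` as a linear map. -/
def heckeULin (n : ℕ) (ψ : DirichletCharacter ℂ p) (k : ℤ) :
    (UpperHalfSpace n → ℂ) →ₗ[ℂ] (UpperHalfSpace n → ℂ) where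
  toFun := heckeU ψ k
  map_add' f g := by
    funext Z
    simp only [heckeU, slash, Pi.add_apply, mul_add]
    rw [finsum_add_distrib (Set.toFinite _) (Set.toFinite _), mul_add]
  map_smul' c f := by
    funext Z
    simp only [heckeU, slash, Pi.smul_apply, smul_eq_mul, RingHom.id_apply]
    rw [mul_left_comm c, mul_finsum _ c]
    congr 1
    exact finsum_congr fun q => by ring

variable {ψ : DirichletCharacter ℂ p} {k : ℤ}

/-- The functions `E_0, …, E_n` are transformed by `U(p)` like Eisenstein series. -/
def HeckeAction (ψ : DirichletCharacter ℂ p) (k : ℤ) (s : ℂ)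
    (E : Fin (n + 1) → UpperHalfSpace n → ℂ) : Prop :=
  ∀ r Z, heckeU ψ k (E r) Z = ∑ j : Fin (n + 1), heckeCoeff n ψ k s r j * E j Z

variable {s : ℂ} {E : Fin (n + 1) → UpperHalfSpace n → ℂ}

lemma HeckeAction.eq_sum (h : HeckeAction ψ k s E) (r : Fin (n + 1)) :
    heckeULin n ψ k (E r) =
      ∑ j, (of fun r j : Fin (n + 1) => heckeCoeff n ψ k s r j) r j • E j := by
  funext Z
  simp only [Finset.sum_apply, Pi.smul_apply, smul_eq_mul, of_apply]
  exact h r Z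

lemma HeckeAction.stable (h : HeckeAction ψ k s E) :
    ∀ f ∈ spanOf E, heckeU ψ k f ∈ spanOf E := fun _ hf =>
  map_mem_span_of_eq_sum (U := heckeULin n ψ k) h.eq_sum hf

lemma HeckeAction.subset (hq : IsSquareTrivial ψ) (h : HeckeAction ψ k s E) :
    {c | IsEigenvalue (heckeU ψ k) (spanOf E) c} ⊆ eigenSet n p k s := by
  rintro c ⟨f, hf, hf0, hc⟩
  obtain ⟨r, hr⟩ := exists_diag_of_eigenvector (U := heckeULin n ψ k) h.eq_sum
    (fun r j hj => heckeCoeff_of_lt hq s (by omega) hj) hf hf0 hc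
  exact ⟨r, by omega, hr.trans (heckeCoeff_self hq s (by omega))⟩

lemma HeckeAction.eigenvaluesAre (hq : IsSquareTrivial ψ) (h : HeckeAction ψ k s E)
    (hE : LinearIndependent ℂ E) :
    EigenvaluesAre (heckeU ψ k) (spanOf E) (eigenSet n p k s) := by
  refine ⟨h.stable, (h.subset hq).antisymm ?_⟩
  rintro c ⟨j, hj, rfl⟩
  obtain ⟨f, hf, hf0, hc⟩ := exists_eigenvector_of_diag (U := heckeULin n ψ k) h.eq_sum
    (fun r j hj => heckeCoeff_of_lt hq s (by omega) hj) hE ⟨j, by omega⟩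
  refine ⟨f, hf, hf0, ?_⟩
  rw [← heckeCoeff_self hq s hj]
  exact hc

lemma heckeAction_eisenstein (hq : IsSquareTrivial ψ) (hk : ψ (-1) = (-1) ^ k)
    (hs : (n : ℝ) + 1 < 2 * s.re) :
    HeckeAction ψ k s fun (r : Fin (n + 1)) (Z : UpperHalfSpace n) => eisenstein ψ k r Z s :=
  fun r Z => heckeU_eisenstein hq hk hs (by omega) Z

end Operator

/-! ### Meromorphic continuation -/

section Continuation

/-- Infinite order at one point propagates over the connected plane. Analyticity at `s` is needed
since a meromorphic function may have an arbitrary value at an isolated point. -/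
lemma eq_zero_of_meromorphic {G : ℂ → ℂ} (hG : Meromorphic G) {s₀ s : ℂ}
    (h₀ : ∀ᶠ z in 𝓝 s₀, G z = 0) (hs : AnalyticAt ℂ G s) : G s = 0 := by
  have h1 : ¬ ∀ u, meromorphicOrderAt G u ≠ ⊤ := fun h =>
    h s₀ (meromorphicOrderAt_eq_top_iff.2 (h₀.filter_mono nhdsWithin_le_nhds))
  rw [← hG.exists_meromorphicOrderAt_ne_top_iff_forall] at h1
  push Not at h1
  have h2 := meromorphicOrderAt_eq_top_iff.1 (h1 s)
  exact tendsto_nhds_unique (hs.continuousAt.tendsto.mono_left nhdsWithin_le_nhds)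
    (tendsto_const_nhds.congr' (h2.mono fun z hz => hz.symm))

lemma eventually_ne_zero_of_meromorphic {G : ℂ → ℂ} (hG : Meromorphic G) {s₀ : ℂ}
    (h₀ : ∀ᶠ z in 𝓝 s₀, G z ≠ 0) : ∀ᶠ z in codiscrete ℂ, G z ≠ 0 := by
  have h1 : ∃ u, meromorphicOrderAt G u ≠ ⊤ :=
    ⟨s₀, (meromorphicOrderAt_ne_top_iff_eventually_ne_zero (hG s₀)).2
      (h₀.filter_mono nhdsWithin_le_nhds)⟩
  rw [hG.exists_meromorphicOrderAt_ne_top_iff_forall] at h1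
  exact MeromorphicOn.eventually_codiscreteWithin_apply_ne_zero (meromorphicOn_univ.2 hG)
    fun x _ => h1 x

variable {n p : ℕ}

/-- A point of the half plane of convergence. -/
lemma eventually_halfPlane (n : ℕ) :
    ∀ᶠ s : ℂ in 𝓝 ((n : ℂ) + 1), (n : ℝ) + 1 < 2 * s.re := by
  refine (isOpen_lt continuous_const
    (by fun_prop : Continuous fun s : ℂ => 2 * s.re)).eventually_mem ?_
  have : (0 : ℝ) ≤ n := Nat.cast_nonneg _
  simp only [Set.mem_ofPred_eq, Complex.add_re, Complex.natCast_re, Complex.one_re]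
  linarith

variable [Fact p.Prime] {ψ : DirichletCharacter ℂ p} {k : ℤ}
  {F : Fin (n + 1) → UpperHalfSpace n → ℂ → ℂ}

lemma eventually_linearIndependent (hq : IsSquareTrivial ψ) (hk : ψ (-1) = (-1) ^ k)
    (hF : ∀ r : Fin (n + 1), IsMeromorphicContinuation ψ k r (F r)) :
    ∀ᶠ s in codiscrete ℂ, LinearIndependent ℂ (fun r Z => F r Z s) := by
  have hs₀ := (eventually_halfPlane n).self_of_nhds
  obtain ⟨Z, hZ⟩ := exists_det_ne_zero (linearIndependent_eisenstein (n := n) hq hk hs₀)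
  -- The points `Z i` are chosen for the single parameter `n + 1`, where the series converge.
  -- Continuity of the series keeps the determinant nonzero nearby, and meromorphy keeps it nonzero
  -- off a discrete set.
  let G : ℂ → ℂ := fun s => (of fun i j : Fin (n + 1) => F j (Z i) s).det
  have hG : Meromorphic G := by
    intro s
    simp only [G, det_apply, of_apply]
    refine MeromorphicAt.fun_sum fun σ _ => MeromorphicAt.const_smul ?_ _
    exact MeromorphicAt.fun_prod fun i _ => (hF i (Z (σ i))).1 s
  have hcont : ContinuousAt (fun s => (of fun i j : Fin (n + 1) =>
      eisenstein ψ k j (Z i) s).det) ((n : ℂ) + 1) := by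
    simp only [det_apply, of_apply]
    refine tendsto_finsetSum _ fun σ _ => Tendsto.const_smul ?_ _
    exact tendsto_finsetProd _ fun i _ => continuousAt_eisenstein i (Z (σ i)) hs₀
  have hne : ∀ᶠ s in 𝓝 ((n : ℂ) + 1), G s ≠ 0 := by
    filter_upwards [hcont.eventually_ne hZ, eventually_halfPlane n] with s h1 h2
    simp only [G]
    simp only [(hF _ _).2 s h2]
    exact h1
  filter_upwards [eventually_ne_zero_of_meromorphic hG hne] with s hs
  exact linearIndependent_of_det_ne_zero hs

lemma analytic_heckeCoeff (n : ℕ) (ψ : DirichletCharacter ℂ p) (k : ℤ) (r j : ℕ) (s : ℂ) :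
    AnalyticAt ℂ (fun s => heckeCoeff n ψ k s r j) s := by
  have hp : (p : ℂ) ≠ 0 := by exact_mod_cast (Fact.out : p.Prime).ne_zero
  refine Differentiable.analyticAt ?_ s
  unfold heckeCoeff
  refine ((differentiable_const _).mul ?_).mul_const _
  exact Differentiable.const_cpow (by fun_prop) (Or.inl hp)

lemma heckeAction_continuation (hq : IsSquareTrivial ψ) (hk : ψ (-1) = (-1) ^ k)
    (hF : ∀ r : Fin (n + 1), IsMeromorphicContinuation ψ k r (F r)) {s : ℂ}
    (hs : ∀ r Z, AnalyticAt ℂ (F r Z) s) : HeckeAction ψ k s fun r Z => F r Z s := by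
  intro r Z
  have := Fintype.ofFinite (Quotient (heckeSetoid n p))
  -- The difference of the two sides, as a function of the parameter: it vanishes on the half plane
  -- of convergence, and `U(p)` is a finite sum, so meromorphy and analyticity are inherited from
  -- the `F r`.
  let G : ℂ → ℂ := fun s => heckeU ψ k (fun Z => F r Z s) Z -
    ∑ j : Fin (n + 1), heckeCoeff n ψ k s r j * F j Z s
  have hG : Meromorphic G := by
    intro z
    simp only [G, heckeU, finsum_eq_sum_of_fintype, slash]
    refine MeromorphicAt.fun_sub ((MeromorphicAt.const _ _).fun_mul (MeromorphicAt.fun_sum fun q _ =>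
      (MeromorphicAt.const _ _).fun_mul ((MeromorphicAt.const _ _).fun_mul ((hF r _).1 z))))
      (MeromorphicAt.fun_sum fun j _ =>
        (analytic_heckeCoeff n ψ k r j z).meromorphicAt.fun_mul ((hF j Z).1 z))
  have hGs : AnalyticAt ℂ G s := by
    simp only [G, heckeU, finsum_eq_sum_of_fintype, slash]
    refine AnalyticAt.fun_sub (analyticAt_const.fun_mul (Finset.analyticAt_fun_sum _ fun q _ =>
      analyticAt_const.fun_mul (analyticAt_const.fun_mul (hs r _))))
      (Finset.analyticAt_fun_sum _ fun j _ => (analytic_heckeCoeff n ψ k r j s).fun_mul (hs j Z))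
  refine sub_eq_zero.1 (eq_zero_of_meromorphic hG (s₀ := (n : ℂ) + 1) ?_ hGs)
  filter_upwards [eventually_halfPlane n] with z hz
  have h1 := heckeU_eisenstein (n := n) (r := r) hq hk hz (by omega) Z
  simp only [G, (hF _ _).2 z hz]
  rw [h1, sub_self]

end Continuation

end SiegelEisenstein

end

theorem mainTheorem7 (n : ℕ) (hn : 1 ≤ n) (p : ℕ) [Fact p.Prime] (hp : p ≠ 2)
    (ψ : DirichletCharacter ℂ p) (hψ : ψ = 1 ∨ ψ = chiQuad p)
    (k : ℤ) (hk : ψ (-1) = (-1) ^ k) :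
    -- the series themselves, in the half-plane of convergence
    (∀ s : ℂ, (n : ℝ) + 1 < 2 * s.re →
      EigenvaluesAre (heckeU ψ k) (eisSpace n ψ k s) (eigenSet n p k s)) ∧
    -- the holomorphic series of weight `k`
    ((n : ℤ) + 1 < k →
      EigenvaluesAre (heckeU ψ k) (holEisSpace n ψ k) (holEigenSet n p k)) ∧
    -- the meromorphically continued series
    (∀ F : Fin (n + 1) → UpperHalfSpace n → ℂ → ℂ,
      (∀ r : Fin (n + 1), IsMeromorphicContinuation ψ k r (F r)) →
      (∀ᶠ s in Filter.codiscrete ℂ, LinearIndependent ℂ (fun r Z => F r Z s)) ∧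
      ∀ s : ℂ, (∀ r Z, AnalyticAt ℂ (F r Z) s) →
        (∀ f ∈ spanOf (fun r Z => F r Z s), heckeU ψ k f ∈ spanOf (fun r Z => F r Z s)) ∧
        {c | IsEigenvalue (heckeU ψ k) (spanOf fun r Z => F r Z s) c} ⊆ eigenSet n p k s ∧
        (LinearIndependent ℂ (fun r Z => F r Z s) →
          EigenvaluesAre (heckeU ψ k) (spanOf fun r Z => F r Z s) (eigenSet n p k s) ∧
          (s = (k : ℂ) / 2 →
            EigenvaluesAre (heckeU ψ k) (spanOf fun r Z => F r Z s) (holEigenSet n p k)))) := by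
  have hq := isSquareTrivial_of_eq hψ
  have h1 : ∀ s : ℂ, (n : ℝ) + 1 < 2 * s.re →
      EigenvaluesAre (heckeU ψ k) (eisSpace n ψ k s) (eigenSet n p k s) := fun s hs =>
    (heckeAction_eisenstein hq hk hs).eigenvaluesAre hq (linearIndependent_eisenstein hq hk hs)
  refine ⟨h1, fun hkn => ?_, fun F hF => ⟨eventually_linearIndependent hq hk hF, fun s hs => ?_⟩⟩
  · have h2 := h1 ((k : ℂ) / 2) (by
      have h3 : (n : ℝ) + 1 < k := by exact_mod_cast hkn
      have h4 : ((k : ℂ) / 2).re = (k : ℝ) / 2 := by simp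
      rw [h4]
      linarith)
    rw [eigenSet_half] at h2
    have h3 : eisSpace n ψ k ((k : ℂ) / 2) = holEisSpace n ψ k := by
      simp only [eisSpace, holEisSpace, eisenstein_half]
    rwa [h3] at h2
  · have hU := heckeAction_continuation hq hk hF hs
    refine ⟨hU.stable, hU.subset hq, fun hE => ⟨hU.eigenvaluesAre hq hE, fun hsk => ?_⟩⟩
    have h2 := hU.eigenvaluesAre hq hE
    rw [hsk, eigenSet_half, ← hsk] at h2
    exact h2
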